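/- Let $n,k$ be integers with $0\le k\le n-2$, let $0<a<\pi/10$, and write $\mathbb{R}^{n+1}=\mathbb{R}^{n-k}\oplus\mathbb{R}^{k+1}$. For small $\varepsilon>0$ set $$f_\varepsilon(r)=\varepsilon\int_1^{r/\varepsilon}\frac{dt}{\sqrt{t^{2(n-k-1)}-1}},\qquad r\ge\varepsilon .$$ Call $(\varphi_\varepsilon)$ an admissible family if, for every small $\varepsilon>0$, $\varphi_\varepsilon:[\varepsilon,\frac{\pi}{2}]\to\mathbb{R}$ is smooth on $(\varepsilon,\frac{\pi}{2}]$, equals $f_\varepsilon$ on $[\varepsilon,a+\varepsilon]$, is strictly concave on $(\varepsilon,2a+\varepsilon]$ and equals a constant $b_\varepsilon<\frac12$ on $[2a+\varepsilon,\frac{\pi}{2}]$, and if, as $\varepsilon\to0$, $\varphi_\varepsilon\to0$ uniformly on $[\varepsilon,\frac{\pi}{2}]$ and $\varphi_\varepsilon'\to0$, $\varphi_\varepsilon''\to0$ uniformly on every compact subset of $(0,\frac{\pi}{2}]$. For a function $\varphi$ on $[\varepsilon,\frac{\pi}{2}]$ let $X_\varphi\subset\mathbb{R}^{n+1}$ be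 the image of $$\mathbb{S}^{n-k-1}\times\mathbb{S}^{k}\times[\varepsilon,\tfrac{\pi}{2}]\to\mathbb{R}^{n+1},\qquad (y,z,r)\mapsto(1+\varphi(r))\bigl((\sin r)\,y+(\cos r)\,z\bigr),$$ and put $M_\varepsilon^k=X_{\varphi_\varepsilon}\cup X_{-\varphi_\varepsilon}$. Then admissible families exist, and for every admissible family, $M_\varepsilon^k$ is a compact smooth embedded hypersurface of $\mathbb{R}^{n+1}$ for all small $\varepsilon>0$. Moreover, let $B_\varepsilon(u,v)=\langle\nabla^0_u\nu,v\rangle$ and $H_\varepsilon=\frac1n\operatorname{tr}B_\varepsilon$ be its second fundamental form and mean curvature, where at each point $X$ the local unit normal field $\nu$ is the one with $\langle\nu,X\rangle>0$ (at the points of $X_{\varphi_\varepsilon}\cap X_{-\varphi_\varepsilon}$, a null set where $\langle\nu,X\rangle=0$, either choice is allowed), let $|B_\varepsilon|$ be the operator norm of $B_\varepsilon$, let $\|f\|_p^p=\frac{1}{\mathrm{Vol}\,M_\varepsilon^k}\int_{M_\varepsilon^k}|f|^p\,dv$, and let $\|f\|_\infty=\sup_{M_\varepsilon^k}|f|$.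 Then, as $\varepsilon\to0$, $$\|H_\varepsilon\|_\infty\ \text{ and }\ \|B_\varepsilon\|_{n-k}\ \text{ remain bounded},\qquad \|H_\varepsilon-1\|_1\to0,\qquad \bigl\||X|-1\bigr\|_\infty\to0 .$$ -/

import Mathlib

open Real Set Filter Topology MeasureTheory
open scoped ENNReal ContDiff RealInnerProductSpace

noncomputable section

/-! ### Hypersurfaces of a Euclidean space -/

section Hypersurface

variable {V : Type*} [NormedAddCommGroup V] [InnerProductSpace ℝ V]

/-- `M` is a smooth embedded hypersurface (without boundary): near each of its points it is the
zero set of a smooth function whose differential does not vanish on `M`. -/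
def IsSmoothHypersurface (M : Set V) : Prop :=
  ∀ p ∈ M, ∃ (U : Set V) (F : V → ℝ), IsOpen U ∧ p ∈ U ∧ ContDiffOn ℝ ∞ F U ∧
    (∀ x ∈ M ∩ U, fderiv ℝ F x ≠ 0) ∧ M ∩ U = {x ∈ U | F x = 0}

/-- The tangent space of `M` at `p`, spanned by the velocities at `p` of the curves in `M`. -/
def tangentSpaceAt (M : Set V) (p : V) : Submodule ℝ V :=
  Submodule.span ℝ {v | ∃ γ : ℝ → V, γ 0 = p ∧ (∀ᶠ t in 𝓝 0, γ t ∈ M) ∧ HasDerivAt γ v 0}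

/-- `ν` is (the restriction to `M` of) a smooth unit normal field of `M` near `p`. -/
def IsUnitNormalNear (M : Set V) (p : V) (ν : V → V) : Prop :=
  ContDiffAt ℝ ∞ ν p ∧ ∀ᶠ x in 𝓝[M] p, ‖ν x‖ = 1 ∧ ν x ∈ (tangentSpaceAt M x)ᗮ

/-- The second fundamental form `B(u, v) = ⟪∇_u ν, v⟫` at `p` associated with the unit normal
field `ν`, for tangent vectors `u`, `v` at `p`. -/
def secondFundamentalForm (ν : V → V) (p u v : V) : ℝ :=
  ⟪fderiv ℝ ν p u, v⟫

open Classical in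
/-- A smooth unit normal field of the hypersurface `M` near `p`, pointing away from the origin
at `p` (`⟪ν p, p⟫ > 0`) if there is such a field, and any unit normal field near `p` otherwise. -/
def outerNormal (M : Set V) (p : V) : V → V :=
  if h : ∃ ν, IsUnitNormalNear M p ν ∧ 0 < ⟪ν p, p⟫ then h.choose
  else if h : ∃ ν, IsUnitNormalNear M p ν then h.choose
  else 0

/-- The mean curvature `H = (1/n) tr B` of `M` at `p`, where `n` is the dimension of `M`. -/
def meanCurvature [FiniteDimensional ℝ V] (M : Set V) (p : V) : ℝ :=
  (∑ i, secondFundamentalForm (outerNormal M p) p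
      (stdOrthonormalBasis ℝ (tangentSpaceAt M p) i)
      (stdOrthonormalBasis ℝ (tangentSpaceAt M p) i)) /
    Module.finrank ℝ (tangentSpaceAt M p)

/-- The operator norm `|B|` at `p` of the second fundamental form of `M`, that is, the largest
absolute value of a principal curvature. -/
def normSecondFundamentalForm (M : Set V) (p : V) : ℝ :=
  sSup {t | ∃ u ∈ tangentSpaceAt M p, ∃ v ∈ tangentSpaceAt M p, ‖u‖ ≤ 1 ∧ ‖v‖ ≤ 1 ∧
    t = |secondFundamentalForm (outerNormal M p) p u v|}

/-- The renormalized `L^q`-norm `‖f‖_q = (Vol(M)⁻¹ ∫_M |f|^q dv)^(1/q)` on the `n`-dimensional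
submanifold `M`, whose Riemannian volume is its `n`-dimensional Hausdorff measure. -/
def renormLpNorm [MeasurableSpace V] [BorelSpace V] (n : ℕ) (M : Set V) (q : ℝ≥0∞) (f : V → ℝ) :
    ℝ≥0∞ :=
  eLpNorm f q ((μHE[n] M)⁻¹ • (μHE[n] : Measure V).restrict M)

/-- The norm `‖f‖_∞` on `M`. -/
def supNorm (M : Set V) (f : V → ℝ) : ℝ≥0∞ := ⨆ p ∈ M, ‖f p‖ₑ

end Hypersurface

/-! ### The hypersurfaces obtained by gluing two perturbed spheres -/

/-- `ℝ^{n+1} = ℝ^{n-k} ⊕ ℝ^{k+1}` with its Euclidean structure. -/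
abbrev SplitSpace (n k : ℕ) : Type :=
  WithLp 2 (EuclideanSpace ℝ (Fin (n - k)) × EuclideanSpace ℝ (Fin (k + 1)))

/-- The map `Φ_φ(y, z, r) = (1 + φ(r)) ((sin r) y + (cos r) z)`. -/
def gluingMap (n k : ℕ) (φ : ℝ → ℝ)
    (x : EuclideanSpace ℝ (Fin (n - k)) × EuclideanSpace ℝ (Fin (k + 1)) × ℝ) : SplitSpace n k :=
  (1 + φ x.2.2) • WithLp.toLp 2 (sin x.2.2 • x.1, cos x.2.2 • x.2.1)

/-- `X_φ`, the image under `Φ_φ` of `S^{n-k-1} × S^k × [ε, π/2]`. -/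
def gluingPiece (n k : ℕ) (ε : ℝ) (φ : ℝ → ℝ) : Set (SplitSpace n k) :=
  gluingMap n k φ '' (Metric.sphere 0 1 ×ˢ (Metric.sphere 0 1 ×ˢ Icc ε (π / 2)))

/-- `M_ε^k = X_φ ∪ X_{-φ}`. -/
def gluedHypersurface (n k : ℕ) (ε : ℝ) (φ : ℝ → ℝ) : Set (SplitSpace n k) :=
  gluingPiece n k ε φ ∪ gluingPiece n k ε (-φ)

/-- `f_ε(r) = ε ∫_1^{r/ε} dt / √(t^{2(n-k-1)} - 1)`. -/
def neckProfile (n k : ℕ) (ε r : ℝ) : ℝ :=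
  ε * ∫ t in (1 : ℝ)..(r / ε), 1 / √(t ^ (2 * (n - k - 1)) - 1)

/-- `φ` is an admissible profile `φ_ε` on `[ε, π/2]`. -/
structure IsGluingProfile (n k : ℕ) (a ε : ℝ) (φ : ℝ → ℝ) : Prop where
  smooth : ContDiffOn ℝ ∞ φ (Ioc ε (π / 2))
  eq_neck : ∀ r ∈ Icc ε (a + ε), φ r = neckProfile n k ε r
  strictConcave : StrictConcaveOn ℝ (Ioc ε (2 * a + ε)) φ
  eq_const : ∃ b < (1 / 2 : ℝ), ∀ r ∈ Icc (2 * a + ε) (π / 2), φ r = b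

/-- `(φ_ε)` is an admissible family of profiles, defined for small `ε > 0`: as `ε → 0`, `φ_ε → 0`
uniformly on `[ε, π/2]`, and `φ_ε' → 0`, `φ_ε'' → 0` uniformly on the compact subsets of
`(0, π/2]`. -/
structure IsGluingFamily (n k : ℕ) (a : ℝ) (φ : ℝ → ℝ → ℝ) : Prop where
  profile : ∀ᶠ ε in 𝓝[>] 0, IsGluingProfile n k a ε (φ ε)
  tendsto_zero : ∀ η > 0, ∀ᶠ ε in 𝓝[>] 0, ∀ r ∈ Icc ε (π / 2), |φ ε r| < η
  deriv_tendsto_zero : ∀ K ⊆ Ioc 0 (π / 2), IsCompact K →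
    TendstoUniformlyOn (fun ε r ↦ derivWithin (φ ε) (Ioc ε (π / 2)) r) 0 (𝓝[>] 0) K
  deriv2_tendsto_zero : ∀ K ⊆ Ioc 0 (π / 2), IsCompact K →
    TendstoUniformlyOn (fun ε r ↦ iteratedDerivWithin 2 (φ ε) (Ioc ε (π / 2)) r) 0 (𝓝[>] 0) K

end

/-! In polar coordinates, with `r` the polar angle, the hypersurface consists of the two sheets `‖x‖
= 1 ± φ(r)`, which meet only at `r = ε`. Write `ρ = 1 ± φ`, `p = ρ'`, `W = √(ρ² + p²)` and `q = n -
k - 1`. The principal curvatures are `(1 - p cot r / ρ) / W` with multiplicity `q`, `(1 + p tan r /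
ρ) / W` with multiplicity `k`, and `(ρ² + 2p² - ρp') / W³` (`IsPolarGraph.inner_fderiv_normal`,
`IsPolarGraph.meanCurvature_eq`).

On the neck the profile is a generalized catenoid, so `p' = -(q/r) p (1 + p²)`. The curvatures along
the first sphere and along the profile are each of size `(ε/r)^q / r`, but in the trace their
singular parts cancel up to a bounded error, because `|φ| ≤ r` and `1/r - cot r` is bounded
(`abs_neck_trace_le`). Hence `H` is bounded. The part `r ≤ R` has volume `O(R^(n-k))`, so the
integral of `((ε/r)^q / r)^(n-k)` over dyadic shells is a geometric series bounded independently of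
`ε` (`setLIntegral_neck_le`). Away from the neck, `C²` convergence of `φ` to `0` makes all
curvatures tend to `1`; the pole of `tan r` at the equator is harmless because the profile is
constant there (`curvature_far`). Small neck volume, bounded `H` and a lower bound on the total
volume give convergence of `H` to `1` in `L¹`.

At `r = ε` the slope is infinite. In the parameter `w` with radius `ε (cosh w)^(1/q)` the two sheets
form one regular curve, along which the polar angle is a smooth function of `‖x‖`
(`exists_neck_chart`). No curvature is computed there: the bounds pass to the neck circle by
continuity, in a form insensitive to the sign of the normal.

Existence is obtained by multiplying the slope of the catenoid by a smooth cutoff and integrating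
(`isGluingFamily_cutoffProfile`). -/

noncomputable section

set_option linter.unusedSectionVars false

/-! ### Unit normals and second fundamental forms of implicit hypersurfaces -/

section LocalNormal

variable {V : Type*} [NormedAddCommGroup V] [InnerProductSpace ℝ V]

/-- On the open set `U`, the field `N` is smooth, has unit length, and spans the normal line of
the hypersurface `M` at the points of `M`. -/
structure IsLocalNormal (M U : Set V) (N : V → V) : Prop where
  isOpen : IsOpen U
  contDiffOn : ContDiffOn ℝ ∞ N U
  norm_eq_one : ∀ x ∈ U, ‖N x‖ = 1
  tangentSpaceAt_eq : ∀ x ∈ M ∩ U, tangentSpaceAt M x = (ℝ ∙ N x)ᗮ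

/-- Differentiating `F ∘ γ = 0` gives one inclusion. For the other, the implicit function theorem
parametrizes the zero set over the kernel, and the image of the line `t • w` is a curve in `M` with
the prescribed velocity. -/
theorem tangentSpaceAt_eq_ker [CompleteSpace V] {M U : Set V} {F : V → ℝ} (hU : IsOpen U)
    (hF : ContDiffOn ℝ ∞ F U) (hM : M ∩ U = {x ∈ U | F x = 0}) {p : V} (hp : p ∈ M ∩ U)
    (hd : fderiv ℝ F p ≠ 0) : tangentSpaceAt M p = (fderiv ℝ F p).ker := by
  have hFp : ContDiffAt ℝ ∞ F p := hF.contDiffAt (hU.mem_nhds hp.2)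
  have hF0 : F p = 0 := by
    have : p ∈ {x ∈ U | F x = 0} := hM ▸ hp
    exact this.2
  apply le_antisymm
  · refine Submodule.span_le.2 ?_
    rintro v ⟨γ, hγ0, hγM, hγ⟩
    have hγU : ∀ᶠ t in 𝓝 0, γ t ∈ U :=
      hγ.continuousAt.eventually_mem (by rw [hγ0]; exact hU.mem_nhds hp.2)
    have h0 : (F ∘ γ) =ᶠ[𝓝 0] fun _ ↦ (0 : ℝ) := by
      filter_upwards [hγU, hγM] with t h1 h2
      have : γ t ∈ {x ∈ U | F x = 0} := hM ▸ ⟨h2, h1⟩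
      exact this.2
    have h1 : HasFDerivAt F (fderiv ℝ F p) (γ 0) := by
      rw [hγ0]; exact (hFp.differentiableAt (by simp)).hasFDerivAt
    have h2 := (h1.comp_hasDerivAt 0 hγ).congr_of_eventuallyEq h0.symm
    have := h2.unique (hasDerivAt_const (0 : ℝ) (0 : ℝ))
    simpa using this
  · intro v hv
    have hs : HasStrictFDerivAt F (fderiv ℝ F p) p := hFp.hasStrictFDerivAt (by simp)
    have hr : (fderiv ℝ F p).range = ⊤ := by
      refine LinearMap.range_eq_top.2 (LinearMap.surjective ?_)
      intro h
      exact hd (ContinuousLinearMap.coe_injective h)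
    let g := hs.implicitFunction F (fderiv ℝ F p) hr (F p)
    have hg : HasStrictFDerivAt g (fderiv ℝ F p).ker.subtypeL 0 := hs.to_implicitFunction hr
    have hg0 : g 0 = p := hs.implicitFunction_apply_image hr
    let w : (fderiv ℝ F p).ker := ⟨v, hv⟩
    have hl : HasDerivAt (fun t : ℝ ↦ t • w) w 0 := by
      simpa using (hasDerivAt_id (0 : ℝ)).smul_const w
    have hc : HasDerivAt (fun t : ℝ ↦ g (t • w)) v 0 := by
      have hg' : HasFDerivAt g (fderiv ℝ F p).ker.subtypeL ((0 : ℝ) • w) := by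
        rw [zero_smul]; exact hg.hasFDerivAt
      exact hg'.comp_hasDerivAt (0 : ℝ) hl
    refine Submodule.subset_span ⟨fun t ↦ g (t • w), by simp [hg0], ?_, hc⟩
    have h1 : ∀ᶠ t : ℝ in 𝓝 0, g (t • w) ∈ U :=
      hc.continuousAt.eventually_mem (by simpa [hg0] using hU.mem_nhds hp.2)
    have h2 : Tendsto (fun t : ℝ ↦ (F p, t • w)) (𝓝 0) (𝓝 (F p, 0)) := by
      refine tendsto_const_nhds.prodMk_nhds ?_
      simpa using hl.continuousAt.tendsto
    filter_upwards [h1, h2.eventually (hs.map_implicitFunction_eq hr)] with t ht1 ht2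
    have : g (t • w) ∈ {x ∈ U | F x = 0} := ⟨ht1, ht2.trans hF0⟩
    rw [← hM] at this
    exact this.1

/-- Proportionality of `dF` and `N` is needed only on `M`. Off `M` the field may be any smooth unit
field, which allows the explicit rotation invariant normals used for polar graphs. -/
theorem isLocalNormal_of_fderiv_eq [CompleteSpace V] {M U : Set V} {F : V → ℝ} {N : V → V}
    {c : V → ℝ} (hU : IsOpen U) (hF : ContDiffOn ℝ ∞ F U) (hM : M ∩ U = {x ∈ U | F x = 0})
    (hN : ContDiffOn ℝ ∞ N U) (hN1 : ∀ x ∈ U, ‖N x‖ = 1)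
    (hFN : ∀ x ∈ M ∩ U, c x ≠ 0 ∧ ∀ u, fderiv ℝ F x u = c x * ⟪N x, u⟫) :
    IsLocalNormal M U N where
  isOpen := hU
  contDiffOn := hN
  norm_eq_one := hN1
  tangentSpaceAt_eq x hx := by
    obtain ⟨hc, h⟩ := hFN x hx
    have hd : fderiv ℝ F x ≠ 0 := by
      intro h0
      have := h (N x)
      rw [h0, real_inner_self_eq_norm_sq, hN1 x hx.2] at this
      simp [eq_comm, hc] at this
    rw [tangentSpaceAt_eq_ker hU hF hM hx hd]
    ext u
    rw [Submodule.mem_orthogonal_singleton_iff_inner_right]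
    simp [LinearMap.mem_ker, h u, hc]

theorem IsSmoothHypersurface.exists_isLocalNormal [CompleteSpace V] {M : Set V}
    (hM : IsSmoothHypersurface M) {p : V} (hp : p ∈ M) :
    ∃ U N, p ∈ U ∧ IsLocalNormal M U N := by
  obtain ⟨U, F, hU, hpU, hF, hd, hMU⟩ := hM p hp
  let G : V → V := fun x ↦ (InnerProductSpace.toDual ℝ V).symm (fderiv ℝ F x)
  have hG : ContDiffOn ℝ ∞ G U := by
    have h1 : ContDiffOn ℝ ∞ (fderiv ℝ F) U := hF.fderiv_of_isOpen hU (by simp)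
    exact ((InnerProductSpace.toDual ℝ V).symm.toContinuousLinearEquiv
      |>.toContinuousLinearMap.contDiff (n := ∞)).comp_contDiffOn h1
  have hG0 : ∀ x ∈ M ∩ U, G x ≠ 0 := fun x hx h ↦ hd x hx (by simpa [G] using h)
  -- The differential is nonzero only on `M`, so the neighbourhood is shrunk before the gradient is
  -- normalized.
  let U' := U ∩ G ⁻¹' {0}ᶜ
  have hU' : IsOpen U' := hG.continuousOn.isOpen_inter_preimage hU isOpen_compl_singleton
  have hsub : U' ⊆ U := inter_subset_left
  have hn : ∀ x ∈ U', ‖G x‖ ≠ 0 := fun x hx ↦ norm_ne_zero_iff.2 hx.2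
  refine ⟨U', fun x ↦ ‖G x‖⁻¹ • G x, ⟨hpU, hG0 p ⟨hp, hpU⟩⟩,
    isLocalNormal_of_fderiv_eq (F := F) (c := fun x ↦ ‖G x‖) hU' (hF.mono hsub) ?_ ?_ ?_ ?_⟩
  · ext x
    have := Set.ext_iff.1 hMU x
    simp only [mem_inter_iff, mem_ofPred_eq] at this ⊢
    constructor
    · rintro ⟨h1, h2⟩
      exact ⟨h2, (this.1 ⟨h1, h2.1⟩).2⟩
    · rintro ⟨h1, h2⟩
      exact ⟨(this.2 ⟨h1.1, h2⟩).1, h1⟩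
  · exact (((hG.mono hsub).norm ℝ (fun x hx ↦ hx.2)).inv hn).smul (hG.mono hsub)
  · intro x hx
    rw [norm_smul, norm_inv, norm_norm, inv_mul_cancel₀ (hn x hx)]
  · intro x hx
    refine ⟨hn x hx.2, fun u ↦ ?_⟩
    rw [real_inner_smul_left, mul_inv_cancel_left₀ (hn x hx.2)]
    simp [G]

namespace IsLocalNormal

variable {M U : Set V} {N : V → V} {p : V}

theorem isUnitNormalNear (h : IsLocalNormal M U N) (hp : p ∈ M ∩ U) : IsUnitNormalNear M p N := by
  refine ⟨h.contDiffOn.contDiffAt (h.isOpen.mem_nhds hp.2), ?_⟩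
  filter_upwards [self_mem_nhdsWithin, mem_nhdsWithin_of_mem_nhds (h.isOpen.mem_nhds hp.2)]
    with x hx hxU
  refine ⟨h.norm_eq_one x hxU, ?_⟩
  rw [h.tangentSpaceAt_eq x ⟨hx, hxU⟩]
  exact Submodule.le_orthogonal_orthogonal _ (Submodule.mem_span_singleton_self _)

theorem outerNormal_isUnitNormalNear (h : IsLocalNormal M U N) (hp : p ∈ M ∩ U) :
    IsUnitNormalNear M p (outerNormal M p) := by
  unfold outerNormal
  split_ifs with h1 h2
  · exact h1.choose_spec.1
  · exact h2.choose_spec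
  · exact absurd ⟨N, h.isUnitNormalNear hp⟩ h2

theorem outerNormal_inner_pos (h : IsLocalNormal M U N) (hp : p ∈ M ∩ U) (hpos : 0 < ⟪N p, p⟫) :
    0 < ⟪outerNormal M p p, p⟫ := by
  have h1 : ∃ ν, IsUnitNormalNear M p ν ∧ 0 < ⟪ν p, p⟫ := ⟨N, h.isUnitNormalNear hp, hpos⟩
  unfold outerNormal
  rw [dif_pos h1]
  exact h1.choose_spec.2

/-- Two unit normal fields agree up to a sign near a point of the hypersurface. -/
theorem exists_sign_eventuallyEq (h : IsLocalNormal M U N) (hp : p ∈ M ∩ U) {ν : V → V}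
    (hν : IsUnitNormalNear M p ν) :
    ∃ σ : ℝ, (σ = 1 ∨ σ = -1) ∧ ∀ᶠ x in 𝓝[M] p, ν x = σ • N x := by
  have key : ∀ᶠ x in 𝓝[M] p, ν x = ⟪N x, ν x⟫ • N x ∧ (⟪N x, ν x⟫ = 1 ∨ ⟪N x, ν x⟫ = -1) := by
    filter_upwards [hν.2, self_mem_nhdsWithin,
      mem_nhdsWithin_of_mem_nhds (h.isOpen.mem_nhds hp.2)] with x hx hxM hxU
    obtain ⟨h1, h2⟩ := hx
    rw [h.tangentSpaceAt_eq x ⟨hxM, hxU⟩, Submodule.orthogonal_orthogonal,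
      Submodule.mem_span_singleton] at h2
    obtain ⟨c, hc⟩ := h2
    have hN := h.norm_eq_one x hxU
    have h3 : ⟪N x, ν x⟫ = c := by
      rw [← hc, real_inner_smul_right, real_inner_self_eq_norm_sq, hN]; simp
    rw [h3]
    refine ⟨hc.symm, ?_⟩
    rw [← hc, norm_smul, hN, mul_one, Real.norm_eq_abs] at h1
    exact (abs_eq zero_le_one).1 h1
  have hcont : ContinuousAt (fun x ↦ ⟪N x, ν x⟫) p :=
    (h.contDiffOn.contDiffAt (h.isOpen.mem_nhds hp.2)).continuousAt.inner hν.1.continuousAt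
  have hσ := (key.self_of_nhdsWithin hp.1).2
  refine ⟨⟪N p, ν p⟫, hσ, ?_⟩
  have hnear : ∀ᶠ x in 𝓝[M] p, |⟪N x, ν x⟫ - ⟪N p, ν p⟫| < 1 := by
    have := Metric.continuousAt_iff'.1 hcont 1 one_pos
    exact mem_nhdsWithin_of_mem_nhds this
  filter_upwards [key, hnear] with x hx hx'
  obtain ⟨h1, h2⟩ := hx
  have : ⟪N x, ν x⟫ = ⟪N p, ν p⟫ := by
    -- Two numbers in `{1, -1}` at distance less than `1` are equal.
    rcases h2 with h2 | h2 <;> rcases hσ with h3 | h3 <;> rw [h2, h3] at hx' ⊢ <;>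
      norm_num at hx'
  rw [← this]
  exact h1

/-- `outerNormal` comes from a choice and is controlled only on `M`. Its derivative in tangent
directions is nevertheless determined, since it can be computed along curves lying in `M`. -/
theorem exists_sign_fderiv_outerNormal (h : IsLocalNormal M U N) (hp : p ∈ M ∩ U) :
    ∃ σ : ℝ, (σ = 1 ∨ σ = -1) ∧ (0 < ⟪N p, p⟫ → σ = 1) ∧
      ∀ u ∈ tangentSpaceAt M p, fderiv ℝ (outerNormal M p) p u = σ • fderiv ℝ N p u := by
  have hν := h.outerNormal_isUnitNormalNear hp
  obtain ⟨σ, hσ, heq⟩ := h.exists_sign_eventuallyEq hp hν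
  refine ⟨σ, hσ, fun hpos ↦ ?_, fun u hu ↦ ?_⟩
  · have h1 := h.outerNormal_inner_pos hp hpos
    rw [heq.self_of_nhdsWithin hp.1, real_inner_smul_left] at h1
    rcases hσ with h2 | h2
    · exact h2
    · rw [h2] at h1; linarith
  · refine Submodule.span_induction (p := fun u _ ↦
      fderiv ℝ (outerNormal M p) p u = σ • fderiv ℝ N p u) ?_ (by simp) ?_ ?_ hu
    · rintro v ⟨γ, hγ0, hγM, hγ⟩
      have h1 : HasDerivAt (outerNormal M p ∘ γ) (fderiv ℝ (outerNormal M p) p v) 0 := by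
        refine HasFDerivAt.comp_hasDerivAt 0 ?_ hγ
        rw [hγ0]
        exact (hν.1.differentiableAt (by simp)).hasFDerivAt
      have h2 : HasDerivAt (N ∘ γ) (fderiv ℝ N p v) 0 := by
        refine HasFDerivAt.comp_hasDerivAt 0 ?_ hγ
        rw [hγ0]
        exact ((h.isUnitNormalNear hp).1.differentiableAt (by simp)).hasFDerivAt
      have h3 : Tendsto γ (𝓝 0) (𝓝[M] p) := by
        refine tendsto_nhdsWithin_iff.2 ⟨?_, hγM⟩
        rw [← hγ0]; exact hγ.continuousAt.tendsto
      have h4 : (fun t ↦ outerNormal M p (γ t)) =ᶠ[𝓝 0] fun t ↦ σ • N (γ t) := h3.eventually heq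
      exact h1.unique ((h2.const_smul σ).congr_of_eventuallyEq h4)
    · intro x y _ _ hx hy
      simp [hx, hy]
    · intro c x _ hx
      simp [hx, smul_comm c σ]

theorem abs_secondFundamentalForm (h : IsLocalNormal M U N) (hp : p ∈ M ∩ U) {u : V}
    (hu : u ∈ tangentSpaceAt M p) (v : V) :
    |secondFundamentalForm (outerNormal M p) p u v| = |⟪fderiv ℝ N p u, v⟫| := by
  obtain ⟨σ, h1, -, h3⟩ := h.exists_sign_fderiv_outerNormal hp
  unfold secondFundamentalForm
  rw [h3 u hu, real_inner_smul_left, abs_mul]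
  rcases h1 with h1 | h1 <;> simp [h1]

theorem mem_tangentSpaceAt_iff (h : IsLocalNormal M U N) (hp : p ∈ M ∩ U) {u : V} :
    u ∈ tangentSpaceAt M p ↔ ⟪N p, u⟫ = 0 := by
  rw [h.tangentSpaceAt_eq p hp, Submodule.mem_orthogonal_singleton_iff_inner_right]

theorem sub_mem_tangentSpaceAt (h : IsLocalNormal M U N) (hp : p ∈ M ∩ U) (u : V) :
    u - ⟪N p, u⟫ • N p ∈ tangentSpaceAt M p := by
  rw [h.mem_tangentSpaceAt_iff hp, inner_sub_right, real_inner_smul_right,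
    real_inner_self_eq_norm_sq, h.norm_eq_one p hp.2]
  simp

theorem norm_sub_le (h : IsLocalNormal M U N) (hp : p ∈ U) (u : V) :
    ‖u - ⟪N p, u⟫ • N p‖ ≤ ‖u‖ := by
  have h1 : ‖u - ⟪N p, u⟫ • N p‖ ^ 2 = ‖u‖ ^ 2 - ⟪N p, u⟫ ^ 2 := by
    rw [norm_sub_sq_real, norm_smul, h.norm_eq_one p hp, real_inner_smul_right, real_inner_comm]
    simp [sq_abs]
    ring
  exact abs_le_of_sq_le_sq' (by nlinarith [sq_nonneg ⟪N p, u⟫]) (norm_nonneg _) |>.2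

theorem finrank_tangentSpaceAt (h : IsLocalNormal M U N) (hp : p ∈ M ∩ U) {n : ℕ}
    (hn : Module.finrank ℝ V = n + 1) : Module.finrank ℝ (tangentSpaceAt M p) = n := by
  rw [h.tangentSpaceAt_eq p hp]
  have : Fact (Module.finrank ℝ V = n + 1) := ⟨hn⟩
  exact Submodule.finrank_orthogonal_span_singleton
    (norm_ne_zero_iff.1 (by rw [h.norm_eq_one p hp.2]; exact one_ne_zero))

variable [FiniteDimensional ℝ V]

theorem sum_inner_stdOrthonormalBasis_sq (h : IsLocalNormal M U N) (hp : p ∈ M ∩ U) (w : V) :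
    ∑ i, ⟪(stdOrthonormalBasis ℝ (tangentSpaceAt M p) i : V), w⟫ ^ 2 = ‖w‖ ^ 2 - ⟪N p, w⟫ ^ 2 := by
  set T := tangentSpaceAt M p with hT
  let w' : T := ⟨w - ⟪N p, w⟫ • N p, h.sub_mem_tangentSpaceAt hp w⟩
  have h1 : ∀ i, ⟪(stdOrthonormalBasis ℝ T i : V), w⟫ = ⟪stdOrthonormalBasis ℝ T i, w'⟫ := by
    intro i
    have := (h.mem_tangentSpaceAt_iff hp).1 (stdOrthonormalBasis ℝ T i).2
    rw [Submodule.coe_inner, inner_sub_right, real_inner_smul_right,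
      real_inner_comm (N p) (stdOrthonormalBasis ℝ T i : V), this]
    simp
  simp_rw [h1]
  have h2 := (stdOrthonormalBasis ℝ T).sum_sq_norm_inner_right w'
  simp only [Real.norm_eq_abs, sq_abs] at h2
  rw [h2, Submodule.coe_norm, norm_sub_sq_real, norm_smul, h.norm_eq_one p hp.2,
    real_inner_smul_right, real_inner_comm]
  simp [sq_abs]
  ring

/-- The trace of a bilinear form over the tangent space, computed in an orthonormal basis of the
ambient space. -/
theorem sum_stdOrthonormalBasis_eq {ι : Type*} [Fintype ι] (e : OrthonormalBasis ι ℝ V)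
    (h : IsLocalNormal M U N) (hp : p ∈ M ∩ U) (L : V →L[ℝ] V) :
    ∑ i, ⟪L (stdOrthonormalBasis ℝ (tangentSpaceAt M p) i),
      (stdOrthonormalBasis ℝ (tangentSpaceAt M p) i : V)⟫ =
    ∑ j, ⟪L (e j - ⟪N p, e j⟫ • N p), e j - ⟪N p, e j⟫ • N p⟫ := by
  set T := tangentSpaceAt M p with hT
  set b := stdOrthonormalBasis ℝ T with hb
  have h1 : ∀ j, e j - ⟪N p, e j⟫ • N p = ∑ i, ⟪(b i : V), e j⟫ • (b i : V) := by
    intro j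
    let w' : T := ⟨e j - ⟪N p, e j⟫ • N p, h.sub_mem_tangentSpaceAt hp _⟩
    have := congrArg (Subtype.val) (b.sum_repr' w').symm
    simp only [Submodule.coe_sum, Submodule.coe_smul, Submodule.coe_inner] at this
    rw [show (w' : V) = e j - ⟪N p, e j⟫ • N p from rfl] at this
    rw [this]
    refine Finset.sum_congr rfl fun i _ ↦ ?_
    have h2 := (h.mem_tangentSpaceAt_iff hp).1 (b i).2
    rw [inner_sub_right, real_inner_smul_right, real_inner_comm (N p) (b i : V), h2]
    simp
  -- The projected ambient basis is a Parseval frame of the tangent space, which is all that is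
  -- needed to compute a trace.
  have h3 : ∀ i l, ∑ j, ⟪(b i : V), e j⟫ * ⟪(b l : V), e j⟫ = if i = l then 1 else 0 := by
    intro i l
    have h4 := e.sum_inner_mul_inner (b i : V) (b l : V)
    simp_rw [real_inner_comm (b l : V)] at h4
    rw [h4, ← Submodule.coe_inner, orthonormal_iff_ite.1 b.orthonormal]
    simp only [eq_comm]
  simp_rw [h1, map_sum, map_smul, sum_inner, inner_sum, real_inner_smul_left,
    real_inner_smul_right]
  rw [Finset.sum_comm]
  refine Finset.sum_congr rfl fun i _ ↦ ?_
  rw [Finset.sum_comm]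
  have : ∀ l, ∑ j, ⟪(b i : V), e j⟫ * (⟪(b l : V), e j⟫ * ⟪L (b i), (b l : V)⟫) =
      if i = l then ⟪L (b i), (b l : V)⟫ else 0 := by
    intro l
    have h5 := h3 i l
    simp_rw [← mul_assoc]
    rw [← Finset.sum_mul, h5]
    split_ifs <;> simp
  simp_rw [this]
  simp

theorem exists_sign_meanCurvature (h : IsLocalNormal M U N) (hp : p ∈ M ∩ U) {n : ℕ}
    (hn : Module.finrank ℝ V = n + 1) :
    ∃ σ : ℝ, (σ = 1 ∨ σ = -1) ∧ (0 < ⟪N p, p⟫ → σ = 1) ∧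
      meanCurvature M p = σ * (∑ i, ⟪fderiv ℝ N p (stdOrthonormalBasis ℝ (tangentSpaceAt M p) i),
        (stdOrthonormalBasis ℝ (tangentSpaceAt M p) i : V)⟫) / n := by
  obtain ⟨σ, h1, h2, h3⟩ := h.exists_sign_fderiv_outerNormal hp
  refine ⟨σ, h1, h2, ?_⟩
  unfold meanCurvature secondFundamentalForm
  rw [Finset.mul_sum, show (n : ℝ) = Module.finrank ℝ (tangentSpaceAt M p) by
    rw [h.finrank_tangentSpaceAt hp hn]]
  congr 1
  refine Finset.sum_congr rfl fun i _ ↦ ?_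
  rw [h3 _ (Submodule.coe_mem _), real_inner_smul_left]

end IsLocalNormal

theorem normSecondFundamentalForm_nonneg (M : Set V) (p : V) :
    0 ≤ normSecondFundamentalForm M p := by
  refine Real.sSup_nonneg ?_
  rintro t ⟨u, -, v, -, -, -, rfl⟩
  exact abs_nonneg _

theorem normSecondFundamentalForm_le {M : Set V} {p : V} {C : ℝ} (hC : 0 ≤ C)
    (h : ∀ u ∈ tangentSpaceAt M p, ∀ v ∈ tangentSpaceAt M p,
      |secondFundamentalForm (outerNormal M p) p u v| ≤ C * (‖u‖ * ‖v‖)) :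
    normSecondFundamentalForm M p ≤ C := by
  refine Real.sSup_le ?_ hC
  rintro t ⟨u, hu, v, hv, hu1, hv1, rfl⟩
  refine (h u hu v hv).trans ?_
  have : ‖u‖ * ‖v‖ ≤ 1 := mul_le_one₀ hu1 (norm_nonneg _) hv1
  nlinarith

namespace IsSmoothHypersurface

variable {M : Set V} {p : V}

/-- Bounds on the mean curvature pass to limit points. -/
theorem abs_meanCurvature_le_of_frequently [FiniteDimensional ℝ V] (hM : IsSmoothHypersurface M) (hp : p ∈ M) {n : ℕ}
    (hn : Module.finrank ℝ V = n + 1) {C : ℝ}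
    (h : ∃ᶠ x in 𝓝[M] p, |meanCurvature M x| ≤ C) : |meanCurvature M p| ≤ C := by
  obtain ⟨U, N, hpU, hN⟩ := hM.exists_isLocalNormal hp
  let e := stdOrthonormalBasis ℝ V
  -- The tangent bases and the signs are chosen separately at every point. Written in one ambient
  -- basis and under an absolute value, the trace is continuous in `x`.
  let G : V → ℝ := fun x ↦
    |(∑ j, ⟪fderiv ℝ N x (e j - ⟪N x, e j⟫ • N x), e j - ⟪N x, e j⟫ • N x⟫) / n|
  have hG : ∀ x ∈ M ∩ U, |meanCurvature M x| = G x := by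
    intro x hx
    obtain ⟨σ, h1, -, h3⟩ := hN.exists_sign_meanCurvature hx hn
    rw [h3, hN.sum_stdOrthonormalBasis_eq e hx, mul_div_assoc, abs_mul]
    rcases h1 with h1 | h1 <;> simp [h1, G]
  have hNc : ContinuousAt N p := hN.contDiffOn.continuousOn.continuousAt (hN.isOpen.mem_nhds hpU)
  have hDc : ContinuousAt (fderiv ℝ N) p :=
    (hN.contDiffOn.continuousOn_fderiv_of_isOpen hN.isOpen (by simp)).continuousAt
      (hN.isOpen.mem_nhds hpU)
  have hGc : ContinuousAt G p := by
    have h1 : ∀ j, ContinuousAt (fun x ↦ e j - ⟪N x, e j⟫ • N x) p := fun j ↦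
      continuousAt_const.sub ((hNc.inner continuousAt_const).smul hNc)
    exact ((tendsto_finsetSum _ fun j _ ↦ ((hDc.clm_apply (h1 j)).inner (h1 j))).div_const _).abs
  rw [hG p ⟨hp, hpU⟩]
  refine le_of_tendsto_of_frequently (x := 𝓝[M] p)
      (hGc.tendsto.mono_left nhdsWithin_le_nhds) ?_
  refine (h.and_eventually (inter_mem_nhdsWithin M
    (hN.isOpen.mem_nhds hpU))).mono ?_
  rintro x ⟨h1, h2⟩
  rwa [← hG x h2]

/-- Bounds on the second fundamental form pass to limit points. -/
theorem abs_secondFundamentalForm_le_of_frequently [CompleteSpace V]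
    (hM : IsSmoothHypersurface M) (hp : p ∈ M)
    {c : V → ℝ} (hc : ContinuousAt c p) (hc0 : ∀ x, 0 ≤ c x)
    (h : ∃ᶠ x in 𝓝[M] p, ∀ u ∈ tangentSpaceAt M x, ∀ v ∈ tangentSpaceAt M x,
      |secondFundamentalForm (outerNormal M x) x u v| ≤ c x * (‖u‖ * ‖v‖)) :
    ∀ u ∈ tangentSpaceAt M p, ∀ v ∈ tangentSpaceAt M p,
      |secondFundamentalForm (outerNormal M p) p u v| ≤ c p * (‖u‖ * ‖v‖) := by
  intro u hu v hv
  obtain ⟨U, N, hpU, hN⟩ := hM.exists_isLocalNormal hp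
  -- Orthogonal projection extends a tangent vector at `p` continuously to tangent vectors at nearby
  -- points without increasing its length.
  let P : V → V → V := fun w x ↦ w - ⟪N x, w⟫ • N x
  have hNc : ContinuousAt N p := hN.contDiffOn.continuousOn.continuousAt (hN.isOpen.mem_nhds hpU)
  have hDc : ContinuousAt (fderiv ℝ N) p :=
    (hN.contDiffOn.continuousOn_fderiv_of_isOpen hN.isOpen (by simp)).continuousAt
      (hN.isOpen.mem_nhds hpU)
  have hP : ∀ w, ContinuousAt (P w) p := fun w ↦
      continuousAt_const.sub ((hNc.inner continuousAt_const).smul hNc)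
  have hPT : ∀ w ∈ tangentSpaceAt M p, P w p = w := by
    intro w hw
    simp [P, (hN.mem_tangentSpaceAt_iff ⟨hp, hpU⟩).1 hw]
  let G : V → ℝ := fun x ↦ |⟪fderiv ℝ N x (P u x), P v x⟫| - c x * (‖u‖ * ‖v‖)
  have hGc : ContinuousAt G p :=
    (((hDc.clm_apply (hP u)).inner (hP v)).abs).sub (hc.mul_const _)
  have : G p ≤ 0 := by
    refine le_of_tendsto_of_frequently (x := 𝓝[M] p)
      (hGc.tendsto.mono_left nhdsWithin_le_nhds) ?_
    refine (h.and_eventually (inter_mem_nhdsWithin M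
      (hN.isOpen.mem_nhds hpU))).mono ?_
    rintro x ⟨h1, h2⟩
    have h3 := h1 _ (hN.sub_mem_tangentSpaceAt h2 u) _ (hN.sub_mem_tangentSpaceAt h2 v)
    rw [hN.abs_secondFundamentalForm h2 (hN.sub_mem_tangentSpaceAt h2 u)] at h3
    have h4 : ‖u - ⟪N x, u⟫ • N x‖ * ‖v - ⟪N x, v⟫ • N x‖ ≤ ‖u‖ * ‖v‖ :=
      mul_le_mul (hN.norm_sub_le h2.2 u) (hN.norm_sub_le h2.2 v) (norm_nonneg _) (norm_nonneg _)
    exact sub_nonpos.2 (h3.trans (mul_le_mul_of_nonneg_left h4 (hc0 x)))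
  rw [hN.abs_secondFundamentalForm ⟨hp, hpU⟩ hu]
  simpa [G, hPT u hu, hPT v hv] using this

end IsSmoothHypersurface

end LocalNormal

/-! ### The generalized catenoid -/

section NeckProfile

/-- The profile of the generalized catenoid of neck radius `1`. -/
def catenoidProfile (q : ℕ) (s : ℝ) : ℝ :=
  ∫ t in (1 : ℝ)..s, 1 / √(t ^ (2 * q) - 1)

/-- The slope of the profile of the generalized catenoid of neck radius `ε`. -/
def neckSlope (q : ℕ) (ε r : ℝ) : ℝ :=
  1 / √((r / ε) ^ (2 * q) - 1)

theorem neckProfile_eq (n k : ℕ) (ε r : ℝ) :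
    neckProfile n k ε r = ε * catenoidProfile (n - k - 1) (r / ε) := rfl

variable {q : ℕ}

theorem sub_one_le_pow_sub_one (hq : 1 ≤ q) {t : ℝ} (ht : 1 ≤ t) : t - 1 ≤ t ^ (2 * q) - 1 := by
  have : t ^ 1 ≤ t ^ (2 * q) := pow_le_pow_right₀ ht (by lia)
  linarith [pow_one t]

theorem catenoid_integrand_le (hq : 1 ≤ q) {t : ℝ} (ht : 1 ≤ t) :
    1 / √(t ^ (2 * q) - 1) ≤ (t - 1) ^ (-(1 / 2) : ℝ) := by
  rcases ht.eq_or_lt with rfl | ht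
  -- At `t = 1` both sides take the conventional value `0`.
  · simp [Real.zero_rpow]
  rw [Real.rpow_neg (by linarith), ← Real.sqrt_eq_rpow, one_div]
  have : 0 < √(t - 1) := Real.sqrt_pos.2 (by linarith)
  exact inv_anti₀ this (Real.sqrt_le_sqrt (sub_one_le_pow_sub_one hq ht.le))

theorem intervalIntegrable_sub_one_rpow (s : ℝ) :
    IntervalIntegrable (fun t : ℝ ↦ (t - 1) ^ (-(1 / 2) : ℝ)) volume 1 s := by
  have h := (intervalIntegral.intervalIntegrable_rpow' (a := 0) (b := s - 1)
    (r := -(1 / 2)) (by norm_num)).comp_sub_right 1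
  simpa using h

theorem intervalIntegrable_catenoid (hq : 1 ≤ q) {s : ℝ} (hs : 1 ≤ s) :
    IntervalIntegrable (fun t : ℝ ↦ 1 / √(t ^ (2 * q) - 1)) volume 1 s := by
  refine (intervalIntegrable_sub_one_rpow s).mono_fun ?_ ?_
  · exact Measurable.aestronglyMeasurable (by fun_prop)
  · rw [uIoc_of_le hs]
    refine (ae_restrict_iff' measurableSet_Ioc).2 (ae_of_all _ fun t ht ↦ ?_)
    beta_reduce
    rw [Real.norm_of_nonneg (by positivity),
      Real.norm_of_nonneg (Real.rpow_nonneg (by linarith [ht.1]) _)]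
    exact catenoid_integrand_le hq ht.1.le

theorem catenoidProfile_one (q : ℕ) : catenoidProfile q 1 = 0 := by simp [catenoidProfile]

/-- Compare with the integral of `(t - 1)^(-1/2)`, which is explicit. -/
theorem catenoidProfile_le (hq : 1 ≤ q) {s : ℝ} (hs : 1 ≤ s) :
    catenoidProfile q s ≤ 2 * √(s - 1) := by
  have h1 : catenoidProfile q s ≤ ∫ t in (1 : ℝ)..s, (t - 1) ^ (-(1 / 2) : ℝ) :=
    intervalIntegral.integral_mono_on hs (intervalIntegrable_catenoid hq hs)
      (intervalIntegrable_sub_one_rpow s) fun t ht ↦ catenoid_integrand_le hq ht.1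
  refine h1.trans_eq ?_
  rw [intervalIntegral.integral_comp_sub_right (fun t ↦ t ^ (-(1 / 2) : ℝ)) 1,
    integral_rpow (Or.inl (by norm_num)), Real.sqrt_eq_rpow]
  norm_num
  ring

/-- This is `2√(s - 1) ≤ s`, the square of `√(s - 1) - 1` being nonnegative. It yields `φ(r) ≤ r` on
the neck, the bound behind the cancellation in the mean curvature. -/
theorem catenoidProfile_le_self (hq : 1 ≤ q) {s : ℝ} (hs : 1 ≤ s) : catenoidProfile q s ≤ s := by
  have h1 := catenoidProfile_le hq hs
  have h2 := Real.sq_sqrt (show 0 ≤ s - 1 by linarith)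
  nlinarith [sq_nonneg (√(s - 1) - 1)]

theorem continuousOn_catenoidProfile (hq : 1 ≤ q) : ContinuousOn (catenoidProfile q) (Ici 1) := by
  intro s hs
  have hs : 1 ≤ s := hs
  have h1 := intervalIntegral.continuousOn_primitive_interval'
    (intervalIntegrable_catenoid hq (show 1 ≤ s + 1 by linarith)) left_mem_uIcc
  rw [uIcc_of_le (by linarith)] at h1
  refine (h1 s ⟨hs, by linarith⟩).mono_of_mem_nhdsWithin ?_
  rw [← Ici_inter_Iic]
  exact inter_mem_nhdsWithin _ (Iic_mem_nhds (by linarith))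

theorem one_lt_pow_of_one_lt (hq : 1 ≤ q) {s : ℝ} (hs : 1 < s) : 0 < s ^ (2 * q) - 1 := by
  linarith [sub_one_le_pow_sub_one hq hs.le]

theorem hasDerivAt_catenoidProfile (hq : 1 ≤ q) {s : ℝ} (hs : 1 < s) :
    HasDerivAt (catenoidProfile q) (1 / √(s ^ (2 * q) - 1)) s := by
  refine intervalIntegral.integral_hasDerivAt_right (intervalIntegrable_catenoid hq hs.le) ?_ ?_
  · exact (Measurable.stronglyMeasurable (by fun_prop)).stronglyMeasurableAtFilter
  · have := Real.sqrt_pos.2 (one_lt_pow_of_one_lt hq hs)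
    fun_prop (disch := positivity)

theorem catenoidProfile_strictMonoOn (hq : 1 ≤ q) : StrictMonoOn (catenoidProfile q) (Ici 1) := by
  refine strictMonoOn_of_deriv_pos (convex_Ici 1) (continuousOn_catenoidProfile hq) ?_
  intro s hs
  rw [interior_Ici] at hs
  rw [(hasDerivAt_catenoidProfile hq hs).deriv]
  have := Real.sqrt_pos.2 (one_lt_pow_of_one_lt hq hs)
  positivity

/-! #### The neck of size `ε` -/

variable {ε r : ℝ}

theorem neckSlope_pos (hq : 1 ≤ q) (hε : 0 < ε) (hr : ε < r) : 0 < neckSlope q ε r := by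
  have := Real.sqrt_pos.2 (one_lt_pow_of_one_lt hq ((one_lt_div hε).2 hr))
  unfold neckSlope
  positivity

theorem neckSlope_sq (hq : 1 ≤ q) (hε : 0 < ε) (hr : ε < r) :
    neckSlope q ε r ^ 2 = 1 / ((r / ε) ^ (2 * q) - 1) := by
  unfold neckSlope
  rw [div_pow, Real.sq_sqrt (one_lt_pow_of_one_lt hq ((one_lt_div hε).2 hr)).le, one_pow]

theorem hasDerivAt_smul_catenoidProfile (hq : 1 ≤ q) (hε : 0 < ε) (hr : ε < r) :
    HasDerivAt (fun r ↦ ε * catenoidProfile q (r / ε)) (neckSlope q ε r) r := by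
  have h := ((hasDerivAt_catenoidProfile hq ((one_lt_div hε).2 hr)).comp r
    ((hasDerivAt_id r).div_const ε)).const_mul ε
  refine h.congr_deriv ?_
  unfold neckSlope
  simp
  field_simp

/-- This is the minimal surface equation of the catenoid. It expresses the second derivative of the
profile through the slope, so that curvature bounds involve no other unknown. -/
theorem hasDerivAt_neckSlope (hq : 1 ≤ q) (hε : 0 < ε) (hr : ε < r) :
    HasDerivAt (neckSlope q ε)
      (-(q / r) * neckSlope q ε r * (1 + neckSlope q ε r ^ 2)) r := by
  have hT := one_lt_pow_of_one_lt hq ((one_lt_div hε).2 hr)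
  have hr0 : 0 < r := hε.trans hr
  have hs := Real.sqrt_pos.2 hT
  have h1 : HasDerivAt (fun r : ℝ ↦ (r / ε) ^ (2 * q) - 1)
      ((2 * q : ℕ) * (r / ε) ^ (2 * q - 1) * (1 / ε)) r :=
    ((((hasDerivAt_id r).div_const ε).pow (2 * q))).sub_const 1
  have h2 := (h1.sqrt hT.ne').inv hs.ne'
  have h3 : neckSlope q ε = (fun r : ℝ ↦ √((r / ε) ^ (2 * q) - 1))⁻¹ := by
    ext r; simp [neckSlope]
  rw [h3]
  refine h2.congr_deriv ?_
  have h4 : (r / ε) ^ (2 * q) = (r / ε) ^ (2 * q - 1) * (r / ε) := by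
    rw [← pow_succ]; congr 1; lia
  have h5 := Real.sq_sqrt hT.le
  simp only [Pi.inv_apply]
  set A := √((r / ε) ^ (2 * q) - 1) with hA
  -- All powers of `r / ε` are eliminated in favour of `A`, which leaves a rational identity.
  have h6 : (r / ε) ^ (2 * q - 1) = (A ^ 2 + 1) * ε / r := by
    rw [h5, sub_add_cancel, h4]
    field_simp
  rw [h6]
  push_cast
  field_simp

theorem contDiffOn_neckSlope (hq : 1 ≤ q) (hε : 0 < ε) : ContDiffOn ℝ ∞ (neckSlope q ε) (Ioi ε) := by
  have hT : ∀ r ∈ Ioi ε, (r / ε) ^ (2 * q) - 1 ≠ 0 := fun r hr ↦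
    (one_lt_pow_of_one_lt hq ((one_lt_div hε).2 hr)).ne'
  have h1 : ContDiffOn ℝ ∞ (fun r : ℝ ↦ (r / ε) ^ (2 * q) - 1) (Ioi ε) :=
    ContDiff.contDiffOn (by fun_prop)
  exact contDiffOn_const.div (h1.sqrt hT) fun r hr ↦
    (Real.sqrt_pos.2 (one_lt_pow_of_one_lt hq ((one_lt_div hε).2 hr))).ne'

theorem continuousOn_smul_catenoidProfile (hq : 1 ≤ q) (hε : 0 < ε) :
    ContinuousOn (fun r ↦ ε * catenoidProfile q (r / ε)) (Ici ε) := by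
  refine continuousOn_const.mul ((continuousOn_catenoidProfile hq).comp (by fun_prop) ?_)
  intro r hr
  exact (one_le_div hε).2 hr

theorem neckSlope_strictAntiOn (hq : 1 ≤ q) (hε : 0 < ε) :
    StrictAntiOn (neckSlope q ε) (Ioi ε) := by
  intro x hx y hy hxy
  have hx1 : 1 < x / ε := (one_lt_div hε).2 hx
  have hT := one_lt_pow_of_one_lt hq hx1
  unfold neckSlope
  refine one_div_lt_one_div_of_lt (Real.sqrt_pos.2 hT) (Real.sqrt_lt_sqrt hT.le ?_)
  have : (x / ε) ^ (2 * q) < (y / ε) ^ (2 * q) :=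
    pow_lt_pow_left₀ ((div_lt_div_iff_of_pos_right hε).2 hxy) (by linarith) (by lia)
  linarith

theorem smul_catenoidProfile_le_self (hq : 1 ≤ q) (hε : 0 < ε) (hr : ε ≤ r) :
    ε * catenoidProfile q (r / ε) ≤ r := by
  have := catenoidProfile_le_self hq ((one_le_div hε).2 hr)
  calc ε * catenoidProfile q (r / ε) ≤ ε * (r / ε) := by gcongr
    _ = r := by field_simp

/-- Unlike the bound by `r`, this one tends to `0` with `ε` uniformly on bounded sets of `r`. -/
theorem smul_catenoidProfile_le_sqrt (hq : 1 ≤ q) (hε : 0 < ε) (hr : ε ≤ r) :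
    ε * catenoidProfile q (r / ε) ≤ 2 * √(ε * r) := by
  have h1 := catenoidProfile_le hq ((one_le_div hε).2 hr)
  have h2 : √(r / ε - 1) ≤ √(r / ε) := Real.sqrt_le_sqrt (by linarith)
  calc ε * catenoidProfile q (r / ε) ≤ ε * (2 * √(r / ε)) := by gcongr; linarith
    _ = 2 * √(ε * r) := by
      rw [show ε * r = ε ^ 2 * (r / ε) by field_simp, Real.sqrt_mul (by positivity),
        Real.sqrt_sq hε.le]
      ring

/-! #### A regular parametrization of the neck -/

/-- The radius of the generalized catenoid in the parameter `w`. -/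
def catenoidRadius (q : ℕ) (w : ℝ) : ℝ := cosh w ^ (1 / q : ℝ)

/-- The height of the generalized catenoid in the parameter `w`. -/
def catenoidHeight (q : ℕ) (w : ℝ) : ℝ := ∫ v in (0 : ℝ)..w, 1 / q * cosh v ^ (1 / q - 1 : ℝ)

theorem contDiff_cosh_rpow (c : ℝ) : ContDiff ℝ ∞ fun w ↦ cosh w ^ c :=
  contDiff_iff_contDiffAt.2 fun w ↦
    (Real.contDiff_cosh.contDiffAt).rpow_const_of_ne (Real.cosh_pos w).ne'

theorem hasDerivAt_catenoidHeight (q : ℕ) (w : ℝ) :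
    HasDerivAt (catenoidHeight q) (1 / q * cosh w ^ (1 / q - 1 : ℝ)) w := by
  have hc : Continuous fun v ↦ 1 / q * cosh v ^ (1 / q - 1 : ℝ) :=
    continuous_const.mul (contDiff_cosh_rpow _).continuous
  exact intervalIntegral.integral_hasDerivAt_right (hc.intervalIntegrable _ _)
    hc.stronglyMeasurable.stronglyMeasurableAtFilter hc.continuousAt

theorem contDiff_catenoidHeight (q : ℕ) : ContDiff ℝ ∞ (catenoidHeight q) := by
  rw [contDiff_infty_iff_deriv]
  refine ⟨fun w ↦ (hasDerivAt_catenoidHeight q w).differentiableAt, ?_⟩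
  rw [show deriv (catenoidHeight q) = fun w ↦ 1 / q * cosh w ^ (1 / q - 1 : ℝ) from
    funext fun w ↦ (hasDerivAt_catenoidHeight q w).deriv]
  exact contDiff_const.mul (contDiff_cosh_rpow _)

theorem catenoidHeight_zero (q : ℕ) : catenoidHeight q 0 = 0 := by simp [catenoidHeight]

theorem catenoidHeight_deriv_pos (hq : 1 ≤ q) (w : ℝ) :
    0 < 1 / q * cosh w ^ (1 / q - 1 : ℝ) := by
  have : (0 : ℝ) < q := by exact_mod_cast hq
  have := Real.rpow_pos_of_pos (Real.cosh_pos w) (1 / q - 1 : ℝ)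
  positivity

theorem catenoidHeight_strictMono (hq : 1 ≤ q) : StrictMono (catenoidHeight q) :=
  strictMono_of_deriv_pos fun w ↦ by
    rw [(hasDerivAt_catenoidHeight q w).deriv]; exact catenoidHeight_deriv_pos hq w

theorem catenoidHeight_neg (q : ℕ) (w : ℝ) : catenoidHeight q (-w) = -catenoidHeight q w := by
  unfold catenoidHeight
  have h := intervalIntegral.integral_comp_neg (a := 0) (b := w)
    (fun v ↦ 1 / q * cosh v ^ (1 / q - 1 : ℝ))
  simp only [Real.cosh_neg, neg_zero] at h
  rw [h, intervalIntegral.integral_symm]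

theorem catenoidRadius_neg (q : ℕ) (w : ℝ) : catenoidRadius q (-w) = catenoidRadius q w := by
  simp [catenoidRadius]

theorem one_le_catenoidRadius (q : ℕ) (w : ℝ) : 1 ≤ catenoidRadius q w :=
  Real.one_le_rpow (Real.one_le_cosh w) (by positivity)

theorem catenoidRadius_pow (hq : 1 ≤ q) (w : ℝ) : catenoidRadius q w ^ q = cosh w := by
  unfold catenoidRadius
  rw [one_div, Real.rpow_inv_natCast_pow (Real.cosh_pos w).le (by lia)]

theorem exists_catenoidRadius_eq (hq : 1 ≤ q) {s : ℝ} (hs : 1 ≤ s) :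
    ∃ w, 0 ≤ w ∧ catenoidRadius q w = s := by
  have h1 : 1 ≤ s ^ q := one_le_pow₀ hs
  refine ⟨arcosh (s ^ q), Real.arcosh_nonneg h1, ?_⟩
  unfold catenoidRadius
  rw [Real.cosh_arcosh h1, one_div, Real.pow_rpow_inv_natCast (by linarith) (by lia)]

/-- Substitute `t = (cosh v)^(1/q)`: then `√(t^(2q) - 1) = sinh v`, which cancels the factor `sinh
v` of `dt`. The singularity at `t = 1` thus comes from the parametrization only. -/
theorem catenoidProfile_catenoidRadius (hq : 1 ≤ q) {w : ℝ} (hw : 0 ≤ w) :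
    catenoidProfile q (catenoidRadius q w) = catenoidHeight q w := by
  have hq0 : (q : ℝ) ≠ 0 := by
    have : (0 : ℝ) < q := by exact_mod_cast hq
    exact this.ne'
  rcases hw.eq_or_lt with rfl | hw
  · simp [catenoidRadius, catenoidProfile_one, catenoidHeight_zero]
  have hcR : ContDiff ℝ ∞ (catenoidRadius q) := contDiff_cosh_rpow _
  have hcont : ContinuousOn (fun w ↦ catenoidProfile q (catenoidRadius q w) - catenoidHeight q w)
      (Icc 0 w) :=
    ((continuousOn_catenoidProfile hq).comp hcR.continuous.continuousOn
      fun v _ ↦ one_le_catenoidRadius q v).sub (contDiff_catenoidHeight q).continuous.continuousOn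
  have hder : ∀ v ∈ Ioo 0 w, HasDerivAt
      (fun w ↦ catenoidProfile q (catenoidRadius q w) - catenoidHeight q w) 0 v := by
    intro v hv
    have hc := Real.cosh_pos v
    have hsh : 0 < sinh v := Real.sinh_pos_iff.2 hv.1
    have h1 : HasDerivAt (catenoidRadius q) (sinh v * (1 / q) * cosh v ^ (1 / q - 1 : ℝ)) v :=
      (Real.hasDerivAt_cosh v).rpow_const (Or.inl hc.ne')
    have h2 : 1 < catenoidRadius q v :=
      Real.one_lt_rpow (Real.one_lt_cosh.2 hv.1.ne') (by positivity)
    have h3 := ((hasDerivAt_catenoidProfile hq h2).comp v h1).sub (hasDerivAt_catenoidHeight q v)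
    refine h3.congr_deriv ?_
    rw [mul_comm 2 q, pow_mul, catenoidRadius_pow hq, ← Real.sinh_sq, Real.sqrt_sq hsh.le]
    field_simp
    ring
  -- The mean value theorem asks only for continuity at `0`, where the derivative of
  -- `catenoidProfile` is unavailable.
  obtain ⟨c, -, hc⟩ := exists_hasDerivAt_eq_slope _ _ hw hcont hder
  rw [eq_comm, div_eq_zero_iff] at hc
  have h0 : catenoidProfile q (catenoidRadius q 0) - catenoidHeight q 0 = 0 := by
    simp [catenoidRadius, catenoidProfile_one, catenoidHeight_zero]
  rcases hc with hc | hc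
  · linarith
  · linarith

/-- The height is locally a regular parameter of the catenoid. -/
theorem exists_local_inverse_catenoidHeight (hq : 1 ≤ q) :
    ∃ δ > 0, ∃ L : ℝ → ℝ, ContDiffOn ℝ ∞ L (Ioo (-δ) δ) ∧
      ∀ s ∈ Ioo (-δ) δ, catenoidHeight q (L s) = s := by
  have hd := hasDerivAt_catenoidHeight q 0
  have hne := (catenoidHeight_deriv_pos hq 0).ne'
  have hS := (contDiff_catenoidHeight q).contDiffAt (x := 0)
  set c := 1 / q * cosh 0 ^ (1 / q - 1 : ℝ)
  have hfd : HasFDerivAt (catenoidHeight q)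
      (ContinuousLinearEquiv.unitsEquivAut ℝ (Units.mk0 c hne) : ℝ →L[ℝ] ℝ) 0 :=
    hd.hasFDerivAt_equiv hne
  let e := hS.toOpenPartialHomeomorph _ hfd (by simp)
  have he : (e : ℝ → ℝ) = catenoidHeight q := rfl
  have h0 : (0 : ℝ) ∈ e.target := by
    have := hS.image_mem_toOpenPartialHomeomorph_target hfd (by simp)
    rwa [catenoidHeight_zero] at this
  have hL : ContDiffAt ℝ ∞ e.symm 0 := by
    have := hS.to_localInverse hfd (by simp)
    rwa [catenoidHeight_zero] at this
  -- The derivative of the height is positive everywhere, so the inverse is smooth on its whole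
  -- domain and not just at `0`.
  have hder : ∀ s ∈ e.target, ContDiffAt ℝ ∞ e.symm s := by
    intro s hs
    refine e.contDiffAt_symm_deriv (f₀' := 1 / q * cosh (e.symm s) ^ (1 / q - 1 : ℝ))
      (catenoidHeight_deriv_pos hq _).ne' hs ?_ ?_
    · rw [he]; exact hasDerivAt_catenoidHeight q _
    · rw [he]; exact (contDiff_catenoidHeight q).contDiffAt
  obtain ⟨δ, hδ, hball⟩ := Metric.isOpen_iff.1 e.open_target 0 h0
  rw [Real.ball_eq_Ioo, zero_sub, zero_add] at hball
  exact ⟨δ, hδ, e.symm, fun s hs ↦ (hder s (hball hs)).contDiffWithinAt,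
    fun s hs ↦ e.right_inv (hball hs)⟩

end NeckProfile

/-! ### Existence of admissible families -/

section Existence

/-- For `r ≥ 2ε`, `(r/ε)^(2q) - 1` is at least `(r/ε)²/4`. The resulting `O(ε/r)` bound gives the
convergence of `φ'` and, through the catenoid equation, of `φ''` on compact sets. -/
theorem neckSlope_le {q : ℕ} (hq : 1 ≤ q) {ε r : ℝ} (hε : 0 < ε) (hr : 2 * ε ≤ r) :
    neckSlope q ε r ≤ 2 * ε / r := by
  have hr0 : 0 < r := by linarith
  have h2 : 2 ≤ r / ε := (le_div_iff₀ hε).2 hr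
  have h3 : (r / ε) ^ 2 ≤ (r / ε) ^ (2 * q) := pow_le_pow_right₀ (by linarith) (by lia)
  have h4 : r / (2 * ε) ≤ √((r / ε) ^ (2 * q) - 1) := by
    refine Real.le_sqrt_of_sq_le ?_
    have : r / (2 * ε) = (r / ε) / 2 := by field_simp
    rw [this]
    nlinarith
  have h5 : 0 < r / (2 * ε) := by positivity
  calc neckSlope q ε r ≤ 1 / (r / (2 * ε)) := one_div_le_one_div_of_le h5 h4
    _ = 2 * ε / r := by rw [one_div_div]

/-- A smooth function equal to `1` before `a + ε` and to `0` after `2 * a + ε`. -/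
def neckCutoff (a ε r : ℝ) : ℝ := smoothTransition ((2 * a + ε - r) / a)

/-- A profile that is equal to the catenoidal profile before `a + ε` and is constant after
`2 * a + ε`. -/
def cutoffProfile (q : ℕ) (a ε r : ℝ) : ℝ :=
  ε * catenoidProfile q (r / ε) -
    ∫ t in (a + ε)..r, neckSlope q ε t * (1 - neckCutoff a ε t)

variable {q : ℕ} {a ε r : ℝ}

theorem contDiff_neckCutoff (a ε : ℝ) : ContDiff ℝ ∞ (neckCutoff a ε) :=
  smoothTransition.contDiff.comp (by fun_prop)

theorem neckCutoff_of_le (ha : 0 < a) (hr : r ≤ a + ε) : neckCutoff a ε r = 1 :=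
  smoothTransition.one_of_one_le ((one_le_div ha).2 (by linarith))

theorem neckCutoff_of_ge (ha : 0 < a) (hr : 2 * a + ε ≤ r) : neckCutoff a ε r = 0 :=
  smoothTransition.zero_of_nonpos (div_nonpos_of_nonpos_of_nonneg (by linarith) ha.le)

theorem neckCutoff_pos (ha : 0 < a) (hr : r < 2 * a + ε) : 0 < neckCutoff a ε r :=
  smoothTransition.pos_of_pos (div_pos (by linarith) ha)

theorem neckCutoff_nonneg (a ε r : ℝ) : 0 ≤ neckCutoff a ε r := smoothTransition.nonneg _

theorem neckCutoff_le_one (a ε r : ℝ) : neckCutoff a ε r ≤ 1 := smoothTransition.le_one _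

theorem neckCutoff_antitone (ha : 0 < a) : Antitone (neckCutoff a ε) := fun x y hxy ↦
  smoothTransition.monotone (by gcongr)

theorem cutoffProfile_of_le (ha : 0 < a) (hr : r ≤ a + ε) :
    cutoffProfile q a ε r = ε * catenoidProfile q (r / ε) := by
  unfold cutoffProfile
  rw [intervalIntegral.integral_congr (g := fun _ ↦ 0), intervalIntegral.integral_zero, sub_zero]
  intro t ht
  rw [uIcc_of_ge hr] at ht
  simp [neckCutoff_of_le ha ht.2]

/-- The subtracted integral removes the part `1 - χ` of the slope. What remains is a positive,
strictly decreasing slope times a nonnegative, nonincreasing cutoff `χ`: hence monotonicity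
everywhere, strict concavity while `χ > 0`, and constancy afterwards. -/
theorem hasDerivAt_cutoffProfile (hq : 1 ≤ q) (ha : 0 < a) (hε : 0 < ε) (hr : ε < r) :
    HasDerivAt (cutoffProfile q a ε) (neckSlope q ε r * neckCutoff a ε r) r := by
  have hc : ContinuousOn (fun t ↦ neckSlope q ε t * (1 - neckCutoff a ε t)) (Ioi ε) :=
    (contDiffOn_neckSlope hq hε).continuousOn.mul
      (continuousOn_const.sub (contDiff_neckCutoff a ε).continuous.continuousOn)
  have hsub : uIcc (a + ε) r ⊆ Ioi ε := by
    intro t ht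
    have : min (a + ε) r ≤ t := ht.1
    exact lt_of_lt_of_le (lt_min (by linarith) hr) this
  have h1 : HasDerivAt (fun r ↦ ∫ t in (a + ε)..r, neckSlope q ε t * (1 - neckCutoff a ε t))
      (neckSlope q ε r * (1 - neckCutoff a ε r)) r :=
    intervalIntegral.integral_hasDerivAt_right (hc.mono hsub).intervalIntegrable
      (hc.stronglyMeasurableAtFilter isOpen_Ioi r hr) (hc.continuousAt (Ioi_mem_nhds hr))
  refine ((hasDerivAt_smul_catenoidProfile hq hε hr).sub h1).congr_deriv ?_
  ring

theorem contDiffOn_cutoffProfile (hq : 1 ≤ q) (ha : 0 < a) (hε : 0 < ε) :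
    ContDiffOn ℝ ∞ (cutoffProfile q a ε) (Ioi ε) := by
  rw [contDiffOn_infty_iff_deriv_of_isOpen isOpen_Ioi]
  refine ⟨fun r hr ↦ (hasDerivAt_cutoffProfile hq ha hε hr).differentiableAt.differentiableWithinAt,
    ?_⟩
  exact ((contDiffOn_neckSlope hq hε).mul (contDiff_neckCutoff a ε).contDiffOn).congr
    fun r hr ↦ (hasDerivAt_cutoffProfile hq ha hε hr).deriv

theorem continuousOn_cutoffProfile (hq : 1 ≤ q) (ha : 0 < a) (hε : 0 < ε) :
    ContinuousOn (cutoffProfile q a ε) (Ici ε) := by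
  intro r hr
  rcases (show ε ≤ r from hr).eq_or_lt with rfl | hr
  · refine ((continuousOn_smul_catenoidProfile hq hε) ε hr).congr_of_eventuallyEq ?_
      (cutoffProfile_of_le ha (by linarith))
    filter_upwards [mem_nhdsWithin_of_mem_nhds (Iic_mem_nhds (show ε < a + ε by linarith))]
      with t ht using cutoffProfile_of_le ha ht
  · exact (hasDerivAt_cutoffProfile hq ha hε hr).continuousAt.continuousWithinAt

theorem monotoneOn_cutoffProfile (hq : 1 ≤ q) (ha : 0 < a) (hε : 0 < ε) :
    MonotoneOn (cutoffProfile q a ε) (Ici ε) := by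
  refine monotoneOn_of_deriv_nonneg (convex_Ici ε) (continuousOn_cutoffProfile hq ha hε) ?_ ?_
  all_goals rw [interior_Ici]
  · exact (contDiffOn_cutoffProfile hq ha hε).differentiableOn (by simp)
  · intro r hr
    rw [(hasDerivAt_cutoffProfile hq ha hε hr).deriv]
    exact mul_nonneg (neckSlope_pos hq hε hr).le (neckCutoff_nonneg a ε _)

theorem cutoffProfile_nonneg (hq : 1 ≤ q) (ha : 0 < a) (hε : 0 < ε) (hr : ε ≤ r) :
    0 ≤ cutoffProfile q a ε r := by
  have h := monotoneOn_cutoffProfile hq ha hε self_mem_Ici hr hr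
  rwa [cutoffProfile_of_le ha (by linarith), div_self hε.ne', catenoidProfile_one, mul_zero] at h

theorem cutoffProfile_le (hq : 1 ≤ q) (ha : 0 < a) (hε : 0 < ε) (hr : ε ≤ r) :
    cutoffProfile q a ε r ≤ 2 * √(ε * r) := by
  have h1 := smul_catenoidProfile_le_sqrt hq hε hr
  rcases le_total r (a + ε) with h | h
  · rwa [cutoffProfile_of_le ha h]
  · have : 0 ≤ ∫ t in (a + ε)..r, neckSlope q ε t * (1 - neckCutoff a ε t) := by
      refine intervalIntegral.integral_nonneg h fun t ht ↦ ?_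
      exact mul_nonneg (neckSlope_pos hq hε (by linarith [ht.1])).le
        (sub_nonneg.2 (neckCutoff_le_one a ε _))
    unfold cutoffProfile
    linarith

theorem cutoffProfile_of_ge (hq : 1 ≤ q) (ha : 0 < a) (hε : 0 < ε) (hr : 2 * a + ε ≤ r) :
    cutoffProfile q a ε r = cutoffProfile q a ε (2 * a + ε) := by
  have hsub : Icc (2 * a + ε) r ⊆ Ici ε := fun t ht ↦ show ε ≤ t by linarith [ht.1]
  refine constant_of_has_deriv_right_zero ((continuousOn_cutoffProfile hq ha hε).mono hsub) ?_ r
    (right_mem_Icc.2 hr)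
  intro t ht
  have := hasDerivAt_cutoffProfile (q := q) hq ha hε (show ε < t by linarith [ht.1])
  rw [neckCutoff_of_ge ha ht.1, mul_zero] at this
  exact this.hasDerivWithinAt

theorem strictConcaveOn_cutoffProfile (hq : 1 ≤ q) (ha : 0 < a) (hε : 0 < ε) :
    StrictConcaveOn ℝ (Ioc ε (2 * a + ε)) (cutoffProfile q a ε) := by
  refine StrictAntiOn.strictConcaveOn_of_deriv (convex_Ioc _ _)
    ((continuousOn_cutoffProfile hq ha hε).mono fun t ht ↦ ht.1.le) ?_
  rw [interior_Ioc]
  intro x hx y hy hxy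
  rw [(hasDerivAt_cutoffProfile hq ha hε hx.1).deriv, (hasDerivAt_cutoffProfile hq ha hε hy.1).deriv]
  have h1 := neckSlope_strictAntiOn hq hε hx.1 hy.1 hxy
  have h2 := neckCutoff_antitone (ε := ε) ha hxy.le
  have h3 := neckCutoff_pos ha hx.2
  calc neckSlope q ε y * neckCutoff a ε y ≤ neckSlope q ε y * neckCutoff a ε x :=
        mul_le_mul_of_nonneg_left h2 (neckSlope_pos hq hε hy.1).le
    _ < neckSlope q ε x * neckCutoff a ε x := mul_lt_mul_of_pos_right h1 h3

theorem derivWithin_cutoffProfile (hq : 1 ≤ q) (ha : 0 < a) (hε : 0 < ε) {b : ℝ}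
    (hr : r ∈ Ioc ε b) :
    derivWithin (cutoffProfile q a ε) (Ioc ε b) r = neckSlope q ε r * neckCutoff a ε r :=
  (hasDerivAt_cutoffProfile hq ha hε hr.1).hasDerivWithinAt.derivWithin
    (uniqueDiffOn_Ioc ε b r hr)

theorem iteratedDerivWithin_two_cutoffProfile (hq : 1 ≤ q) (ha : 0 < a) (hε : 0 < ε) {b : ℝ}
    (hr : r ∈ Ioc ε b) :
    iteratedDerivWithin 2 (cutoffProfile q a ε) (Ioc ε b) r =
      -(q / r) * neckSlope q ε r * (1 + neckSlope q ε r ^ 2) * neckCutoff a ε r +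
        neckSlope q ε r * deriv (neckCutoff a ε) r := by
  rw [iteratedDerivWithin_succ, derivWithin_congr
    (f := fun r ↦ neckSlope q ε r * neckCutoff a ε r)]
  · refine HasDerivWithinAt.derivWithin ?_ (uniqueDiffOn_Ioc ε b r hr)
    exact ((hasDerivAt_neckSlope hq hε hr.1).mul
      ((contDiff_neckCutoff a ε).differentiable (by simp)).differentiableAt.hasDerivAt)
        |>.hasDerivWithinAt
  · intro t ht
    rw [iteratedDerivWithin_one, derivWithin_cutoffProfile hq ha hε ht]
  · rw [iteratedDerivWithin_one, derivWithin_cutoffProfile hq ha hε hr]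

/-- In this range of `ε` and `r` the argument of the transition function stays in a fixed compact
interval, so the bound does not depend on `ε`. -/
theorem exists_abs_deriv_neckCutoff_le (ha : 0 < a) :
    ∃ C, ∀ ε ∈ Ioo (0 : ℝ) 1, ∀ r ∈ Ioc (0 : ℝ) (π / 2), |deriv (neckCutoff a ε) r| ≤ C := by
  have hc : Continuous (deriv smoothTransition) :=
    (smoothTransition.contDiff (n := 1)).continuous_deriv le_rfl
  obtain ⟨C, hC⟩ := (isCompact_Icc (a := (2 * a - π / 2) / a) (b := (2 * a + 1) / a))
    |>.exists_bound_of_continuousOn hc.continuousOn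
  refine ⟨C * (1 / a), fun ε hε r hr ↦ ?_⟩
  have h1 : HasDerivAt (fun r ↦ (2 * a + ε - r) / a) (-1 / a) r :=
    ((hasDerivAt_id r).const_sub _).div_const a
  have h2 : HasDerivAt smoothTransition _ ((2 * a + ε - r) / a) :=
    ((smoothTransition.contDiff (n := 1)).differentiable (by simp)).differentiableAt.hasDerivAt
  have h3 : deriv (neckCutoff a ε) r = _ := (h2.comp r h1).deriv
  have h4 := hC ((2 * a + ε - r) / a)
    ⟨div_le_div_of_nonneg_right (by linarith [hε.1, hr.2]) ha.le,
      div_le_div_of_nonneg_right (by linarith [hε.2, hr.1]) ha.le⟩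
  rw [h3, abs_mul, neg_div, abs_neg, abs_of_pos (show 0 < 1 / a by positivity)]
  exact mul_le_mul_of_nonneg_right h4 (by positivity)

theorem exists_pos_lower_bound_of_isCompact {K : Set ℝ} {b : ℝ} (hK : K ⊆ Ioc 0 b)
    (hKc : IsCompact K) : ∃ r₀ > 0, ∀ r ∈ K, r₀ ≤ r := by
  rcases K.eq_empty_or_nonempty with rfl | hne
  · exact ⟨1, one_pos, by simp⟩
  · obtain ⟨r₀, h1, h2⟩ := hKc.exists_isLeast hne
    exact ⟨r₀, (hK h1).1, fun r hr ↦ h2 hr⟩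

theorem eventually_Ioo_nhdsGT {c : ℝ} (hc : 0 < c) : ∀ᶠ ε : ℝ in 𝓝[>] 0, ε ∈ Ioo 0 c :=
  Ioo_mem_nhdsGT hc

theorem isGluingFamily_cutoffProfile {n k : ℕ} (hk : k + 2 ≤ n) (ha : 0 < a) (ha' : a < π / 10) :
    IsGluingFamily n k a (cutoffProfile (n - k - 1) a) := by
  have hq : 1 ≤ n - k - 1 := by lia
  set q := n - k - 1 with hqdef
  have hsmall : ∀ η > 0, ∀ᶠ ε in 𝓝[>] 0, ∀ r ∈ Icc ε (π / 2), |cutoffProfile q a ε r| < η := by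
    intro η hη
    have hpi := Real.pi_pos
    filter_upwards [eventually_Ioo_nhdsGT (show 0 < (η / 2) ^ 2 / π by positivity)] with ε hε r hr
    rw [abs_of_nonneg (cutoffProfile_nonneg hq ha hε.1 hr.1)]
    refine (cutoffProfile_le hq ha hε.1 hr.1).trans_lt ?_
    have h1 : ε * r < (η / 2) ^ 2 := by
      have := (lt_div_iff₀ hpi).1 hε.2
      nlinarith [hr.2, hε.1]
    have h2 : √(ε * r) < η / 2 := (Real.sqrt_lt' (by positivity)).2 h1
    linarith
  refine ⟨?_, hsmall, ?_, ?_⟩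
  · filter_upwards [hsmall (1 / 2) (by norm_num), eventually_Ioo_nhdsGT ha] with ε h1 hε
    refine ⟨(contDiffOn_cutoffProfile hq ha hε.1).mono fun r hr ↦ hr.1, ?_,
      strictConcaveOn_cutoffProfile hq ha hε.1, cutoffProfile q a ε (2 * a + ε), ?_, ?_⟩
    · intro r hr
      rw [neckProfile_eq, cutoffProfile_of_le ha hr.2]
    · exact (le_abs_self _).trans_lt (h1 _ ⟨by linarith, by linarith [hε.2]⟩)
    · exact fun r hr ↦ cutoffProfile_of_ge hq ha hε.1 hr.1
  · intro K hK hKc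
    obtain ⟨r₀, hr₀, hKr⟩ := exists_pos_lower_bound_of_isCompact hK hKc
    rw [Metric.tendstoUniformlyOn_iff]
    intro η hη
    filter_upwards [eventually_Ioo_nhdsGT (show 0 < r₀ / 2 by positivity),
      eventually_Ioo_nhdsGT (show 0 < η * r₀ / 2 by positivity)] with ε h1 h2 r hr
    have hrr := hKr r hr
    have hεr : ε < r := by linarith [h1.2]
    rw [derivWithin_cutoffProfile hq ha h1.1 ⟨hεr, (hK hr).2⟩, Pi.zero_apply, dist_zero_left,
      Real.norm_of_nonneg (mul_nonneg (neckSlope_pos hq h1.1 hεr).le (neckCutoff_nonneg a ε _))]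
    have h3 := neckSlope_le hq h1.1 (show 2 * ε ≤ r by linarith [h1.2])
    have h4 : 2 * ε / r < η := by
      rw [div_lt_iff₀ (by linarith)]
      nlinarith [h2.2]
    refine lt_of_le_of_lt ?_ h4
    exact (mul_le_of_le_one_right (neckSlope_pos hq h1.1 hεr).le
      (neckCutoff_le_one a ε _)).trans h3
  · intro K hK hKc
    obtain ⟨r₀, hr₀, hKr⟩ := exists_pos_lower_bound_of_isCompact hK hKc
    obtain ⟨C, hC⟩ := exists_abs_deriv_neckCutoff_le ha
    rw [Metric.tendstoUniformlyOn_iff]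
    intro η hη
    -- Once the slope is at most `1`, the second derivative is at most the slope times `2q/r₀ +
    -- |C|`; the summand `1` keeps `D` positive.
    set D := q / r₀ * 2 + |C| + 1 with hD
    have hDpos : 0 < D := by positivity
    filter_upwards [eventually_Ioo_nhdsGT (show 0 < r₀ / 2 by positivity),
      eventually_Ioo_nhdsGT one_pos,
      eventually_Ioo_nhdsGT (show 0 < η / D * r₀ / 2 by positivity)] with ε h1 h1' h2 r hr
    have hrr := hKr r hr
    have hr0 : 0 < r := by linarith
    have hεr : ε < r := by linarith [h1.2]
    rw [iteratedDerivWithin_two_cutoffProfile hq ha h1.1 ⟨hεr, (hK hr).2⟩, Pi.zero_apply,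
      dist_zero_left, Real.norm_eq_abs]
    have hp := neckSlope_pos hq h1.1 hεr
    have h3 := neckSlope_le hq h1.1 (show 2 * ε ≤ r by linarith [h1.2])
    have h4 : 2 * ε / r < η / D := by
      rw [div_lt_iff₀ hr0]
      have : η / D * r₀ ≤ η / D * r := by gcongr
      linarith [h2.2]
    have h5 : neckSlope q ε r ≤ 1 := h3.trans ((div_le_one hr0).2 (by linarith [h1.2]))
    have h6 := hC ε h1' r (hK hr)
    have h7 : (q : ℝ) / r ≤ q / r₀ := by gcongr
    set p := neckSlope q ε r
    have hχ0 : 0 ≤ neckCutoff a ε r := neckCutoff_nonneg a ε _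
    have hχ1 : neckCutoff a ε r ≤ 1 := neckCutoff_le_one a ε _
    have h8 : |-(q / r) * p * (1 + p ^ 2) * neckCutoff a ε r| ≤ p * (q / r₀ * 2) := by
      rw [neg_mul, neg_mul, neg_mul, abs_neg, abs_of_nonneg (by positivity)]
      have h9 : (1 + p ^ 2) * neckCutoff a ε r ≤ 2 :=
        (mul_le_of_le_one_right (by positivity) hχ1).trans (by nlinarith)
      calc q / r * p * (1 + p ^ 2) * neckCutoff a ε r
          = p * (q / r * ((1 + p ^ 2) * neckCutoff a ε r)) := by ring
        _ ≤ p * (q / r₀ * 2) := by gcongr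
    have h10 : |p * deriv (neckCutoff a ε) r| ≤ p * |C| := by
      rw [abs_mul, abs_of_pos hp]
      exact mul_le_mul_of_nonneg_left (h6.trans (le_abs_self C)) hp.le
    calc |_| ≤ p * (q / r₀ * 2) + p * |C| := (abs_add_le _ _).trans (add_le_add h8 h10)
      _ ≤ p * D := by rw [hD]; nlinarith
      _ ≤ 2 * ε / r * D := by gcongr
      _ < η / D * D := by gcongr
      _ = η := by field_simp

end Existence

/-! ### The polar angle and its derivative -/

section PolarAngle

variable {E F : Type*} [NormedAddCommGroup E] [InnerProductSpace ℝ E]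
  [NormedAddCommGroup F] [InnerProductSpace ℝ F]

/-- The angle `r` such that `x = ‖x‖ ((sin r) y + (cos r) z)` with `y`, `z` of unit length. -/
def polarAngle (x : WithLp 2 (E × F)) : ℝ := arcsin (‖x.fst‖ / ‖x‖)

variable {x : WithLp 2 (E × F)}

theorem norm_fst_div_norm_le_one (x : WithLp 2 (E × F)) : ‖x.fst‖ / ‖x‖ ≤ 1 :=
  div_le_one_of_le₀ (WithLp.norm_fst_le _ x) (norm_nonneg _)

theorem sin_polarAngle (x : WithLp 2 (E × F)) : sin (polarAngle x) = ‖x.fst‖ / ‖x‖ :=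
  Real.sin_arcsin (by linarith [show 0 ≤ ‖x.fst‖ / ‖x‖ by positivity])
    (norm_fst_div_norm_le_one x)

theorem cos_polarAngle (hx : x ≠ 0) : cos (polarAngle x) = ‖x.snd‖ / ‖x‖ := by
  have hx' : 0 < ‖x‖ := norm_pos_iff.2 hx
  unfold polarAngle
  rw [Real.cos_arcsin]
  have : 1 - (‖x.fst‖ / ‖x‖) ^ 2 = (‖x.snd‖ / ‖x‖) ^ 2 := by
    have := WithLp.prod_norm_sq_eq_of_L2 x
    field_simp
    linarith
  rw [this, Real.sqrt_sq (by positivity)]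

theorem polarAngle_nonneg (x : WithLp 2 (E × F)) : 0 ≤ polarAngle x :=
  Real.arcsin_nonneg.2 (by positivity)

theorem polarAngle_le (x : WithLp 2 (E × F)) : polarAngle x ≤ π / 2 :=
  Real.arcsin_le_pi_div_two _

/-- The arctangent is smooth on the whole line, so this form is the one used for smoothness and
derivatives. -/
theorem polarAngle_eq_arctan (hx : x.snd ≠ 0) : polarAngle x = arctan (‖x.fst‖ / ‖x.snd‖) := by
  have hx0 : x ≠ 0 := fun h ↦ hx (by simp [h])
  have h1 : 0 < ‖x‖ := norm_pos_iff.2 hx0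
  have h2 : 0 < ‖x.snd‖ := norm_pos_iff.2 hx
  have h3 : 0 < cos (polarAngle x) := by rw [cos_polarAngle hx0]; positivity
  have h4 : polarAngle x < π / 2 := by
    refine lt_of_le_of_ne (polarAngle_le x) fun h ↦ ?_
    rw [h, Real.cos_pi_div_two] at h3
    exact lt_irrefl _ h3
  rw [← Real.arctan_tan (by linarith [polarAngle_nonneg x, Real.pi_pos]) h4, Real.tan_eq_sin_div_cos,
    sin_polarAngle, cos_polarAngle hx0]
  congr 1
  field_simp

theorem fst_ne_zero_of_polarAngle_pos (h : 0 < polarAngle x) : x.fst ≠ 0 := by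
  intro h0
  simp [polarAngle, h0] at h

theorem snd_ne_zero_of_polarAngle_lt (hx : x ≠ 0) (h : polarAngle x < π / 2) : x.snd ≠ 0 := by
  intro h0
  have h1 := cos_polarAngle hx
  have h2 : 0 < cos (polarAngle x) :=
    Real.cos_pos_of_mem_Ioo ⟨by linarith [polarAngle_nonneg x, Real.pi_pos], h⟩
  simp [h0] at h1
  linarith

theorem continuousAt_polarAngle (hx : x ≠ 0) :
    ContinuousAt (polarAngle : WithLp 2 (E × F) → ℝ) x := by
  refine Real.continuous_arcsin.continuousAt.comp ?_
  exact (WithLp.continuous_fst 2 E F).norm.continuousAt.div continuous_norm.continuousAt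
    (norm_ne_zero_iff.2 hx)

theorem polarAngle_toLp {y : E} {z : F} (hy : ‖y‖ = 1) (hz : ‖z‖ = 1) {ρ r : ℝ} (hρ : 0 < ρ)
    (hr0 : 0 ≤ r) (hr1 : r ≤ π / 2) :
    polarAngle (ρ • WithLp.toLp 2 (sin r • y, cos r • z)) = r ∧
      ‖(ρ • WithLp.toLp 2 (sin r • y, cos r • z) : WithLp 2 (E × F))‖ = ρ := by
  have hs : 0 ≤ sin r := Real.sin_nonneg_of_nonneg_of_le_pi hr0 (by linarith [Real.pi_pos])
  have h1 : ‖(WithLp.toLp 2 (sin r • y, cos r • z) : WithLp 2 (E × F))‖ = 1 := by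
    rw [WithLp.prod_norm_eq_of_L2]
    simp [norm_smul, hy, hz, sq_abs]
  have h2 : ‖(ρ • WithLp.toLp 2 (sin r • y, cos r • z) : WithLp 2 (E × F))‖ = ρ := by
    rw [norm_smul, h1, Real.norm_of_nonneg hρ.le, mul_one]
  refine ⟨?_, h2⟩
  unfold polarAngle
  rw [h2]
  simp only [WithLp.smul_fst, WithLp.toLp_fst, norm_smul, hy, Real.norm_of_nonneg hρ.le,
    Real.norm_of_nonneg hs, mul_one]
  rw [mul_div_cancel_left₀ _ hρ.ne', Real.arcsin_sin (by linarith [Real.pi_pos]) hr1]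

theorem contDiffOn_norm_fst :
    ContDiffOn ℝ ∞ (fun x : WithLp 2 (E × F) ↦ ‖x.fst‖) {x | x.fst ≠ 0} :=
  (WithLp.fstL 2 ℝ E F).contDiff.contDiffOn.norm ℝ fun _ hx ↦ hx

theorem contDiffOn_norm_snd :
    ContDiffOn ℝ ∞ (fun x : WithLp 2 (E × F) ↦ ‖x.snd‖) {x | x.snd ≠ 0} :=
  (WithLp.sndL 2 ℝ E F).contDiff.contDiffOn.norm ℝ fun _ hx ↦ hx

theorem contDiffOn_polarAngle :
    ContDiffOn ℝ ∞ (polarAngle : WithLp 2 (E × F) → ℝ) {x | x.fst ≠ 0 ∧ x.snd ≠ 0} := by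
  have h1 : ContDiffOn ℝ ∞ (fun x : WithLp 2 (E × F) ↦ arctan (‖x.fst‖ / ‖x.snd‖))
      {x | x.fst ≠ 0 ∧ x.snd ≠ 0} :=
    Real.contDiff_arctan.comp_contDiffOn ((contDiffOn_norm_fst.mono fun _ hx ↦ hx.1).div
      (contDiffOn_norm_snd.mono fun _ hx ↦ hx.2) fun x hx ↦ norm_ne_zero_iff.2 hx.2)
  exact h1.congr fun x hx ↦ polarAngle_eq_arctan hx.2

theorem hasDerivAt_norm_line {G : Type*} [NormedAddCommGroup G] [InnerProductSpace ℝ G] {x : G}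
    (hx : x ≠ 0) (u : G) : HasDerivAt (fun t : ℝ ↦ ‖x + t • u‖) (⟪x, u⟫ / ‖x‖) 0 := by
  have h1 : HasDerivAt (fun t : ℝ ↦ x + t • u) u 0 := by
    simpa using ((hasDerivAt_id (0 : ℝ)).smul_const u).const_add x
  have h2 := h1.norm_sq.sqrt (by simpa using hx)
  simp only [zero_smul, add_zero, Real.sqrt_sq (norm_nonneg _)] at h2
  refine h2.congr_deriv ?_
  have : ‖x‖ ≠ 0 := norm_ne_zero_iff.2 hx
  field_simp

theorem hasDerivAt_polarAngle_line (h1 : x.fst ≠ 0) (h2 : x.snd ≠ 0) (u : WithLp 2 (E × F)) :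
    HasDerivAt (fun t : ℝ ↦ polarAngle (x + t • u))
      ((⟪x.fst, u.fst⟫ / ‖x.fst‖ * ‖x.snd‖ - ‖x.fst‖ * (⟪x.snd, u.snd⟫ / ‖x.snd‖)) / ‖x‖ ^ 2) 0 := by
  have hA : HasDerivAt (fun t : ℝ ↦ ‖(x + t • u).fst‖) _ 0 := hasDerivAt_norm_line h1 u.fst
  have hD : HasDerivAt (fun t : ℝ ↦ ‖(x + t • u).snd‖) _ 0 := hasDerivAt_norm_line h2 u.snd
  have hD0 : ‖(x + (0 : ℝ) • u).snd‖ ≠ 0 := by simpa using h2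
  have h3 := (hA.div hD hD0).arctan
  have hev : (fun t : ℝ ↦ polarAngle (x + t • u)) =ᶠ[𝓝 0]
      fun t ↦ arctan (‖(x + t • u).fst‖ / ‖(x + t • u).snd‖) := by
    have := hD.continuousAt.eventually_ne hD0
    filter_upwards [this] with t ht
    exact polarAngle_eq_arctan (norm_ne_zero_iff.1 ht)
  refine (h3.congr_of_eventuallyEq hev).congr_deriv ?_
  have hA' : ‖x.fst‖ ≠ 0 := norm_ne_zero_iff.2 h1
  have hD' : ‖x.snd‖ ≠ 0 := norm_ne_zero_iff.2 h2
  have hx := WithLp.prod_norm_sq_eq_of_L2 x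
  simp only [zero_smul, add_zero, Pi.div_apply]
  rw [hx]
  have : ‖x.fst‖ ^ 2 + ‖x.snd‖ ^ 2 ≠ 0 := by positivity
  have h5 : 1 + (‖x.fst‖ / ‖x.snd‖) ^ 2 ≠ 0 := by positivity
  field_simp
  ring

end PolarAngle

/-! ### Polar graphs and rotation invariant fields -/

section PolarGraph

variable {E F : Type*} [NormedAddCommGroup E] [InnerProductSpace ℝ E]
  [NormedAddCommGroup F] [InnerProductSpace ℝ F]

/-- In the open set `U`, the set `M` is the polar graph `‖x‖ = 1 + ψ r` over the angles in `I`. -/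
structure IsPolarGraph (M U : Set (WithLp 2 (E × F))) (ψ : ℝ → ℝ) (I : Set ℝ) : Prop where
  isOpen_I : IsOpen I
  contDiffOn : ContDiffOn ℝ ∞ ψ I
  pos : ∀ r ∈ I, 0 < 1 + ψ r
  isOpen : IsOpen U
  mem : ∀ x ∈ U, x.fst ≠ 0 ∧ x.snd ≠ 0 ∧ polarAngle x ∈ I
  inter_eq : M ∩ U = {x ∈ U | ‖x‖ - (1 + ψ (polarAngle x)) = 0}

/-- The angle of the normal to the polar graph of `1 + ψ`. -/
def normalAngle (ψ : ℝ → ℝ) (r : ℝ) : ℝ := r - arctan (deriv ψ r / (1 + ψ r))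

/-- The rotation invariant field whose angle is `θ`. -/
def angleField (θ : ℝ → ℝ) (x : WithLp 2 (E × F)) : WithLp 2 (E × F) :=
  WithLp.toLp 2 ((sin (θ (polarAngle x)) / ‖x.fst‖) • x.fst,
    (cos (θ (polarAngle x)) / ‖x.snd‖) • x.snd)

theorem inner_angleField (θ : ℝ → ℝ) (x v : WithLp 2 (E × F)) :
    ⟪angleField θ x, v⟫ = sin (θ (polarAngle x)) / ‖x.fst‖ * ⟪x.fst, v.fst⟫ +
      cos (θ (polarAngle x)) / ‖x.snd‖ * ⟪x.snd, v.snd⟫ := by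
  rw [WithLp.prod_inner_apply]
  simp [angleField, real_inner_smul_left]

theorem norm_angleField (θ : ℝ → ℝ) {x : WithLp 2 (E × F)} (h1 : x.fst ≠ 0) (h2 : x.snd ≠ 0) :
    ‖angleField θ x‖ = 1 := by
  have hA' : ‖x.fst‖ ≠ 0 := norm_ne_zero_iff.2 h1
  have hD' : ‖x.snd‖ ≠ 0 := norm_ne_zero_iff.2 h2
  rw [WithLp.prod_norm_eq_of_L2]
  simp only [angleField, WithLp.toLp_fst, WithLp.toLp_snd, norm_smul, norm_div, abs_norm,
    Real.norm_eq_abs]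
  rw [div_mul_cancel₀ _ hA', div_mul_cancel₀ _ hD', sq_abs, sq_abs, Real.sin_sq_add_cos_sq,
    Real.sqrt_one]

theorem contDiffOn_angleField {θ : ℝ → ℝ} {I : Set ℝ} (hθ : ContDiffOn ℝ ∞ θ I)
    {U : Set (WithLp 2 (E × F))} (hU : ∀ x ∈ U, x.fst ≠ 0 ∧ x.snd ≠ 0 ∧ polarAngle x ∈ I) :
    ContDiffOn ℝ ∞ (angleField θ) U := by
  have h1 : ContDiffOn ℝ ∞ (fun x ↦ θ (polarAngle x)) U :=
    hθ.comp (contDiffOn_polarAngle.mono fun x hx ↦ ⟨(hU x hx).1, (hU x hx).2.1⟩)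
      fun x hx ↦ (hU x hx).2.2
  have h2 : ContDiffOn ℝ ∞ (fun x : WithLp 2 (E × F) ↦
      ((sin (θ (polarAngle x)) / ‖x.fst‖) • x.fst, (cos (θ (polarAngle x)) / ‖x.snd‖) • x.snd)) U :=
    (((Real.contDiff_sin.comp_contDiffOn h1).div
      (contDiffOn_norm_fst.mono fun x hx ↦ (hU x hx).1)
        fun x hx ↦ norm_ne_zero_iff.2 (hU x hx).1).smul
          (WithLp.fstL 2 ℝ E F).contDiff.contDiffOn).prodMk
    (((Real.contDiff_cos.comp_contDiffOn h1).div
      (contDiffOn_norm_snd.mono fun x hx ↦ (hU x hx).2.1)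
        fun x hx ↦ norm_ne_zero_iff.2 (hU x hx).2.1).smul
          (WithLp.sndL 2 ℝ E F).contDiff.contDiffOn)
  exact (WithLp.prodContinuousLinearEquiv 2 ℝ E F).symm.contDiff.comp_contDiffOn h2

/-- The field is `sin θ` and `cos θ` times the unit directions of the two components. The first two
terms come from the variation of these directions, each orthogonal to the component itself; the last
comes from the variation of `θ` with the polar angle. -/
theorem inner_fderiv_angleField {θ : ℝ → ℝ} {θ' : ℝ} {x : WithLp 2 (E × F)} (h1 : x.fst ≠ 0)
    (h2 : x.snd ≠ 0) (hθ : HasDerivAt θ θ' (polarAngle x))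
    (hd : DifferentiableAt ℝ (angleField θ) x) (u v : WithLp 2 (E × F)) :
    ⟪fderiv ℝ (angleField θ) x u, v⟫ =
      sin (θ (polarAngle x)) / ‖x.fst‖ *
        (⟪u.fst, v.fst⟫ - ⟪x.fst, u.fst⟫ / ‖x.fst‖ * (⟪x.fst, v.fst⟫ / ‖x.fst‖)) +
      cos (θ (polarAngle x)) / ‖x.snd‖ *
        (⟪u.snd, v.snd⟫ - ⟪x.snd, u.snd⟫ / ‖x.snd‖ * (⟪x.snd, v.snd⟫ / ‖x.snd‖)) +
      θ' * ((⟪x.fst, u.fst⟫ / ‖x.fst‖ * ‖x.snd‖ - ‖x.fst‖ * (⟪x.snd, u.snd⟫ / ‖x.snd‖)) /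
        ‖x‖ ^ 2) * (cos (θ (polarAngle x)) * (⟪x.fst, v.fst⟫ / ‖x.fst‖) -
          sin (θ (polarAngle x)) * (⟪x.snd, v.snd⟫ / ‖x.snd‖)) := by
  have hl : HasDerivAt (fun t : ℝ ↦ x + t • u) u 0 := by
    simpa using ((hasDerivAt_id (0 : ℝ)).smul_const u).const_add x
  have hN : HasDerivAt (fun t : ℝ ↦ angleField θ (x + t • u)) (fderiv ℝ (angleField θ) x u) 0 := by
    have hd' : HasFDerivAt (angleField θ) (fderiv ℝ (angleField θ) x) (x + (0 : ℝ) • u) := by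
      simpa using hd.hasFDerivAt
    exact hd'.comp_hasDerivAt (0 : ℝ) hl
  have hNv := hN.inner ℝ (hasDerivAt_const (0 : ℝ) v)
  simp only [inner_zero_right, zero_add] at hNv
  have hA : HasDerivAt (fun t : ℝ ↦ ‖(x + t • u).fst‖) _ 0 := hasDerivAt_norm_line h1 u.fst
  have hD : HasDerivAt (fun t : ℝ ↦ ‖(x + t • u).snd‖) _ 0 := hasDerivAt_norm_line h2 u.snd
  have hA0 : ‖(x + (0 : ℝ) • u).fst‖ ≠ 0 := by simpa using h1
  have hD0 : ‖(x + (0 : ℝ) • u).snd‖ ≠ 0 := by simpa using h2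
  have hr := hasDerivAt_polarAngle_line h1 h2 u
  have hθr : HasDerivAt (fun t : ℝ ↦ θ (polarAngle (x + t • u))) _ 0 :=
    HasDerivAt.comp (0 : ℝ) (h₂ := θ) (by simpa using hθ) hr
  have hi1 : HasDerivAt (fun t : ℝ ↦ ⟪(x + t • u).fst, v.fst⟫) ⟪u.fst, v.fst⟫ 0 := by
    have h := ((hasDerivAt_id (0 : ℝ)).mul_const ⟪u.fst, v.fst⟫).const_add ⟪x.fst, v.fst⟫
    simpa [inner_add_left, real_inner_smul_left] using h
  have hi2 : HasDerivAt (fun t : ℝ ↦ ⟪(x + t • u).snd, v.snd⟫) ⟪u.snd, v.snd⟫ 0 := by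
    have h := ((hasDerivAt_id (0 : ℝ)).mul_const ⟪u.snd, v.snd⟫).const_add ⟪x.snd, v.snd⟫
    simpa [inner_add_left, real_inner_smul_left] using h
  have htot := ((hθr.sin.div hA hA0).mul hi1).add ((hθr.cos.div hD hD0).mul hi2)
  have hfun : (fun t : ℝ ↦ ⟪angleField θ (x + t • u), v⟫) = _ :=
    funext fun t ↦ inner_angleField θ (x + t • u) v
  rw [hfun] at hNv
  rw [hNv.unique htot]
  have hA' : ‖x.fst‖ ≠ 0 := norm_ne_zero_iff.2 h1
  have hD' : ‖x.snd‖ ≠ 0 := norm_ne_zero_iff.2 h2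
  simp only [zero_smul, add_zero, Pi.div_apply]
  field_simp
  ring

namespace IsPolarGraph

variable {M U : Set (WithLp 2 (E × F))} {ψ : ℝ → ℝ} {I : Set ℝ} {x : WithLp 2 (E × F)}

theorem contDiffOn_normalAngle (h : IsPolarGraph M U ψ I) : ContDiffOn ℝ ∞ (normalAngle ψ) I := by
  have h1 : ContDiffOn ℝ ∞ (deriv ψ) I := h.contDiffOn.deriv_of_isOpen h.isOpen_I (by simp)
  exact contDiffOn_id.sub (Real.contDiff_arctan.comp_contDiffOn
    (h1.div (contDiffOn_const.add h.contDiffOn) fun r hr ↦ (h.pos r hr).ne'))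

/-- This is the rate at which the normal turns with `r`; divided by the speed `W` of the profile
curve it becomes `polarCurvProfile`. -/
theorem hasDerivAt_normalAngle (h : IsPolarGraph M U ψ I) {r : ℝ} (hr : r ∈ I) :
    HasDerivAt (normalAngle ψ)
      (((1 + ψ r) ^ 2 + 2 * deriv ψ r ^ 2 - (1 + ψ r) * deriv (deriv ψ) r) /
        ((1 + ψ r) ^ 2 + deriv ψ r ^ 2)) r := by
  have h1 : ContDiffOn ℝ ∞ (deriv ψ) I := h.contDiffOn.deriv_of_isOpen h.isOpen_I (by simp)
  have hd : HasDerivAt ψ (deriv ψ r) r :=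
    ((h.contDiffOn.contDiffAt (h.isOpen_I.mem_nhds hr)).differentiableAt (by simp)).hasDerivAt
  have hd2 : HasDerivAt (deriv ψ) (deriv (deriv ψ) r) r :=
    ((h1.contDiffAt (h.isOpen_I.mem_nhds hr)).differentiableAt (by simp)).hasDerivAt
  have hp := h.pos r hr
  refine ((hasDerivAt_id r).sub (hd2.div (hd.const_add 1) hp.ne').arctan).congr_deriv ?_
  have h5 : (1 + ψ r) ^ 2 + deriv ψ r ^ 2 ≠ 0 := by positivity
  simp only [Pi.div_apply]
  have h6 : 1 + (deriv ψ r / (1 + ψ r)) ^ 2 ≠ 0 := by positivity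
  field_simp
  ring

end IsPolarGraph

end PolarGraph

/-! ### Principal curvatures of polar graphs -/

section PolarGraphCurvature

/-- The length of the gradient factor `√(ρ² + p²)`, `ρ = 1 + s`, of a polar graph. -/
def polarLength (s p : ℝ) : ℝ := √((1 + s) ^ 2 + p ^ 2)

/-- The principal curvature of a polar graph along the first sphere. -/
def polarCurvFst (r s p : ℝ) : ℝ := (1 - p * (cos r / sin r) / (1 + s)) / polarLength s p

/-- The principal curvature of a polar graph along the second sphere. -/
def polarCurvSnd (r s p : ℝ) : ℝ := (1 + p * (sin r / cos r) / (1 + s)) / polarLength s p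

/-- The principal curvature of a polar graph along its profile curve. -/
def polarCurvProfile (s p p₂ : ℝ) : ℝ :=
  ((1 + s) ^ 2 + 2 * p ^ 2 - (1 + s) * p₂) / polarLength s p ^ 3

variable {E F : Type*} [NormedAddCommGroup E] [InnerProductSpace ℝ E]
  [NormedAddCommGroup F] [InnerProductSpace ℝ F]

theorem polarLength_pos {s p : ℝ} (hs : 0 < 1 + s) : 0 < polarLength s p :=
  Real.sqrt_pos.2 (by positivity)

theorem polarLength_eq {s p : ℝ} (hs : 0 < 1 + s) :
    polarLength s p = (1 + s) * √(1 + (p / (1 + s)) ^ 2) := by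
  unfold polarLength
  rw [show (1 + s) ^ 2 + p ^ 2 = (1 + s) ^ 2 * (1 + (p / (1 + s)) ^ 2) by field_simp,
    Real.sqrt_mul (by positivity), Real.sqrt_sq hs.le]

theorem sum_sq_inner_toLp_fst [FiniteDimensional ℝ E] (w : WithLp 2 (E × F)) :
    ∑ l, ⟪w, WithLp.toLp 2 (stdOrthonormalBasis ℝ E l, (0 : F))⟫ ^ 2 = ‖w.fst‖ ^ 2 := by
  rw [← (stdOrthonormalBasis ℝ E).sum_sq_norm_inner_left w.fst]
  refine Finset.sum_congr rfl fun l _ ↦ ?_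
  rw [WithLp.prod_inner_apply]
  simp [sq_abs]

theorem sum_sq_inner_toLp_snd [FiniteDimensional ℝ F] (w : WithLp 2 (E × F)) :
    ∑ l, ⟪w, WithLp.toLp 2 ((0 : E), stdOrthonormalBasis ℝ F l)⟫ ^ 2 = ‖w.snd‖ ^ 2 := by
  rw [← (stdOrthonormalBasis ℝ F).sum_sq_norm_inner_left w.snd]
  refine Finset.sum_congr rfl fun l _ ↦ ?_
  rw [WithLp.prod_inner_apply]
  simp [sq_abs]

namespace IsPolarGraph

variable {M U : Set (WithLp 2 (E × F))} {ψ : ℝ → ℝ} {I : Set ℝ} {x : WithLp 2 (E × F)}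

theorem norm_eq (h : IsPolarGraph M U ψ I) (hx : x ∈ M ∩ U) : ‖x‖ = 1 + ψ (polarAngle x) := by
  have : x ∈ {x ∈ U | ‖x‖ - (1 + ψ (polarAngle x)) = 0} := h.inter_eq ▸ hx
  exact sub_eq_zero.1 this.2

theorem sin_normalAngle (h : IsPolarGraph M U ψ I) (hx : x ∈ M ∩ U) :
    sin (normalAngle ψ (polarAngle x)) =
      (‖x.fst‖ - ‖x.snd‖ * (deriv ψ (polarAngle x) / ‖x‖)) /
        polarLength (ψ (polarAngle x)) (deriv ψ (polarAngle x)) := by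
  have hx0 : x ≠ 0 := fun h0 ↦ (h.mem x hx.2).1 (by simp [h0])
  have hpos := h.pos _ (h.mem x hx.2).2.2
  have hρ := h.norm_eq hx
  have hρ0 : ‖x‖ ≠ 0 := norm_ne_zero_iff.2 hx0
  rw [normalAngle, Real.sin_sub, Real.sin_arctan, Real.cos_arctan, sin_polarAngle,
    cos_polarAngle hx0, polarLength_eq hpos, ← hρ]
  have : 0 < √(1 + (deriv ψ (polarAngle x) / ‖x‖) ^ 2) := Real.sqrt_pos.2 (by positivity)
  field_simp

theorem cos_normalAngle (h : IsPolarGraph M U ψ I) (hx : x ∈ M ∩ U) :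
    cos (normalAngle ψ (polarAngle x)) =
      (‖x.snd‖ + ‖x.fst‖ * (deriv ψ (polarAngle x) / ‖x‖)) /
        polarLength (ψ (polarAngle x)) (deriv ψ (polarAngle x)) := by
  have hx0 : x ≠ 0 := fun h0 ↦ (h.mem x hx.2).1 (by simp [h0])
  have hpos := h.pos _ (h.mem x hx.2).2.2
  have hρ := h.norm_eq hx
  have hρ0 : ‖x‖ ≠ 0 := norm_ne_zero_iff.2 hx0
  rw [normalAngle, Real.cos_sub, Real.sin_arctan, Real.cos_arctan, sin_polarAngle,
    cos_polarAngle hx0, polarLength_eq hpos, ← hρ]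
  have : 0 < √(1 + (deriv ψ (polarAngle x) / ‖x‖) ^ 2) := Real.sqrt_pos.2 (by positivity)
  field_simp

theorem contDiffOn_defining (h : IsPolarGraph M U ψ I) :
    ContDiffOn ℝ ∞ (fun x : WithLp 2 (E × F) ↦ ‖x‖ - (1 + ψ (polarAngle x))) U := by
  have h1 : ContDiffOn ℝ ∞ (fun x : WithLp 2 (E × F) ↦ ‖x‖) U :=
    contDiffOn_id.norm ℝ fun x hx h0 ↦ (h.mem x hx).1 (by simp [show x = 0 from h0])
  exact h1.sub (contDiffOn_const.add (h.contDiffOn.comp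
    (contDiffOn_polarAngle.mono fun x hx ↦ ⟨(h.mem x hx).1, (h.mem x hx).2.1⟩)
      fun x hx ↦ (h.mem x hx).2.2))

/-- The gradient of `‖x‖ - ρ(r)` has radial part `1` and angular part `-p/ρ`. Its length is `W/ρ`,
and its direction is the radial one turned by `arctan (p/ρ)`, which is `normalAngle`. -/
theorem fderiv_defining (h : IsPolarGraph M U ψ I) (hx : x ∈ M ∩ U) (u : WithLp 2 (E × F)) :
    fderiv ℝ (fun x : WithLp 2 (E × F) ↦ ‖x‖ - (1 + ψ (polarAngle x))) x u =
      polarLength (ψ (polarAngle x)) (deriv ψ (polarAngle x)) / ‖x‖ *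
        ⟪angleField (normalAngle ψ) x, u⟫ := by
  obtain ⟨h1, h2, h3⟩ := h.mem x hx.2
  have hx0 : x ≠ 0 := fun h0 ↦ h1 (by simp [h0])
  have hpos := h.pos _ h3
  set G := fun x : WithLp 2 (E × F) ↦ ‖x‖ - (1 + ψ (polarAngle x)) with hG
  have hl : HasDerivAt (fun t : ℝ ↦ x + t • u) u 0 := by
    simpa using ((hasDerivAt_id (0 : ℝ)).smul_const u).const_add x
  have hd : HasFDerivAt G (fderiv ℝ G x) (x + (0 : ℝ) • u) := by
    simpa using ((h.contDiffOn_defining.contDiffAt (h.isOpen.mem_nhds hx.2)).differentiableAt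
      (by simp)).hasFDerivAt
  have hd1 := hd.comp_hasDerivAt (0 : ℝ) hl
  have hψ : HasDerivAt ψ (deriv ψ (polarAngle x)) (polarAngle (x + (0 : ℝ) • u)) := by
    simpa using ((h.contDiffOn.contDiffAt (h.isOpen_I.mem_nhds h3)).differentiableAt
      (by simp)).hasDerivAt
  have hd2 := (hasDerivAt_norm_line hx0 u).sub
    ((hψ.comp (0 : ℝ) (hasDerivAt_polarAngle_line h1 h2 u)).const_add 1)
  rw [hd1.unique hd2, inner_angleField, h.sin_normalAngle hx, h.cos_normalAngle hx,
    WithLp.prod_inner_apply]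
  have hA' : ‖x.fst‖ ≠ 0 := norm_ne_zero_iff.2 h1
  have hD' : ‖x.snd‖ ≠ 0 := norm_ne_zero_iff.2 h2
  have hρ0 : ‖x‖ ≠ 0 := norm_ne_zero_iff.2 hx0
  have hW := (polarLength_pos (p := deriv ψ (polarAngle x)) hpos).ne'
  simp only [WithLp.ofLp_fst, WithLp.ofLp_snd]
  field_simp
  ring

theorem isLocalNormal [CompleteSpace E] [CompleteSpace F] (h : IsPolarGraph M U ψ I) :
    IsLocalNormal M U (angleField (normalAngle ψ)) := by
  refine isLocalNormal_of_fderiv_eq h.isOpen h.contDiffOn_defining h.inter_eq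
    (contDiffOn_angleField h.contDiffOn_normalAngle h.mem)
    (fun x hx ↦ norm_angleField _ (h.mem x hx).1 (h.mem x hx).2.1)
    (c := fun x ↦ polarLength (ψ (polarAngle x)) (deriv ψ (polarAngle x)) / ‖x‖) ?_
  intro x hx
  have hx0 : x ≠ 0 := fun h0 ↦ (h.mem x hx.2).1 (by simp [h0])
  exact ⟨div_ne_zero (polarLength_pos (h.pos _ (h.mem x hx.2).2.2)).ne' (norm_ne_zero_iff.2 hx0),
    h.fderiv_defining hx⟩

/-- The product equals `‖x‖² / W`. Positivity decides that `outerNormal` agrees with this field, so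
that the mean curvature is obtained with its sign. -/
theorem inner_angleField_self_pos (h : IsPolarGraph M U ψ I) (hx : x ∈ M ∩ U) :
    0 < ⟪angleField (normalAngle ψ) x, x⟫ := by
  obtain ⟨h1, h2, h3⟩ := h.mem x hx.2
  have hx0 : x ≠ 0 := fun h0 ↦ h1 (by simp [h0])
  have hA' : 0 < ‖x.fst‖ := norm_pos_iff.2 h1
  have hD' : 0 < ‖x.snd‖ := norm_pos_iff.2 h2
  have hρ0 : 0 < ‖x‖ := norm_pos_iff.2 hx0
  have hW := polarLength_pos (p := deriv ψ (polarAngle x)) (h.pos _ h3)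
  rw [inner_angleField, h.sin_normalAngle hx, h.cos_normalAngle hx, real_inner_self_eq_norm_sq,
    real_inner_self_eq_norm_sq]
  have : (‖x.fst‖ - ‖x.snd‖ * (deriv ψ (polarAngle x) / ‖x‖)) /
        polarLength (ψ (polarAngle x)) (deriv ψ (polarAngle x)) / ‖x.fst‖ * ‖x.fst‖ ^ 2 +
      (‖x.snd‖ + ‖x.fst‖ * (deriv ψ (polarAngle x) / ‖x‖)) /
        polarLength (ψ (polarAngle x)) (deriv ψ (polarAngle x)) / ‖x.snd‖ * ‖x.snd‖ ^ 2 =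
      (‖x.fst‖ ^ 2 + ‖x.snd‖ ^ 2) / polarLength (ψ (polarAngle x)) (deriv ψ (polarAngle x)) := by
    field_simp
    ring
  rw [this]
  positivity

/-- The second fundamental form of a polar graph is diagonal in the frame given by the two spheres
and the profile curve. -/
theorem inner_fderiv_normal (h : IsPolarGraph M U ψ I) (hx : x ∈ M ∩ U)
    {u v : WithLp 2 (E × F)} (hu : ⟪angleField (normalAngle ψ) x, u⟫ = 0) :
    ⟪fderiv ℝ (angleField (normalAngle ψ)) x u, v⟫ =
      polarCurvFst (polarAngle x) (ψ (polarAngle x)) (deriv ψ (polarAngle x)) *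
        (⟪u.fst, v.fst⟫ - ⟪x.fst, u.fst⟫ / ‖x.fst‖ * (⟪x.fst, v.fst⟫ / ‖x.fst‖)) +
      polarCurvSnd (polarAngle x) (ψ (polarAngle x)) (deriv ψ (polarAngle x)) *
        (⟪u.snd, v.snd⟫ - ⟪x.snd, u.snd⟫ / ‖x.snd‖ * (⟪x.snd, v.snd⟫ / ‖x.snd‖)) +
      polarCurvProfile (ψ (polarAngle x)) (deriv ψ (polarAngle x)) (deriv (deriv ψ) (polarAngle x)) *
        ((cos (normalAngle ψ (polarAngle x)) * (⟪x.fst, u.fst⟫ / ‖x.fst‖) -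
          sin (normalAngle ψ (polarAngle x)) * (⟪x.snd, u.snd⟫ / ‖x.snd‖)) *
        (cos (normalAngle ψ (polarAngle x)) * (⟪x.fst, v.fst⟫ / ‖x.fst‖) -
          sin (normalAngle ψ (polarAngle x)) * (⟪x.snd, v.snd⟫ / ‖x.snd‖))) := by
  obtain ⟨h1, h2, h3⟩ := h.mem x hx.2
  have hx0 : x ≠ 0 := fun h0 ↦ h1 (by simp [h0])
  have hpos := h.pos _ h3
  have hA' : ‖x.fst‖ ≠ 0 := norm_ne_zero_iff.2 h1
  have hD' : ‖x.snd‖ ≠ 0 := norm_ne_zero_iff.2 h2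
  have hρ0 : ‖x‖ ≠ 0 := norm_ne_zero_iff.2 hx0
  have hρ := h.norm_eq hx
  have hsq := WithLp.prod_norm_sq_eq_of_L2 x
  have hd : DifferentiableAt ℝ (angleField (normalAngle ψ)) x :=
    ((contDiffOn_angleField h.contDiffOn_normalAngle h.mem).contDiffAt
      (h.isOpen.mem_nhds hx.2)).differentiableAt (by simp)
  rw [inner_fderiv_angleField h1 h2 (h.hasDerivAt_normalAngle h3) hd]
  have hW := (polarLength_pos (p := deriv ψ (polarAngle x)) hpos).ne'
  have hWsq : polarLength (ψ (polarAngle x)) (deriv ψ (polarAngle x)) ^ 2 =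
      (1 + ψ (polarAngle x)) ^ 2 + deriv ψ (polarAngle x) ^ 2 := Real.sq_sqrt (by positivity)
  have hsin := h.sin_normalAngle hx
  have hcos := h.cos_normalAngle hx
  rw [inner_angleField] at hu
  -- The curvature along a rotation sphere is the component of the normal in its radial direction
  -- divided by its radius.
  have hc1 : sin (normalAngle ψ (polarAngle x)) / ‖x.fst‖ =
      polarCurvFst (polarAngle x) (ψ (polarAngle x)) (deriv ψ (polarAngle x)) := by
    rw [hsin, polarCurvFst, sin_polarAngle, cos_polarAngle hx0, ← hρ]
    field_simp
  have hc2 : cos (normalAngle ψ (polarAngle x)) / ‖x.snd‖ =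
      polarCurvSnd (polarAngle x) (ψ (polarAngle x)) (deriv ψ (polarAngle x)) := by
    rw [hcos, polarCurvSnd, sin_polarAngle, cos_polarAngle hx0, ← hρ]
    field_simp
  have hc3 : polarCurvProfile (ψ (polarAngle x)) (deriv ψ (polarAngle x))
      (deriv (deriv ψ) (polarAngle x)) =
      (((1 + ψ (polarAngle x)) ^ 2 + 2 * deriv ψ (polarAngle x) ^ 2 -
        (1 + ψ (polarAngle x)) * deriv (deriv ψ) (polarAngle x)) /
        ((1 + ψ (polarAngle x)) ^ 2 + deriv ψ (polarAngle x) ^ 2)) /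
        polarLength (ψ (polarAngle x)) (deriv ψ (polarAngle x)) := by
    rw [polarCurvProfile, ← hWsq]
    field_simp
  rw [hc1, hc2, hc3]
  set W := polarLength (ψ (polarAngle x)) (deriv ψ (polarAngle x))
  set S := sin (normalAngle ψ (polarAngle x))
  set C := cos (normalAngle ψ (polarAngle x))
  have hSC : S ^ 2 + C ^ 2 = 1 := Real.sin_sq_add_cos_sq _
  set α := ⟪x.fst, u.fst⟫ / ‖x.fst‖ with hα
  set β := ⟪x.snd, u.snd⟫ / ‖x.snd‖ with hβ
  have hu' : S * α + C * β = 0 := by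
    rw [← hu, hα, hβ]
    ring
  -- Tangency `Sα + Cβ = 0` makes `(α, β)` a multiple of `(C, -S)`, the direction of the profile
  -- curve.
  have hα' : α = C * (C * α - S * β) := by linear_combination (-α) * hSC + S * hu'
  have hβ' : β = -S * (C * α - S * β) := by linear_combination (-β) * hSC + C * hu'
  -- The polar angle varies by the profile component of `u` divided by the speed `W`; this is
  -- symmetric to the factor multiplying it and gives a diagonal form.
  have hdr : (α * ‖x.snd‖ - ‖x.fst‖ * β) / ‖x‖ ^ 2 = (C * α - S * β) / W := by
    have h5 : C * ‖x.snd‖ + S * ‖x.fst‖ = ‖x‖ ^ 2 / W := by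
      rw [hsin, hcos, hsq]
      field_simp
      ring
    calc (α * ‖x.snd‖ - ‖x.fst‖ * β) / ‖x‖ ^ 2
        = (C * (C * α - S * β) * ‖x.snd‖ - ‖x.fst‖ * (-S * (C * α - S * β))) / ‖x‖ ^ 2 := by
          rw [← hα', ← hβ']
      _ = (C * ‖x.snd‖ + S * ‖x.fst‖) * (C * α - S * β) / ‖x‖ ^ 2 := by ring
      _ = (C * α - S * β) / W := by rw [h5]; field_simp
  rw [hdr]
  ring

/-- Each curvature multiplies a bilinear form bounded by `4‖u‖‖v‖`. The factor `4` is attained as `2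
· 2` in the profile term, whose linear form is crudely bounded by `2‖w‖`. -/
theorem abs_secondFundamentalForm_le [CompleteSpace E] [CompleteSpace F]
    (h : IsPolarGraph M U ψ I) (hx : x ∈ M ∩ U) {u v : WithLp 2 (E × F)}
    (hu : u ∈ tangentSpaceAt M x) :
    |secondFundamentalForm (outerNormal M x) x u v| ≤
      4 * (|polarCurvFst (polarAngle x) (ψ (polarAngle x)) (deriv ψ (polarAngle x))| +
        |polarCurvSnd (polarAngle x) (ψ (polarAngle x)) (deriv ψ (polarAngle x))| +
        |polarCurvProfile (ψ (polarAngle x)) (deriv ψ (polarAngle x))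
          (deriv (deriv ψ) (polarAngle x))|) * (‖u‖ * ‖v‖) := by
  have hN := h.isLocalNormal
  obtain ⟨h1, h2, h3⟩ := h.mem x hx.2
  rw [hN.abs_secondFundamentalForm hx hu, h.inner_fderiv_normal hx
    ((hN.mem_tangentSpaceAt_iff hx).1 hu)]
  have hf : ∀ w : WithLp 2 (E × F), |⟪x.fst, w.fst⟫ / ‖x.fst‖| ≤ ‖w‖ := by
    intro w
    have hA' : 0 < ‖x.fst‖ := norm_pos_iff.2 h1
    rw [abs_div, abs_of_pos hA', div_le_iff₀ hA', mul_comm]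
    exact (abs_real_inner_le_norm _ _).trans (by gcongr; exact WithLp.norm_fst_le _ w)
  have hs : ∀ w : WithLp 2 (E × F), |⟪x.snd, w.snd⟫ / ‖x.snd‖| ≤ ‖w‖ := by
    intro w
    have hA' : 0 < ‖x.snd‖ := norm_pos_iff.2 h2
    rw [abs_div, abs_of_pos hA', div_le_iff₀ hA', mul_comm]
    exact (abs_real_inner_le_norm _ _).trans (by gcongr; exact WithLp.norm_snd_le _ w)
  have ht : ∀ w : WithLp 2 (E × F), |cos (normalAngle ψ (polarAngle x)) * (⟪x.fst, w.fst⟫ / ‖x.fst‖) -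
          sin (normalAngle ψ (polarAngle x)) * (⟪x.snd, w.snd⟫ / ‖x.snd‖)| ≤ 2 * ‖w‖ := by
    intro w
    refine (abs_sub _ _).trans ?_
    rw [abs_mul, abs_mul]
    have e1 := mul_le_mul (Real.abs_cos_le_one (normalAngle ψ (polarAngle x))) (hf w) (abs_nonneg _)
      zero_le_one
    have e2 := mul_le_mul (Real.abs_sin_le_one (normalAngle ψ (polarAngle x))) (hs w) (abs_nonneg _)
      zero_le_one
    linarith
  have e1 : |⟪u.fst, v.fst⟫ - ⟪x.fst, u.fst⟫ / ‖x.fst‖ * (⟪x.fst, v.fst⟫ / ‖x.fst‖)| ≤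
      4 * (‖u‖ * ‖v‖) := by
    refine (abs_sub _ _).trans ?_
    rw [abs_mul]
    have f1 := mul_le_mul (hf u) (hf v) (abs_nonneg _) (norm_nonneg _)
    have f2 := (abs_real_inner_le_norm u.fst v.fst).trans
      (mul_le_mul (WithLp.norm_fst_le _ u) (WithLp.norm_fst_le _ v) (norm_nonneg _) (norm_nonneg _))
    have : 0 ≤ ‖u‖ * ‖v‖ := by positivity
    linarith
  have e2 : |⟪u.snd, v.snd⟫ - ⟪x.snd, u.snd⟫ / ‖x.snd‖ * (⟪x.snd, v.snd⟫ / ‖x.snd‖)| ≤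
      4 * (‖u‖ * ‖v‖) := by
    refine (abs_sub _ _).trans ?_
    rw [abs_mul]
    have f1 := mul_le_mul (hs u) (hs v) (abs_nonneg _) (norm_nonneg _)
    have f2 := (abs_real_inner_le_norm u.snd v.snd).trans
      (mul_le_mul (WithLp.norm_snd_le _ u) (WithLp.norm_snd_le _ v) (norm_nonneg _) (norm_nonneg _))
    have : 0 ≤ ‖u‖ * ‖v‖ := by positivity
    linarith
  have e3 := mul_le_mul (ht u) (ht v) (abs_nonneg _) (by positivity)
  refine (abs_add_three _ _ _).trans ?_
  rw [abs_mul, abs_mul, abs_mul (polarCurvProfile _ _ _), abs_mul (_ - _)]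
  have g1 := mul_le_mul_of_nonneg_left e1 (abs_nonneg
    (polarCurvFst (polarAngle x) (ψ (polarAngle x)) (deriv ψ (polarAngle x))))
  have g2 := mul_le_mul_of_nonneg_left e2 (abs_nonneg
    (polarCurvSnd (polarAngle x) (ψ (polarAngle x)) (deriv ψ (polarAngle x))))
  have g3 := mul_le_mul_of_nonneg_left e3 (abs_nonneg
    (polarCurvProfile (ψ (polarAngle x)) (deriv ψ (polarAngle x)) (deriv (deriv ψ) (polarAngle x))))
  linarith

/-- The trace of the diagonal form is computed without an adapted frame: by Parseval on the tangent
space, the squared components of any orthonormal basis have the same sums. -/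
theorem meanCurvature_eq [FiniteDimensional ℝ E] [FiniteDimensional ℝ F]
    (h : IsPolarGraph M U ψ I) (hx : x ∈ M ∩ U) {n : ℕ}
    (hn : Module.finrank ℝ (WithLp 2 (E × F)) = n + 1) :
    meanCurvature M x =
      ((Module.finrank ℝ E - 1) *
          polarCurvFst (polarAngle x) (ψ (polarAngle x)) (deriv ψ (polarAngle x)) +
        (Module.finrank ℝ F - 1) *
          polarCurvSnd (polarAngle x) (ψ (polarAngle x)) (deriv ψ (polarAngle x)) +
        polarCurvProfile (ψ (polarAngle x)) (deriv ψ (polarAngle x))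
          (deriv (deriv ψ) (polarAngle x))) / n := by
  have hN := h.isLocalNormal
  obtain ⟨h1, h2, h3⟩ := h.mem x hx.2
  have hA' : ‖x.fst‖ ≠ 0 := norm_ne_zero_iff.2 h1
  have hD' : ‖x.snd‖ ≠ 0 := norm_ne_zero_iff.2 h2
  obtain ⟨σ, -, hσ, hH⟩ := hN.exists_sign_meanCurvature hx hn
  rw [hH, hσ (h.inner_angleField_self_pos hx), one_mul]
  congr 1
  set N := angleField (normalAngle ψ) x with hNx
  set b := fun i ↦ (stdOrthonormalBasis ℝ (tangentSpaceAt M x) i : WithLp 2 (E × F)) with hb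
  have hbT : ∀ i, ⟪N, b i⟫ = 0 := fun i ↦
    (hN.mem_tangentSpaceAt_iff hx).1 (Submodule.coe_mem _)
  have hpars : ∀ w, ∑ i, ⟪b i, w⟫ ^ 2 = ‖w‖ ^ 2 - ⟪N, w⟫ ^ 2 :=
    hN.sum_inner_stdOrthonormalBasis_sq hx
  set S := sin (normalAngle ψ (polarAngle x)) with hS
  set C := cos (normalAngle ψ (polarAngle x)) with hC
  have hSC : S ^ 2 + C ^ 2 = 1 := Real.sin_sq_add_cos_sq _
  have hNf : ‖N.fst‖ ^ 2 = S ^ 2 := by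
    simp only [hNx, angleField, WithLp.toLp_fst, norm_smul, norm_div, norm_norm]
    rw [div_mul_cancel₀ _ hA', Real.norm_eq_abs, sq_abs]
  have hNs : ‖N.snd‖ ^ 2 = C ^ 2 := by
    simp only [hNx, angleField, WithLp.toLp_snd, norm_smul, norm_div, norm_norm]
    rw [div_mul_cancel₀ _ hD', Real.norm_eq_abs, sq_abs]
  -- After subtraction of the sum `1 - S²` of `hα`, `dim E - 1` remains, the dimension of the first
  -- sphere.
  have hsumf : ∑ i, ‖(b i).fst‖ ^ 2 = Module.finrank ℝ E - S ^ 2 := by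
    simp_rw [← sum_sq_inner_toLp_fst]
    rw [Finset.sum_comm]
    simp_rw [hpars]
    rw [Finset.sum_sub_distrib, sum_sq_inner_toLp_fst, hNf]
    simp
  have hsums : ∑ i, ‖(b i).snd‖ ^ 2 = Module.finrank ℝ F - C ^ 2 := by
    simp_rw [← sum_sq_inner_toLp_snd]
    rw [Finset.sum_comm]
    simp_rw [hpars]
    rw [Finset.sum_sub_distrib, sum_sq_inner_toLp_snd, hNs]
    simp
  have hα : ∑ i, (⟪x.fst, (b i).fst⟫ / ‖x.fst‖) ^ 2 = 1 - S ^ 2 := by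
    have e : ∀ i, ⟪x.fst, (b i).fst⟫ / ‖x.fst‖ =
        ⟪b i, WithLp.toLp 2 (‖x.fst‖⁻¹ • x.fst, (0 : F))⟫ := by
      intro i
      rw [WithLp.prod_inner_apply]
      simp only [WithLp.ofLp_fst, WithLp.ofLp_snd, inner_zero_right, add_zero,
        real_inner_smul_right]
      rw [real_inner_comm]
      ring
    simp_rw [e]
    rw [hpars, hNx, inner_angleField, WithLp.norm_toLp_fst, norm_smul, norm_inv, norm_norm,
      inv_mul_cancel₀ hA']
    simp only [WithLp.toLp_fst, WithLp.toLp_snd, real_inner_smul_right, real_inner_self_eq_norm_sq,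
      inner_zero_right]
    rw [← hS]
    field_simp
    ring
  have hβ : ∑ i, (⟪x.snd, (b i).snd⟫ / ‖x.snd‖) ^ 2 = 1 - C ^ 2 := by
    have e : ∀ i, ⟪x.snd, (b i).snd⟫ / ‖x.snd‖ =
        ⟪b i, WithLp.toLp 2 ((0 : E), ‖x.snd‖⁻¹ • x.snd)⟫ := by
      intro i
      rw [WithLp.prod_inner_apply]
      simp only [WithLp.ofLp_fst, WithLp.ofLp_snd, inner_zero_right, zero_add,
        real_inner_smul_right]
      rw [real_inner_comm]
      ring
    simp_rw [e]
    rw [hpars, hNx, inner_angleField, WithLp.norm_toLp_snd, norm_smul, norm_inv, norm_norm,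
      inv_mul_cancel₀ hD']
    simp only [WithLp.toLp_fst, WithLp.toLp_snd, real_inner_smul_right, real_inner_self_eq_norm_sq,
      inner_zero_right]
    rw [← hC]
    field_simp
    ring
  -- The rotated pair `(Cα - Sβ, Sα + Cβ)` has the same length as `(α, β)`, and its second entry
  -- vanishes on tangent vectors.
  have hτ : ∀ i, (C * (⟪x.fst, (b i).fst⟫ / ‖x.fst‖) - S * (⟪x.snd, (b i).snd⟫ / ‖x.snd‖)) ^ 2 =
      (⟪x.fst, (b i).fst⟫ / ‖x.fst‖) ^ 2 + (⟪x.snd, (b i).snd⟫ / ‖x.snd‖) ^ 2 := by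
    intro i
    have e := hbT i
    rw [hNx, inner_angleField, ← hS, ← hC] at e
    have e' : S * (⟪x.fst, (b i).fst⟫ / ‖x.fst‖) + C * (⟪x.snd, (b i).snd⟫ / ‖x.snd‖) = 0 := by
      rw [← e]; ring
    linear_combination ((⟪x.fst, (b i).fst⟫ / ‖x.fst‖) ^ 2 + (⟪x.snd, (b i).snd⟫ / ‖x.snd‖) ^ 2) * hSC -
      (S * (⟪x.fst, (b i).fst⟫ / ‖x.fst‖) + C * (⟪x.snd, (b i).snd⟫ / ‖x.snd‖)) * e'
  have hterm : ∀ i, ⟪fderiv ℝ (angleField (normalAngle ψ)) x (b i), b i⟫ =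
      polarCurvFst (polarAngle x) (ψ (polarAngle x)) (deriv ψ (polarAngle x)) *
        (‖(b i).fst‖ ^ 2 - (⟪x.fst, (b i).fst⟫ / ‖x.fst‖) ^ 2) +
      polarCurvSnd (polarAngle x) (ψ (polarAngle x)) (deriv ψ (polarAngle x)) *
        (‖(b i).snd‖ ^ 2 - (⟪x.snd, (b i).snd⟫ / ‖x.snd‖) ^ 2) +
      polarCurvProfile (ψ (polarAngle x)) (deriv ψ (polarAngle x)) (deriv (deriv ψ) (polarAngle x)) *
        ((⟪x.fst, (b i).fst⟫ / ‖x.fst‖) ^ 2 + (⟪x.snd, (b i).snd⟫ / ‖x.snd‖) ^ 2) := by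
    intro i
    rw [h.inner_fderiv_normal hx (hbT i), ← hτ i, real_inner_self_eq_norm_sq,
      real_inner_self_eq_norm_sq]
    ring
  rw [Finset.sum_congr rfl fun i _ ↦ hterm i, Finset.sum_add_distrib, Finset.sum_add_distrib,
    ← Finset.mul_sum, ← Finset.mul_sum, ← Finset.mul_sum, Finset.sum_sub_distrib,
    Finset.sum_sub_distrib, Finset.sum_add_distrib, hsumf, hsums, hα, hβ]
  linear_combination (-(polarCurvProfile (ψ (polarAngle x)) (deriv ψ (polarAngle x))
    (deriv (deriv ψ) (polarAngle x)))) * hSC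

end IsPolarGraph

end PolarGraphCurvature

/-! ### Gluing profiles and the polar description of the hypersurface -/

section GluingProfile

/-- A gluing profile together with the smallness conditions under which the hypersurface is
embedded. -/
structure IsSmallGluingProfile (n k : ℕ) (a ε : ℝ) (φ : ℝ → ℝ) : Prop
    extends IsGluingProfile n k a ε φ where
  codim : k + 2 ≤ n
  a_pos : 0 < a
  a_lt : a < π / 10
  eps_pos : 0 < ε
  eps_lt : ε < a
  abs_lt_half : ∀ r ∈ Icc ε (π / 2), |φ r| < 1 / 2

namespace IsSmallGluingProfile

variable {n k : ℕ} {a ε r : ℝ} {φ : ℝ → ℝ}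

theorem one_le (h : IsSmallGluingProfile n k a ε φ) : 1 ≤ n - k - 1 := by
  have := h.codim
  lia

theorem lt_pi (h : IsSmallGluingProfile n k a ε φ) : 2 * a + ε < π / 3 := by
  have h1 := h.a_lt
  have h2 := h.eps_lt
  have := Real.pi_pos
  linarith

theorem lt_pi_div_two (h : IsSmallGluingProfile n k a ε φ) : 2 * a + ε < π / 2 := by
  have := Real.pi_pos
  linarith [h.lt_pi]

theorem one_add_pos (h : IsSmallGluingProfile n k a ε φ) (hr : r ∈ Icc ε (π / 2)) :
    0 < 1 + φ r := by
  linarith [(abs_lt.1 (h.abs_lt_half r hr)).1]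

theorem one_sub_pos (h : IsSmallGluingProfile n k a ε φ) (hr : r ∈ Icc ε (π / 2)) :
    0 < 1 - φ r := by
  linarith [(abs_lt.1 (h.abs_lt_half r hr)).2]

theorem apply_eps (h : IsSmallGluingProfile n k a ε φ) : φ ε = 0 := by
  rw [h.eq_neck ε ⟨le_rfl, by linarith [h.a_pos]⟩, neckProfile_eq, div_self h.eps_pos.ne',
    catenoidProfile_one, mul_zero]

theorem eventuallyEq_neck (h : IsSmallGluingProfile n k a ε φ) (hr : r ∈ Ioo ε (a + ε)) :
    φ =ᶠ[𝓝 r] fun r ↦ ε * catenoidProfile (n - k - 1) (r / ε) := by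
  filter_upwards [isOpen_Ioo.mem_nhds hr] with t ht
  exact h.eq_neck t ⟨ht.1.le, ht.2.le⟩

theorem deriv_eq_neckSlope (h : IsSmallGluingProfile n k a ε φ) (hr : r ∈ Ioo ε (a + ε)) :
    deriv φ r = neckSlope (n - k - 1) ε r := by
  rw [(h.eventuallyEq_neck hr).deriv_eq]
  exact (hasDerivAt_smul_catenoidProfile h.one_le h.eps_pos hr.1).deriv

theorem deriv_deriv_eq (h : IsSmallGluingProfile n k a ε φ) (hr : r ∈ Ioo ε (a + ε)) :
    deriv (deriv φ) r = -((n - k - 1 : ℕ) / r) * deriv φ r * (1 + deriv φ r ^ 2) := by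
  have : deriv φ =ᶠ[𝓝 r] neckSlope (n - k - 1) ε := by
    filter_upwards [isOpen_Ioo.mem_nhds hr] with t ht using h.deriv_eq_neckSlope ht
  rw [this.deriv_eq, h.deriv_eq_neckSlope hr]
  exact (hasDerivAt_neckSlope h.one_le h.eps_pos hr.1).deriv

theorem continuousOn (h : IsSmallGluingProfile n k a ε φ) : ContinuousOn φ (Icc ε (π / 2)) := by
  intro r hr
  rcases hr.1.eq_or_lt with rfl | hr'
  · have h1 := (continuousOn_smul_catenoidProfile h.one_le h.eps_pos) ε self_mem_Ici
    refine (h1.mono fun t ht ↦ ht.1).congr_of_eventuallyEq ?_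
      (h.eq_neck ε ⟨le_rfl, by linarith [h.a_pos]⟩)
    filter_upwards [self_mem_nhdsWithin, mem_nhdsWithin_of_mem_nhds
      (Iic_mem_nhds (show ε < a + ε by linarith [h.a_pos]))] with t ht ht'
    exact h.eq_neck t ⟨ht.1, ht'⟩
  · refine (h.smooth.continuousOn r ⟨hr', hr.2⟩).mono_of_mem_nhdsWithin ?_
    filter_upwards [self_mem_nhdsWithin, mem_nhdsWithin_of_mem_nhds (Ioi_mem_nhds hr')] with t h1 h2
    exact ⟨h2, h1.2⟩

theorem contDiffOn_Ioo (h : IsSmallGluingProfile n k a ε φ) : ContDiffOn ℝ ∞ φ (Ioo ε (π / 2)) :=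
  h.smooth.mono fun _ hr ↦ ⟨hr.1, hr.2.le⟩

theorem neck_pos (h : IsSmallGluingProfile n k a ε φ) (hr : r ∈ Ioc ε (a + ε)) : 0 < φ r := by
  rw [h.eq_neck r ⟨hr.1.le, hr.2⟩, neckProfile_eq]
  have h1 : 1 < r / ε := (one_lt_div h.eps_pos).2 hr.1
  have h2 := catenoidProfile_strictMonoOn h.one_le self_mem_Ici (show 1 ≤ r / ε from h1.le) h1
  rw [catenoidProfile_one] at h2
  exact mul_pos h.eps_pos h2

/-- At the left end `2a + ε` only the right neighbourhood is known to be constant. Smoothness there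
makes the right derivative the full derivative. -/
theorem deriv_eq_zero (h : IsSmallGluingProfile n k a ε φ) (hr : r ∈ Ico (2 * a + ε) (π / 2)) :
    deriv φ r = 0 := by
  obtain ⟨b, -, hb⟩ := h.eq_const
  have hrI : r ∈ Ioo ε (π / 2) := ⟨by linarith [hr.1, h.a_pos], hr.2⟩
  have h1 : HasDerivAt φ (deriv φ r) r :=
    ((h.contDiffOn_Ioo.contDiffAt (isOpen_Ioo.mem_nhds hrI)).differentiableAt (by simp)).hasDerivAt
  have h2 : HasDerivWithinAt φ 0 (Ici r) r := by
    refine (hasDerivWithinAt_const r (Ici r) b).congr_of_eventuallyEq ?_ (hb r ⟨hr.1, hr.2.le⟩)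
    filter_upwards [self_mem_nhdsWithin, mem_nhdsWithin_of_mem_nhds (Iic_mem_nhds hr.2)]
      with t ht ht'
    exact hb t ⟨hr.1.trans ht, ht'⟩
  exact (uniqueDiffOn_Ici r r self_mem_Ici).eq_deriv _ h1.hasDerivWithinAt h2

/-- The derivative vanishes at `2a + ε`, so concavity places the value there above the value at `a +
ε`, which is positive. Between the two points a concave function exceeds the smaller end value.
Positivity is what separates the two sheets. -/
theorem pos (h : IsSmallGluingProfile n k a ε φ) (hr : r ∈ Ioc ε (π / 2)) : 0 < φ r := by
  have ha := h.a_pos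
  have hε := h.eps_pos
  have hc := h.lt_pi_div_two
  have h1 : 0 < φ (a + ε) := h.neck_pos ⟨by linarith, le_rfl⟩
  have hm1 : a + ε ∈ Ioc ε (2 * a + ε) := ⟨by linarith, by linarith⟩
  have hm2 : 2 * a + ε ∈ Ioc ε (2 * a + ε) := ⟨by linarith, le_rfl⟩
  have h2 : 0 < φ (2 * a + ε) := by
    have hd : HasDerivAt φ 0 (2 * a + ε) := by
      rw [← h.deriv_eq_zero (left_mem_Ico.2 hc)]
      exact ((h.contDiffOn_Ioo.contDiffAt (isOpen_Ioo.mem_nhds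
        ⟨by linarith, hc⟩)).differentiableAt (by simp)).hasDerivAt
    have h3 := h.strictConcave.concaveOn.le_slope_of_hasDerivAt hm1 hm2 (by linarith) hd
    rw [slope_def_field] at h3
    have h4 : 0 < 2 * a + ε - (a + ε) := by linarith
    have := (le_div_iff₀ h4).1 h3
    linarith
  rcases le_total r (a + ε) with h3 | h3
  · exact h.neck_pos ⟨hr.1, h3⟩
  rcases le_total r (2 * a + ε) with h4 | h4
  · have := h.strictConcave.concaveOn.min_le_of_mem_Icc hm1 hm2 ⟨h3, h4⟩
    exact (lt_min h1 h2).trans_le this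
  · obtain ⟨b, -, hb⟩ := h.eq_const
    rw [hb r ⟨h4, hr.2⟩, ← hb (2 * a + ε) ⟨le_rfl, hc.le⟩]
    exact h2

theorem neck_le_self (h : IsSmallGluingProfile n k a ε φ) (hr : r ∈ Icc ε (a + ε)) : φ r ≤ r := by
  rw [h.eq_neck r hr, neckProfile_eq]
  exact smul_catenoidProfile_le_self h.one_le h.eps_pos hr.1

end IsSmallGluingProfile

/-- The parametrized piece becomes an equation in the polar angle and the norm, from which defining
functions and openness arguments can be read off. -/
theorem mem_gluingPiece_iff {n k : ℕ} {ε : ℝ} {ψ : ℝ → ℝ} (hε : 0 < ε)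
    (hψ : ∀ r ∈ Icc ε (π / 2), 0 < 1 + ψ r) {x : SplitSpace n k} :
    x ∈ gluingPiece n k ε ψ ↔
      x ≠ 0 ∧ polarAngle x ∈ Icc ε (π / 2) ∧ ‖x‖ = 1 + ψ (polarAngle x) := by
  constructor
  · rintro ⟨⟨y, z, r⟩, ⟨hy, hz, hr⟩, rfl⟩
    rw [mem_sphere_zero_iff_norm] at hy hz
    obtain ⟨h1, h2⟩ := polarAngle_toLp hy hz (hψ r hr) (hε.le.trans hr.1) hr.2
    have h3 : gluingMap n k ψ (y, z, r) ≠ 0 := by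
      rw [← norm_ne_zero_iff]
      exact (h2.trans_ne (hψ r hr).ne')
    refine ⟨h3, ?_, ?_⟩
    · change polarAngle ((1 + ψ r) • WithLp.toLp 2 (sin r • y, cos r • z)) ∈ _
      rw [h1]; exact hr
    · change ‖(1 + ψ r) • WithLp.toLp 2 (sin r • y, cos r • z)‖ =
        1 + ψ (polarAngle ((1 + ψ r) • WithLp.toLp 2 (sin r • y, cos r • z)))
      rw [h1, h2]
  · rintro ⟨hx0, hr, hn⟩
    have hf : x.fst ≠ 0 := fst_ne_zero_of_polarAngle_pos (hε.trans_le hr.1)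
    have hf' : ‖x.fst‖ ≠ 0 := norm_ne_zero_iff.2 hf
    have hρ : ‖x‖ ≠ 0 := norm_ne_zero_iff.2 hx0
    obtain ⟨z, hz, hxz⟩ : ∃ z : EuclideanSpace ℝ (Fin (k + 1)), ‖z‖ = 1 ∧ ‖x.snd‖ • z = x.snd := by
      by_cases hs : x.snd = 0
      -- On the equator `cos r = 0`, and any unit vector `z` serves.
      · exact ⟨EuclideanSpace.single 0 1, by simp, by simp [hs]⟩
      · have hs' : ‖x.snd‖ ≠ 0 := norm_ne_zero_iff.2 hs
        refine ⟨‖x.snd‖⁻¹ • x.snd, ?_, ?_⟩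
        · rw [norm_smul, norm_inv, norm_norm, inv_mul_cancel₀ hs']
        · rw [smul_smul, mul_inv_cancel₀ hs', one_smul]
    refine ⟨(‖x.fst‖⁻¹ • x.fst, z, polarAngle x), ⟨?_, ?_, hr⟩, ?_⟩
    · rw [mem_sphere_zero_iff_norm]
      simp only
      rw [norm_smul, norm_inv, norm_norm, inv_mul_cancel₀ hf']
    · rw [mem_sphere_zero_iff_norm]; exact hz
    · unfold gluingMap
      simp only
      rw [← hn, sin_polarAngle, cos_polarAngle hx0]
      apply (WithLp.equiv 2 _).injective
      refine Prod.ext ?_ ?_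
      · change ‖x‖ • (‖x.fst‖ / ‖x‖) • ‖x.fst‖⁻¹ • x.fst = x.fst
        rw [smul_smul, smul_smul]
        convert one_smul ℝ x.fst using 2
        field_simp
      · change ‖x‖ • (‖x.snd‖ / ‖x‖) • z = x.snd
        rw [smul_smul, mul_div_cancel₀ _ hρ, hxz]

namespace IsSmallGluingProfile

variable {n k : ℕ} {a ε r : ℝ} {φ : ℝ → ℝ} {x : SplitSpace n k}

theorem mem_glued_iff (h : IsSmallGluingProfile n k a ε φ) :
    x ∈ gluedHypersurface n k ε φ ↔ x ≠ 0 ∧ polarAngle x ∈ Icc ε (π / 2) ∧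
      (‖x‖ = 1 + φ (polarAngle x) ∨ ‖x‖ = 1 - φ (polarAngle x)) := by
  unfold gluedHypersurface
  rw [mem_union, mem_gluingPiece_iff h.eps_pos fun r hr ↦ h.one_add_pos hr,
    mem_gluingPiece_iff h.eps_pos (ψ := -φ) fun r hr ↦ by
      simpa [sub_eq_add_neg] using h.one_sub_pos hr]
  simp only [Pi.neg_apply, ← sub_eq_add_neg]
  tauto

theorem isCompact_glued (h : IsSmallGluingProfile n k a ε φ) :
    IsCompact (gluedHypersurface n k ε φ) := by
  have key : ∀ ψ : ℝ → ℝ, ContinuousOn ψ (Icc ε (π / 2)) → IsCompact (gluingPiece n k ε ψ) := by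
    intro ψ hψ
    refine ((isCompact_sphere _ _).prod ((isCompact_sphere _ _).prod isCompact_Icc)).image_of_continuousOn
      ?_
    have h1 : ContinuousOn (fun x : EuclideanSpace ℝ (Fin (n - k)) ×
        EuclideanSpace ℝ (Fin (k + 1)) × ℝ ↦ ψ x.2.2)
        (Metric.sphere 0 1 ×ˢ (Metric.sphere 0 1 ×ˢ Icc ε (π / 2))) :=
      hψ.comp (by fun_prop) fun x hx ↦ hx.2.2
    refine (continuousOn_const.add h1).smul (Continuous.continuousOn ?_)
    refine (WithLp.prod_continuous_toLp 2 _ _).comp ?_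
    fun_prop
  exact (key φ h.continuousOn).union (key (-φ) h.continuousOn.neg)

theorem isOpen_region (J : Set ℝ) (hJ : IsOpen J) (J' : Set ℝ) (hJ' : IsOpen J') :
    IsOpen {x : SplitSpace n k | x ≠ 0 ∧ polarAngle x ∈ J ∧ ‖x‖ ∈ J'} := by
  have h1 : IsOpen ({x : SplitSpace n k | x ≠ 0} ∩ polarAngle ⁻¹' J) :=
    ContinuousOn.isOpen_inter_preimage (fun x hx ↦ (continuousAt_polarAngle hx).continuousWithinAt)
      isOpen_ne hJ
  convert h1.inter (hJ'.preimage continuous_norm) using 1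
  ext x
  simp only [mem_inter_iff, mem_preimage, mem_ofPred_eq, and_assoc]

/-- Since the profile is positive beyond the neck circle, the open condition `‖x‖ > 1` isolates the
outer sheet. -/
theorem isPolarGraph_outer (h : IsSmallGluingProfile n k a ε φ) :
    IsPolarGraph (gluedHypersurface n k ε φ)
      {x | x ≠ 0 ∧ polarAngle x ∈ Ioo ε (π / 2) ∧ ‖x‖ ∈ Ioi 1} φ (Ioo ε (π / 2)) where
  isOpen_I := isOpen_Ioo
  contDiffOn := h.contDiffOn_Ioo
  pos r hr := h.one_add_pos ⟨hr.1.le, hr.2.le⟩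
  isOpen := isOpen_region _ isOpen_Ioo _ isOpen_Ioi
  mem x hx := ⟨fst_ne_zero_of_polarAngle_pos (h.eps_pos.trans hx.2.1.1),
    snd_ne_zero_of_polarAngle_lt hx.1 hx.2.1.2, hx.2.1⟩
  inter_eq := by
    ext x
    simp only [mem_inter_iff, h.mem_glued_iff, mem_ofPred_eq, sub_eq_zero]
    constructor
    · rintro ⟨⟨-, -, h3⟩, h4⟩
      refine ⟨h4, h3.resolve_right fun h5 ↦ ?_⟩
      have h6 := h.pos ⟨h4.2.1.1, h4.2.1.2.le⟩
      have h7 : 1 < ‖x‖ := h4.2.2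
      linarith
    · rintro ⟨h4, h5⟩
      exact ⟨⟨h4.1, ⟨h4.2.1.1.le, h4.2.1.2.le⟩, Or.inl h5⟩, h4⟩

theorem isPolarGraph_inner (h : IsSmallGluingProfile n k a ε φ) :
    IsPolarGraph (gluedHypersurface n k ε φ)
      {x | x ≠ 0 ∧ polarAngle x ∈ Ioo ε (π / 2) ∧ ‖x‖ ∈ Iio 1} (-φ) (Ioo ε (π / 2)) where
  isOpen_I := isOpen_Ioo
  contDiffOn := h.contDiffOn_Ioo.neg
  pos r hr := by simpa [sub_eq_add_neg] using h.one_sub_pos ⟨hr.1.le, hr.2.le⟩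
  isOpen := isOpen_region _ isOpen_Ioo _ isOpen_Iio
  mem x hx := ⟨fst_ne_zero_of_polarAngle_pos (h.eps_pos.trans hx.2.1.1),
    snd_ne_zero_of_polarAngle_lt hx.1 hx.2.1.2, hx.2.1⟩
  inter_eq := by
    ext x
    simp only [mem_inter_iff, h.mem_glued_iff, mem_ofPred_eq, sub_eq_zero, Pi.neg_apply,
      ← sub_eq_add_neg]
    constructor
    · rintro ⟨⟨-, -, h3⟩, h4⟩
      refine ⟨h4, h3.resolve_left fun h5 ↦ ?_⟩
      have h6 := h.pos ⟨h4.2.1.1, h4.2.1.2.le⟩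
      have h7 : ‖x‖ < 1 := h4.2.2
      linarith
    · rintro ⟨h4, h5⟩
      exact ⟨⟨h4.1, ⟨h4.2.1.1.le, h4.2.1.2.le⟩, Or.inr h5⟩, h4⟩

/-- Away from the neck circle and from the equator, the hypersurface is locally a polar graph. -/
theorem exists_isPolarGraph (h : IsSmallGluingProfile n k a ε φ)
    (hx : x ∈ gluedHypersurface n k ε φ) (hr : polarAngle x ∈ Ioo ε (π / 2)) :
    ∃ U ψ, x ∈ U ∧ (ψ = φ ∨ ψ = -φ) ∧
      IsPolarGraph (gluedHypersurface n k ε φ) U ψ (Ioo ε (π / 2)) := by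
  obtain ⟨h1, h2, h3⟩ := h.mem_glued_iff.1 hx
  have h4 := h.pos ⟨hr.1, hr.2.le⟩
  rcases h3 with h3 | h3
  · exact ⟨{x | x ≠ 0 ∧ polarAngle x ∈ Ioo ε (π / 2) ∧ ‖x‖ ∈ Ioi 1}, φ,
      ⟨h1, hr, show 1 < ‖x‖ by linarith⟩, Or.inl rfl, h.isPolarGraph_outer⟩
  · exact ⟨{x | x ≠ 0 ∧ polarAngle x ∈ Ioo ε (π / 2) ∧ ‖x‖ ∈ Iio 1}, -φ,
      ⟨h1, hr, show ‖x‖ < 1 by linarith⟩, Or.inr rfl, h.isPolarGraph_inner⟩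

/-- Near the equator, the hypersurface is locally a round sphere. -/
theorem exists_sphere (h : IsSmallGluingProfile n k a ε φ)
    (hx : x ∈ gluedHypersurface n k ε φ) (hr : 2 * a + ε < polarAngle x) :
    ∃ U : Set (SplitSpace n k), x ∈ U ∧ IsOpen U ∧ 0 ∉ U ∧
      gluedHypersurface n k ε φ ∩ U = {y ∈ U | ‖y‖ - ‖x‖ = 0} := by
  obtain ⟨h1, h2, h3⟩ := h.mem_glued_iff.1 hx
  obtain ⟨b, -, hb⟩ := h.eq_const
  have hxb := hb (polarAngle x) ⟨hr.le, h2.2⟩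
  have hbpos : 0 < b := by
    rw [← hxb]; exact h.pos ⟨by linarith [h.a_pos], h2.2⟩
  rw [hxb] at h3
  have hε : ε < 2 * a + ε := by linarith [h.a_pos]
  rcases h3 with h3 | h3
  · refine ⟨{x | x ≠ 0 ∧ polarAngle x ∈ Ioi (2 * a + ε) ∧ ‖x‖ ∈ Ioi 1},
      ⟨h1, hr, show 1 < ‖x‖ by linarith⟩,
      isOpen_region (Ioi (2 * a + ε)) isOpen_Ioi (Ioi 1) isOpen_Ioi, fun h0 ↦ h0.1 rfl, ?_⟩
    ext y
    simp only [mem_inter_iff, h.mem_glued_iff, mem_ofPred_eq, sub_eq_zero]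
    constructor
    · rintro ⟨⟨-, h5, h6⟩, h7⟩
      have h8 : 1 < ‖y‖ := h7.2.2
      rw [hb (polarAngle y) ⟨le_of_lt h7.2.1, h5.2⟩] at h6
      refine ⟨h7, ?_⟩
      rcases h6 with h6 | h6 <;> linarith
    · rintro ⟨h7, h8⟩
      refine ⟨⟨h7.1, ⟨hε.le.trans (le_of_lt h7.2.1), polarAngle_le y⟩, Or.inl ?_⟩, h7⟩
      rw [hb (polarAngle y) ⟨le_of_lt h7.2.1, polarAngle_le y⟩, h8, h3]
  · refine ⟨{x | x ≠ 0 ∧ polarAngle x ∈ Ioi (2 * a + ε) ∧ ‖x‖ ∈ Iio 1},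
      ⟨h1, hr, show ‖x‖ < 1 by linarith⟩,
      isOpen_region (Ioi (2 * a + ε)) isOpen_Ioi (Iio 1) isOpen_Iio, fun h0 ↦ h0.1 rfl, ?_⟩
    ext y
    simp only [mem_inter_iff, h.mem_glued_iff, mem_ofPred_eq, sub_eq_zero]
    constructor
    · rintro ⟨⟨-, h5, h6⟩, h7⟩
      have h8 : ‖y‖ < 1 := h7.2.2
      rw [hb (polarAngle y) ⟨le_of_lt h7.2.1, h5.2⟩] at h6
      refine ⟨h7, ?_⟩
      rcases h6 with h6 | h6 <;> linarith
    · rintro ⟨h7, h8⟩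
      refine ⟨⟨h7.1, ⟨hε.le.trans (le_of_lt h7.2.1), polarAngle_le y⟩, Or.inr ?_⟩, h7⟩
      rw [hb (polarAngle y) ⟨le_of_lt h7.2.1, polarAngle_le y⟩, h8, h3]

end IsSmallGluingProfile

end GluingProfile

/-! ### Curvature of round spheres -/

section Sphere

variable {V : Type*} [NormedAddCommGroup V] [InnerProductSpace ℝ V] {M U : Set V} {ρ : ℝ}

theorem hasDerivAt_line {V : Type*} [NormedAddCommGroup V] [NormedSpace ℝ V] (x u : V) :
    HasDerivAt (fun t : ℝ ↦ x + t • u) u 0 := by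
  simpa using ((hasDerivAt_id (0 : ℝ)).smul_const u).const_add x

theorem fderiv_apply_eq_of_hasDerivAt_line {V W : Type*} [NormedAddCommGroup V] [NormedSpace ℝ V]
    [NormedAddCommGroup W] [NormedSpace ℝ W] {f : V → W} {x u : V} {f' : W}
    (hf : DifferentiableAt ℝ f x) (h : HasDerivAt (fun t : ℝ ↦ f (x + t • u)) f' 0) :
    fderiv ℝ f x u = f' := by
  have hd : HasFDerivAt f (fderiv ℝ f x) (x + (0 : ℝ) • u) := by simpa using hf.hasFDerivAt
  exact (hd.comp_hasDerivAt (0 : ℝ) (hasDerivAt_line x u)).unique h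

theorem contDiffOn_norm_sub_const (h0 : (0 : V) ∉ U) : ContDiffOn ℝ ∞ (fun y : V ↦ ‖y‖ - ρ) U :=
  (contDiffOn_id.norm ℝ fun _ hx h ↦ h0 (h ▸ hx)).sub contDiffOn_const

theorem fderiv_norm_sub_const {x : V} (hx : x ≠ 0) (u : V) :
    fderiv ℝ (fun y : V ↦ ‖y‖ - ρ) x u = ⟪x, u⟫ / ‖x‖ :=
  fderiv_apply_eq_of_hasDerivAt_line
    (((contDiffAt_norm ℝ hx (n := 1)).differentiableAt (by simp)).sub_const ρ)
    ((hasDerivAt_norm_line hx u).sub_const ρ)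

theorem contDiffOn_normalize (h0 : (0 : V) ∉ U) : ContDiffOn ℝ ∞ (fun y : V ↦ ‖y‖⁻¹ • y) U := by
  have hne : ∀ x ∈ U, x ≠ 0 := fun x hx h ↦ h0 (h ▸ hx)
  exact ((contDiffOn_id.norm ℝ hne).inv fun x hx ↦ norm_ne_zero_iff.2 (hne x hx)).smul contDiffOn_id

/-- Polar graphs exclude the equator, where the second component vanishes. There the hypersurface is
a piece of a sphere and the radial field is the normal. -/
theorem isLocalNormal_sphere [CompleteSpace V] (hU : IsOpen U) (h0 : (0 : V) ∉ U)
    (hM : M ∩ U = {y ∈ U | ‖y‖ - ρ = 0}) : IsLocalNormal M U fun y ↦ ‖y‖⁻¹ • y := by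
  have hne : ∀ x ∈ U, x ≠ 0 := fun x hx h ↦ h0 (h ▸ hx)
  refine isLocalNormal_of_fderiv_eq (c := fun _ ↦ 1) hU (contDiffOn_norm_sub_const h0) hM
    (contDiffOn_normalize h0) ?_ ?_
  · intro x hx
    rw [norm_smul, norm_inv, norm_norm, inv_mul_cancel₀ (norm_ne_zero_iff.2 (hne x hx))]
  · intro x hx
    refine ⟨one_ne_zero, fun u ↦ ?_⟩
    rw [fderiv_norm_sub_const (hne x hx.2), real_inner_smul_left]
    ring

theorem fderiv_normalize_apply {x u : V} (hx : x ≠ 0) (hu : ⟪x, u⟫ = 0) :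
    fderiv ℝ (fun y : V ↦ ‖y‖⁻¹ • y) x u = ‖x‖⁻¹ • u := by
  have hx' : ‖x‖ ≠ 0 := norm_ne_zero_iff.2 hx
  have hd : DifferentiableAt ℝ (fun y : V ↦ ‖y‖⁻¹ • y) x :=
    (((contDiffAt_norm ℝ hx (n := 1)).differentiableAt (by simp)).inv hx').smul
      differentiableAt_id
  refine fderiv_apply_eq_of_hasDerivAt_line hd ?_
  have h1 := hasDerivAt_norm_line hx u
  rw [hu, zero_div] at h1
  refine ((h1.inv (by simpa using hx')).smul (hasDerivAt_line x u)).congr_deriv ?_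
  simp

theorem inner_eq_zero_of_mem_tangentSpaceAt_sphere [CompleteSpace V] (hU : IsOpen U)
    (h0 : (0 : V) ∉ U) (hM : M ∩ U = {y ∈ U | ‖y‖ - ρ = 0}) {x u : V} (hx : x ∈ M ∩ U)
    (hu : u ∈ tangentSpaceAt M x) : ⟪x, u⟫ = 0 := by
  have hne : x ≠ 0 := fun h ↦ h0 (h ▸ hx.2)
  have := ((isLocalNormal_sphere hU h0 hM).mem_tangentSpaceAt_iff hx).1 hu
  rw [real_inner_smul_left, mul_eq_zero] at this
  exact this.resolve_left (inv_ne_zero (norm_ne_zero_iff.2 hne))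

theorem abs_secondFundamentalForm_sphere_le [CompleteSpace V] (hU : IsOpen U) (h0 : (0 : V) ∉ U)
    (hM : M ∩ U = {y ∈ U | ‖y‖ - ρ = 0}) {x u v : V} (hx : x ∈ M ∩ U)
    (hu : u ∈ tangentSpaceAt M x) :
    |secondFundamentalForm (outerNormal M x) x u v| ≤ ‖x‖⁻¹ * (‖u‖ * ‖v‖) := by
  have hne : x ≠ 0 := fun h ↦ h0 (h ▸ hx.2)
  rw [(isLocalNormal_sphere hU h0 hM).abs_secondFundamentalForm hx hu, fderiv_normalize_apply hne
    (inner_eq_zero_of_mem_tangentSpaceAt_sphere hU h0 hM hx hu), real_inner_smul_left, abs_mul,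
    abs_of_nonneg (by positivity)]
  gcongr
  exact abs_real_inner_le_norm u v

theorem meanCurvature_sphere [FiniteDimensional ℝ V] (hU : IsOpen U) (h0 : (0 : V) ∉ U)
    (hM : M ∩ U = {y ∈ U | ‖y‖ - ρ = 0}) {x : V} (hx : x ∈ M ∩ U) {n : ℕ} (hn0 : n ≠ 0)
    (hn : Module.finrank ℝ V = n + 1) : meanCurvature M x = ‖x‖⁻¹ := by
  have hne : x ≠ 0 := fun h ↦ h0 (h ▸ hx.2)
  have hN := isLocalNormal_sphere hU h0 hM
  obtain ⟨σ, -, h2, h3⟩ := hN.exists_sign_meanCurvature hx hn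
  have hpos : 0 < ⟪‖x‖⁻¹ • x, x⟫ := by
    rw [real_inner_smul_left, real_inner_self_eq_norm_sq]
    have := norm_pos_iff.2 hne
    positivity
  rw [h3, h2 hpos, one_mul]
  have h4 : ∀ i, ⟪fderiv ℝ (fun y : V ↦ ‖y‖⁻¹ • y) x (stdOrthonormalBasis ℝ (tangentSpaceAt M x) i),
      (stdOrthonormalBasis ℝ (tangentSpaceAt M x) i : V)⟫ = ‖x‖⁻¹ := by
    intro i
    rw [fderiv_normalize_apply hne (inner_eq_zero_of_mem_tangentSpaceAt_sphere hU h0 hM hx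
      (Submodule.coe_mem _)), real_inner_smul_left, real_inner_self_eq_norm_sq,
      ← Submodule.coe_norm, (stdOrthonormalBasis ℝ (tangentSpaceAt M x)).norm_eq_one]
    simp
  rw [Finset.sum_congr rfl fun i _ ↦ h4 i]
  simp only [Finset.sum_const, Finset.card_univ, Fintype.card_fin, nsmul_eq_mul]
  rw [hN.finrank_tangentSpaceAt hx hn]
  field_simp

end Sphere

/-! ### Smoothness across the neck circle -/

namespace IsSmallGluingProfile

variable {n k : ℕ} {a ε r : ℝ} {φ : ℝ → ℝ} {x : SplitSpace n k}

/-- The radius is even and the height odd in `w`, so the sign of `w` selects the sheet and both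
sheets become a single curve. -/
theorem mem_glued_neck_iff (h : IsSmallGluingProfile n k a ε φ) (hx0 : x ≠ 0)
    (hr : polarAngle x < a + ε) :
    x ∈ gluedHypersurface n k ε φ ↔ ∃ w, ‖x‖ = 1 + ε * catenoidHeight (n - k - 1) w ∧
      polarAngle x = ε * catenoidRadius (n - k - 1) w := by
  have hε := h.eps_pos
  rw [h.mem_glued_iff]
  constructor
  · rintro ⟨-, h2, h3⟩
    have h4 := h.eq_neck (polarAngle x) ⟨h2.1, hr.le⟩
    rw [neckProfile_eq] at h4
    obtain ⟨w, hw, hw'⟩ := exists_catenoidRadius_eq h.one_le ((one_le_div hε).2 h2.1)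
    rw [← hw', catenoidProfile_catenoidRadius h.one_le hw] at h4
    have h5 : polarAngle x = ε * catenoidRadius (n - k - 1) w := by rw [hw']; field_simp
    rcases h3 with h3 | h3
    · exact ⟨w, by rw [h3, h4], h5⟩
    · refine ⟨-w, ?_, by rw [catenoidRadius_neg, h5]⟩
      rw [catenoidHeight_neg, h3, h4]
      ring
  · rintro ⟨w, h1, h2⟩
    have h3 : polarAngle x / ε = catenoidRadius (n - k - 1) |w| := by
      rw [h2, mul_div_cancel_left₀ _ hε.ne']
      rcases abs_choice w with hw | hw <;> rw [hw]
      rw [catenoidRadius_neg]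
    have h4 : ε ≤ polarAngle x := by
      rw [h2]; nlinarith [one_le_catenoidRadius (n - k - 1) w]
    have h5 := h.eq_neck (polarAngle x) ⟨h4, hr.le⟩
    rw [neckProfile_eq, h3, catenoidProfile_catenoidRadius h.one_le (abs_nonneg w)] at h5
    refine ⟨hx0, ⟨h4, polarAngle_le x⟩, ?_⟩
    rcases abs_choice w with hw | hw <;> rw [hw] at h5
    · left; rw [h5, h1]
    · right; rw [h5, catenoidHeight_neg, h1]; ring

/-- Near the neck circle the height is a local coordinate of the catenoid. Inverting it exhibits the
hypersurface as a graph of the polar angle over the norm, which stays regular where the profile has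
infinite slope. -/
theorem exists_neck_chart (h : IsSmallGluingProfile n k a ε φ)
    (hx : x ∈ gluedHypersurface n k ε φ) (hr : polarAngle x = ε) :
    ∃ (U : Set (SplitSpace n k)) (F : SplitSpace n k → ℝ), IsOpen U ∧ x ∈ U ∧ ContDiffOn ℝ ∞ F U ∧
      (∀ y ∈ gluedHypersurface n k ε φ ∩ U, fderiv ℝ F y ≠ 0) ∧
      gluedHypersurface n k ε φ ∩ U = {y ∈ U | F y = 0} := by
  have hε := h.eps_pos
  obtain ⟨h1, h2, h3⟩ := h.mem_glued_iff.1 hx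
  rw [hr, h.apply_eps, add_zero, sub_zero, or_self] at h3
  obtain ⟨δ, hδ, L, hL, hSL⟩ := exists_local_inverse_catenoidHeight h.one_le
  set q := n - k - 1
  have hpi := Real.pi_pos
  have hJ' : IsOpen ((fun s : ℝ ↦ (s - 1) / ε) ⁻¹' Ioo (-δ) δ) := isOpen_Ioo.preimage (by fun_prop)
  let U : Set (SplitSpace n k) :=
    {y | y ≠ 0 ∧ polarAngle y ∈ Ioo 0 (a + ε) ∧ ‖y‖ ∈ (fun s : ℝ ↦ (s - 1) / ε) ⁻¹' Ioo (-δ) δ}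
  have hUne : ∀ y ∈ U, y.fst ≠ 0 ∧ y.snd ≠ 0 := fun y hy ↦
    ⟨fst_ne_zero_of_polarAngle_pos hy.2.1.1, snd_ne_zero_of_polarAngle_lt hy.1
      (hy.2.1.2.trans (by linarith [h.lt_pi_div_two, h.a_pos]))⟩
  have hUo : IsOpen U := isOpen_region _ isOpen_Ioo _ hJ'
  let G : ℝ → ℝ := fun s ↦ ε * catenoidRadius q (L ((s - 1) / ε))
  have hG : ContDiffOn ℝ ∞ G ((fun s : ℝ ↦ (s - 1) / ε) ⁻¹' Ioo (-δ) δ) := by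
    refine contDiffOn_const.mul ((contDiff_cosh_rpow _).comp_contDiffOn
      (hL.comp (ContDiff.contDiffOn (by fun_prop)) fun s hs ↦ hs))
  let F : SplitSpace n k → ℝ := fun y ↦ polarAngle y - G ‖y‖
  have hF : ContDiffOn ℝ ∞ F U := by
    refine (contDiffOn_polarAngle.mono hUne).sub (hG.comp ?_ fun y hy ↦ hy.2.2)
    exact contDiffOn_id.norm ℝ fun y hy ↦ hy.1
  refine ⟨U, F, hUo, ⟨h1, ?_, ?_⟩, hF, ?_, ?_⟩
  · rw [hr]; exact ⟨hε, by linarith [h.a_pos]⟩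
  · rw [h3]; simpa using hδ
  · rintro y ⟨-, hy⟩ h0
    obtain ⟨hf, hs⟩ := hUne y hy
    have hf' : ‖y.fst‖ ≠ 0 := norm_ne_zero_iff.2 hf
    have hs' : ‖y.snd‖ ≠ 0 := norm_ne_zero_iff.2 hs
    -- The unit rate rotation of the polar angle: it is orthogonal to `y`, so the norm is
    -- stationary, and `dF(u) = 1`.
    let u : SplitSpace n k := WithLp.toLp 2
      ((‖y.snd‖ / ‖y.fst‖) • y.fst, (-(‖y.fst‖ / ‖y.snd‖)) • y.snd)
    have hu : ⟪y, u⟫ = 0 := by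
      rw [WithLp.prod_inner_apply]
      simp only [u, real_inner_smul_right, WithLp.ofLp_fst, WithLp.ofLp_snd,
        real_inner_self_eq_norm_sq]
      field_simp
      ring
    have hN := hasDerivAt_norm_line hy.1 u
    rw [hu, zero_div] at hN
    have hGd : HasDerivAt G (deriv G ‖y‖) ‖y + (0 : ℝ) • u‖ := by
      simpa using ((hG.contDiffAt (hJ'.mem_nhds hy.2.2)).differentiableAt (by simp)).hasDerivAt
    have h5 := (hasDerivAt_polarAngle_line hf hs u).sub (hGd.comp (0 : ℝ) hN)
    have h6 := fderiv_apply_eq_of_hasDerivAt_line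
      ((hF.contDiffAt (hUo.mem_nhds hy)).differentiableAt (by simp)) h5
    rw [h0] at h6
    simp only [u, WithLp.toLp_fst, WithLp.toLp_snd, real_inner_smul_right,
      real_inner_self_eq_norm_sq] at h6
    have h7 : (‖y.snd‖ / ‖y.fst‖ * ‖y.fst‖ ^ 2 / ‖y.fst‖ * ‖y.snd‖ -
        ‖y.fst‖ * (-(‖y.fst‖ / ‖y.snd‖) * ‖y.snd‖ ^ 2 / ‖y.snd‖)) / ‖y‖ ^ 2 = 1 := by
      rw [WithLp.prod_norm_sq_eq_of_L2 y]
      have : ‖y.fst‖ ^ 2 + ‖y.snd‖ ^ 2 ≠ 0 := by positivity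
      field_simp
      ring
    rw [h7] at h6
    simp at h6
  · ext y
    constructor
    · rintro ⟨hyM, hyU⟩
      refine ⟨hyU, ?_⟩
      obtain ⟨w, hw1, hw2⟩ := (h.mem_glued_neck_iff hyU.1 hyU.2.1.2).1 hyM
      have h5 : (‖y‖ - 1) / ε = catenoidHeight q w := by rw [hw1]; field_simp; ring
      have h6 : L ((‖y‖ - 1) / ε) = w := by
        -- The height is globally injective, so no branch of the curve escapes its local inverse.
        apply (catenoidHeight_strictMono h.one_le).injective
        exact (hSL _ hyU.2.2).trans h5
      simp only [F, G]
      rw [h6, hw2, sub_self]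
    · rintro ⟨hyU, hyF⟩
      refine ⟨(h.mem_glued_neck_iff hyU.1 hyU.2.1.2).2 ⟨L ((‖y‖ - 1) / ε), ?_, sub_eq_zero.1 hyF⟩, hyU⟩
      rw [hSL _ hyU.2.2]
      field_simp
      ring

theorem isSmoothHypersurface (h : IsSmallGluingProfile n k a ε φ) :
    IsSmoothHypersurface (gluedHypersurface n k ε φ) := by
  intro x hx
  obtain ⟨h1, h2, h3⟩ := h.mem_glued_iff.1 hx
  rcases h2.1.eq_or_lt with h4 | h4
  · exact h.exists_neck_chart hx h4.symm
  rcases h2.2.eq_or_lt with h5 | h5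
  · obtain ⟨U, hxU, hU, h0, hM⟩ := h.exists_sphere hx (by rw [h5]; exact h.lt_pi_div_two)
    refine ⟨U, fun y ↦ ‖y‖ - ‖x‖, hU, hxU, contDiffOn_norm_sub_const h0, ?_, hM⟩
    intro y hy hd
    have hy0 : y ≠ 0 := fun h ↦ h0 (h ▸ hy.2)
    have := fderiv_norm_sub_const (ρ := ‖x‖) hy0 y
    rw [hd, real_inner_self_eq_norm_sq] at this
    have hy' := norm_ne_zero_iff.2 hy0
    field_simp at this
    simp at this
    exact hy' this.symm
  · obtain ⟨U, ψ, hxU, -, hG⟩ := h.exists_isPolarGraph hx ⟨h4, h5⟩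
    refine ⟨U, _, hG.isOpen, hxU, hG.contDiffOn_defining, ?_, hG.inter_eq⟩
    intro y hy hd
    have h6 := hG.fderiv_defining hy (angleField (normalAngle ψ) y)
    obtain ⟨e1, e2, e3⟩ := hG.mem y hy.2
    have hy0 : y ≠ 0 := fun h0 ↦ e1 (by simp [h0])
    rw [hd, real_inner_self_eq_norm_sq, norm_angleField _ e1 e2] at h6
    have := div_pos (polarLength_pos (p := deriv ψ (polarAngle y)) (hG.pos _ e3)) (norm_pos_iff.2 hy0)
    rw [one_pow, mul_one] at h6
    exact this.ne h6

/-- Points of the neck circle are limits of points with a larger angle. -/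
theorem frequently_of_polarAngle_eq (h : IsSmallGluingProfile n k a ε φ)
    (hx : x ∈ gluedHypersurface n k ε φ) (hr : polarAngle x = ε) {P : SplitSpace n k → Prop}
    (hP : ∀ y ∈ gluedHypersurface n k ε φ, polarAngle y ∈ Ioo ε a → P y) :
    ∃ᶠ y in 𝓝[gluedHypersurface n k ε φ] x, P y := by
  have hε := h.eps_pos
  have hlt := h.lt_pi_div_two
  have ha := h.a_pos
  -- The profile vanishes on the neck circle, so the point belongs to the outer sheet and can be
  -- approached along a meridian of it.
  have hx' : x ∈ gluingPiece n k ε φ := by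
    obtain ⟨h1, h2, h3⟩ := h.mem_glued_iff.1 hx
    rw [mem_gluingPiece_iff hε fun r hr ↦ h.one_add_pos hr]
    refine ⟨h1, h2, ?_⟩
    rw [hr, h.apply_eps] at h3 ⊢
    simpa using h3
  obtain ⟨⟨y, z, r⟩, ⟨hy, hz, hr'⟩, rfl⟩ := hx'
  have hy1 := mem_sphere_zero_iff_norm.1 hy
  have hz1 := mem_sphere_zero_iff_norm.1 hz
  have hpol : ∀ t ∈ Icc ε (π / 2), polarAngle (gluingMap n k φ (y, z, t)) = t := fun t ht ↦
    (polarAngle_toLp hy1 hz1 (h.one_add_pos ht) (hε.le.trans ht.1) ht.2).1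
  rw [hpol r hr'] at hr
  subst hr
  have hmem : ∀ t ∈ Icc r (π / 2), gluingMap n k φ (y, z, t) ∈ gluedHypersurface n k r φ :=
    fun t ht ↦ Or.inl ⟨(y, z, t), ⟨hy, hz, ht⟩, rfl⟩
  have hcont : Tendsto (fun t ↦ gluingMap n k φ (y, z, t)) (𝓝[>] r)
      (𝓝 (gluingMap n k φ (y, z, r))) := by
    have h1 : ContinuousWithinAt (fun t ↦ gluingMap n k φ (y, z, t)) (Icc r (π / 2)) r := by
      refine (continuousWithinAt_const.add (h.continuousOn r hr')).smul
        (Continuous.continuousWithinAt ?_)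
      refine (WithLp.prod_continuous_toLp 2 _ _).comp ?_
      fun_prop
    refine h1.tendsto.mono_left (nhdsWithin_le_of_mem ?_)
    filter_upwards [Ioo_mem_nhdsGT (show r < π / 2 by linarith)] with t ht using ⟨ht.1.le, ht.2.le⟩
  have hev : ∀ᶠ t in 𝓝[>] r, t ∈ Ioo r a := Ioo_mem_nhdsGT h.eps_lt
  have hT : Tendsto (fun t ↦ gluingMap n k φ (y, z, t)) (𝓝[>] r)
      (𝓝[gluedHypersurface n k r φ] (gluingMap n k φ (y, z, r))) := by
    refine tendsto_nhdsWithin_iff.2 ⟨hcont, ?_⟩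
    filter_upwards [hev] with t ht
    exact hmem t ⟨ht.1.le, by linarith [ht.2]⟩
  refine hT.frequently (Eventually.frequently ?_)
  filter_upwards [hev] with t ht
  have ht' : t ∈ Icc r (π / 2) := ⟨ht.1.le, by linarith [ht.2]⟩
  exact hP _ (hmem t ht') (by rw [hpol t ht']; exact ht)

end IsSmallGluingProfile

/-! ### Curvature estimates for the catenoidal neck -/

section NeckCurvature

variable {r s p q : ℝ}

theorem abs_slope_div_polarLength_le_one (hs : 0 < 1 + s) : |p| / polarLength s p ≤ 1 := by
  rw [div_le_one (polarLength_pos hs)]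
  exact Real.abs_le_sqrt (by nlinarith [sq_nonneg (1 + s)])

theorem one_div_polarLength_le (hs : |s| < 1 / 2) : 1 / polarLength s p ≤ 2 := by
  have h1 := (abs_lt.1 hs).1
  have h2 : 1 / 2 ≤ polarLength s p := Real.le_sqrt_of_sq_le (by nlinarith [sq_nonneg p])
  rw [div_le_iff₀ (by linarith)]
  linarith

theorem one_add_sq_le_polarLength_sq (hs : |s| < 1 / 2) : 1 + p ^ 2 ≤ 4 * polarLength s p ^ 2 := by
  have h1 := (abs_lt.1 hs).1
  rw [polarLength, Real.sq_sqrt (by positivity)]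
  nlinarith [sq_nonneg p]

theorem cos_div_sin_le (hr : 0 < r) (hr' : r < π / 10) : 0 ≤ cos r / sin r ∧ cos r / sin r ≤ 1 / r := by
  have hpi := Real.pi_pos
  have hs : 0 < sin r := Real.sin_pos_of_pos_of_lt_pi hr (by linarith)
  have hc : 0 < cos r := Real.cos_pos_of_mem_Ioo ⟨by linarith, by linarith⟩
  refine ⟨by positivity, ?_⟩
  rw [div_le_div_iff₀ hs hr]
  have h1 := Real.lt_tan hr (by linarith)
  rw [Real.tan_eq_sin_div_cos, lt_div_iff₀ hc] at h1
  linarith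

/-- By `sin r ≤ r`, the numerator `sin r - r cos r` is at most `r (1 - cos r)`, and `1 - cos r ≤ sin
r` for small `r`. -/
theorem one_div_sub_cos_div_sin_le (hr : 0 < r) (hr' : r < π / 10) : 1 / r - cos r / sin r ≤ 1 := by
  have hpi := Real.pi_pos
  have hpi4 := Real.pi_lt_four
  have hs : 0 < sin r := Real.sin_pos_of_pos_of_lt_pi hr (by linarith)
  have h1 : sin r ≤ r := Real.sin_le hr.le
  have h2 := Real.one_sub_sq_div_two_le_cos (x := r)
  have h3 : 2 / π * r ≤ sin r := Real.mul_le_sin hr.le (by linarith)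
  have h4 : 1 / 2 ≤ 2 / π := by rw [div_le_div_iff₀ (by norm_num) hpi]; linarith
  have h5 : r / 2 ≤ sin r := by nlinarith
  rw [div_sub_div _ _ hr.ne' hs.ne', div_le_one (by positivity)]
  have h6 : 1 - cos r ≤ sin r := by nlinarith
  nlinarith

theorem sin_div_cos_nonneg_le (hr : 0 < r) (hr' : r < π / 10) :
    0 ≤ sin r / cos r ∧ sin r / cos r ≤ 1 := by
  have hpi := Real.pi_pos
  have hs : 0 < sin r := Real.sin_pos_of_pos_of_lt_pi hr (by linarith)
  have hc : 0 < cos r := Real.cos_pos_of_mem_Ioo ⟨by linarith, by linarith⟩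
  refine ⟨by positivity, ?_⟩
  rw [div_le_one hc, ← Real.cos_pi_div_two_sub]
  exact Real.cos_le_cos_of_nonneg_of_le_pi hr.le (by linarith) (by linarith)

theorem abs_div_one_add_le (hs : |s| < 1 / 2) (x : ℝ) : |x / (1 + s)| ≤ 2 * |x| := by
  have h1 := (abs_lt.1 hs).1
  rw [abs_div, abs_of_pos (show 0 < 1 + s by linarith), div_le_iff₀ (by linarith)]
  nlinarith [abs_nonneg x]

/-- The slope is unbounded near the neck circle, but `|p| / W ≤ 1`; the singular part is kept in the
form `|p| / (W r)`, common to all neck estimates. -/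
theorem abs_polarCurvFst_le (hr : 0 < r) (hr' : r < π / 10) (hs : |s| < 1 / 2) :
    |polarCurvFst r s p| ≤ 2 + 2 * (|p| / polarLength s p / r) := by
  have hs0 : 0 < 1 + s := by linarith [(abs_lt.1 hs).1]
  have hW := polarLength_pos (p := p) hs0
  obtain ⟨h1, h2⟩ := cos_div_sin_le hr hr'
  have h3 := one_div_polarLength_le (p := p) hs
  unfold polarCurvFst
  rw [abs_div, abs_of_pos hW, div_eq_mul_one_div]
  have h4 : |1 - p * (cos r / sin r) / (1 + s)| ≤ 1 + 2 * (|p| * (1 / r)) := by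
    refine (abs_sub _ _).trans ?_
    rw [abs_one]
    have := abs_div_one_add_le hs (p * (cos r / sin r))
    rw [abs_mul p, abs_of_nonneg h1] at this
    have h5 : |p| * (cos r / sin r) ≤ |p| * (1 / r) := by gcongr
    linarith
  calc |1 - p * (cos r / sin r) / (1 + s)| * (1 / polarLength s p)
      ≤ (1 + 2 * (|p| * (1 / r))) * (1 / polarLength s p) := by gcongr
    _ = 1 / polarLength s p + 2 * (|p| / polarLength s p / r) := by field_simp
    _ ≤ _ := by linarith

theorem abs_polarCurvSnd_le (hr : 0 < r) (hr' : r < π / 10) (hs : |s| < 1 / 2) :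
    |polarCurvSnd r s p| ≤ 4 := by
  have hs0 : 0 < 1 + s := by linarith [(abs_lt.1 hs).1]
  have hW := polarLength_pos (p := p) hs0
  obtain ⟨h1, h2⟩ := sin_div_cos_nonneg_le hr hr'
  have h3 := one_div_polarLength_le (p := p) hs
  have h6 := abs_slope_div_polarLength_le_one (p := p) hs0
  unfold polarCurvSnd
  rw [abs_div, abs_of_pos hW, div_eq_mul_one_div]
  have h4 : |1 + p * (sin r / cos r) / (1 + s)| ≤ 1 + 2 * |p| := by
    refine (abs_add_le _ _).trans ?_
    rw [abs_one]
    have := abs_div_one_add_le hs (p * (sin r / cos r))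
    rw [abs_mul p, abs_of_nonneg h1] at this
    have h5 : |p| * (sin r / cos r) ≤ |p| * 1 := by gcongr
    linarith
  calc |1 + p * (sin r / cos r) / (1 + s)| * (1 / polarLength s p)
      ≤ (1 + 2 * |p|) * (1 / polarLength s p) := by gcongr
    _ = 1 / polarLength s p + 2 * (|p| / polarLength s p) := by ring
    _ ≤ _ := by linarith

theorem abs_profile_main_le (hs : |s| < 1 / 2) :
    |((1 + s) ^ 2 + 2 * p ^ 2) / polarLength s p ^ 3| ≤ 4 := by
  have hs0 : 0 < 1 + s := by linarith [(abs_lt.1 hs).1]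
  have hW := polarLength_pos (p := p) hs0
  have h3 := one_div_polarLength_le (p := p) hs
  have hW2 : polarLength s p ^ 2 = (1 + s) ^ 2 + p ^ 2 := Real.sq_sqrt (by positivity)
  rw [abs_of_nonneg (by positivity)]
  calc ((1 + s) ^ 2 + 2 * p ^ 2) / polarLength s p ^ 3
      ≤ (2 * polarLength s p ^ 2) / polarLength s p ^ 3 := by
        gcongr; rw [hW2]; nlinarith [sq_nonneg (1 + s)]
    _ = 2 * (1 / polarLength s p) := by field_simp
    _ ≤ 4 := by linarith

/-- The cubic growth of the second derivative in `p` is absorbed by `W³`, since `1 + p² ≤ 4W²`. -/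
theorem abs_polarCurvProfile_le (hq : 0 ≤ q) (hr : 0 < r) (hs : |s| < 1 / 2) :
    |polarCurvProfile s p (-(q / r) * p * (1 + p ^ 2))| ≤
      4 + 6 * q * (|p| / polarLength s p / r) := by
  have hs0 : 0 < 1 + s := by linarith [(abs_lt.1 hs).1]
  have hs1 : 1 + s ≤ 3 / 2 := by linarith [(abs_lt.1 hs).2]
  have hW := polarLength_pos (p := p) hs0
  have h1 := abs_profile_main_le (p := p) hs
  have h2 := one_add_sq_le_polarLength_sq (p := p) hs
  unfold polarCurvProfile
  have h3 : ((1 + s) ^ 2 + 2 * p ^ 2 - (1 + s) * (-(q / r) * p * (1 + p ^ 2))) / polarLength s p ^ 3 =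
      ((1 + s) ^ 2 + 2 * p ^ 2) / polarLength s p ^ 3 +
        (1 + s) * (q / r) * p * (1 + p ^ 2) / polarLength s p ^ 3 := by ring
  rw [h3]
  refine (abs_add_le _ _).trans (add_le_add h1 ?_)
  rw [abs_div, abs_mul, abs_mul, abs_of_pos (show 0 < 1 + p ^ 2 by positivity),
    abs_of_nonneg (show 0 ≤ (1 + s) * (q / r) by positivity), abs_of_pos (show 0 <
      polarLength s p ^ 3 by positivity)]
  calc (1 + s) * (q / r) * |p| * (1 + p ^ 2) / polarLength s p ^ 3
      ≤ (3 / 2) * (q / r) * |p| * (4 * polarLength s p ^ 2) / polarLength s p ^ 3 := by gcongr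
    _ = 6 * q * (|p| / polarLength s p / r) := by field_simp; ring

/-- The singular parts of the principal curvatures of the neck cancel in the mean curvature. -/
theorem abs_neck_trace_le (hq : 0 ≤ q) (hr : 0 < r) (hr' : r < π / 10) (hs : |s| < 1 / 2)
    (hsr : |s| ≤ r) :
    |q * polarCurvFst r s p + polarCurvProfile s p (-(q / r) * p * (1 + p ^ 2))| ≤ 9 * q + 4 := by
  have hs0 : 0 < 1 + s := by linarith [(abs_lt.1 hs).1]
  have hW := polarLength_pos (p := p) hs0
  have hW2 : polarLength s p ^ 2 = (1 + s) ^ 2 + p ^ 2 := Real.sq_sqrt (by positivity)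
  have h1 := abs_profile_main_le (p := p) hs
  have h3 := one_div_polarLength_le (p := p) hs
  have h6 := abs_slope_div_polarLength_le_one (p := p) hs0
  have hc1 := one_div_sub_cos_div_sin_le hr hr'
  have hc2 := (cos_div_sin_le hr hr').2
  set W := polarLength s p
  set ct := cos r / sin r
  have key : q * polarCurvFst r s p + polarCurvProfile s p (-(q / r) * p * (1 + p ^ 2)) =
      q * (1 / W) + ((1 + s) ^ 2 + 2 * p ^ 2) / W ^ 3 +
        q * (p / W * ((p / W) ^ 2 * (s / r * (2 + s)) / (1 + s) + (1 / r - ct) / (1 + s))) := by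
    unfold polarCurvFst polarCurvProfile
    change q * ((1 - p * ct / (1 + s)) / W) +
      ((1 + s) ^ 2 + 2 * p ^ 2 - (1 + s) * (-(q / r) * p * (1 + p ^ 2))) / W ^ 3 = _
    -- The cancellation: the difference has a factor `s`, and `|s| ≤ r` compensates the remaining
    -- division by `r`. For the exact cone approximation `ρ = 1`, `cot r = 1/r` the singular part
    -- vanishes identically.
    have e1 : (1 + s) * (1 + p ^ 2) / W ^ 2 - 1 / (1 + s) =
        (p / W) ^ 2 * (s * (2 + s)) / (1 + s) := by
      field_simp
      rw [hW2]
      ring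
    have e2 : q * ((1 - p * ct / (1 + s)) / W) +
      ((1 + s) ^ 2 + 2 * p ^ 2 - (1 + s) * (-(q / r) * p * (1 + p ^ 2))) / W ^ 3 =
        q * (1 / W) + ((1 + s) ^ 2 + 2 * p ^ 2) / W ^ 3 +
        q * (p / W * (((1 + s) * (1 + p ^ 2) / W ^ 2 - 1 / (1 + s)) / r + (1 / r - ct) / (1 + s))) := by
      field_simp
      ring
    rw [e2, e1]
    congr 3
    ring
  rw [key]
  have g1 : |s / r * (2 + s)| ≤ 5 / 2 := by
    rw [abs_mul, abs_div, abs_of_pos hr]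
    have e1 : |s| / r ≤ 1 := (div_le_one hr).2 hsr
    have e2 : |2 + s| ≤ 5 / 2 := by
      rw [abs_le]; constructor <;> linarith [(abs_lt.1 hs).1, (abs_lt.1 hs).2]
    calc |s| / r * |2 + s| ≤ 1 * (5 / 2) := by gcongr
      _ = 5 / 2 := one_mul _
  have hpW : |p / W| ≤ 1 := by rw [abs_div, abs_of_pos hW]; exact h6
  have g2 : |(p / W) ^ 2 * (s / r * (2 + s)) / (1 + s)| ≤ 5 := by
    refine (abs_div_one_add_le hs _).trans ?_
    rw [abs_mul, abs_pow]
    have : |p / W| ^ 2 ≤ 1 := pow_le_one₀ (abs_nonneg _) hpW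
    calc 2 * (|p / W| ^ 2 * |s / r * (2 + s)|) ≤ 2 * (1 * (5 / 2)) := by gcongr
      _ = 5 := by norm_num
  have g3 : |(1 / r - ct) / (1 + s)| ≤ 2 := by
    refine (abs_div_one_add_le hs _).trans ?_
    have : |1 / r - ct| ≤ 1 := by rw [abs_le]; constructor <;> linarith
    linarith
  -- The bound `9q + 4` is `2q` from `q / W`, `4` from the regular profile part, and `7q` from this
  -- term.
  have g4 : |p / W * ((p / W) ^ 2 * (s / r * (2 + s)) / (1 + s) + (1 / r - ct) / (1 + s))| ≤ 7 := by
    rw [abs_mul]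
    calc |p / W| * |(p / W) ^ 2 * (s / r * (2 + s)) / (1 + s) + (1 / r - ct) / (1 + s)| ≤ 1 * 7 := by
          gcongr
          exact (abs_add_le _ _).trans (by linarith)
      _ = 7 := by norm_num
  refine (abs_add_three _ _ _).trans ?_
  rw [abs_mul q, abs_mul q, abs_of_nonneg hq, abs_of_nonneg (show 0 ≤ 1 / W by positivity)]
  have f1 : q * (1 / W) ≤ q * 2 := by gcongr
  have f2 := mul_le_mul_of_nonneg_left g4 hq
  linarith

/-- The catenoid slope satisfies `p² (r/ε)^(2q) = 1 + p²`, and the right side is at most `4W²`. -/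
theorem abs_neckSlope_div_polarLength_le {q : ℕ} (hq : 1 ≤ q) {ε : ℝ} (hε : 0 < ε) (hr : ε < r)
    (hs : |s| < 1 / 2) (hp : p ^ 2 = neckSlope q ε r ^ 2) :
    |p| / polarLength s p ≤ 2 * (ε / r) ^ q := by
  have hr0 : 0 < r := hε.trans hr
  have hs0 : 0 < 1 + s := by linarith [(abs_lt.1 hs).1]
  have hW := polarLength_pos (p := p) hs0
  have h2 := one_add_sq_le_polarLength_sq (p := p) hs
  have hT := one_lt_pow_of_one_lt hq ((one_lt_div hε).2 hr)
  rw [neckSlope_sq hq hε hr] at hp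
  have h3 : (|p| * (r / ε) ^ q) ^ 2 = 1 + p ^ 2 := by
    rw [mul_pow, sq_abs, ← pow_mul, mul_comm q 2, hp]
    field_simp
    ring
  have h4 : |p| * (r / ε) ^ q ≤ 2 * polarLength s p := by
    refine abs_le_of_sq_le_sq' ?_ (by positivity) |>.2
    rw [h3]
    linarith
  have h5 : (ε / r) ^ q * (r / ε) ^ q = 1 := by
    rw [← mul_pow]
    have : ε / r * (r / ε) = 1 := by field_simp
    rw [this, one_pow]
  rw [div_le_iff₀ hW]
  calc |p| = (|p| * (r / ε) ^ q) * (ε / r) ^ q := by rw [mul_assoc, mul_comm ((r / ε) ^ q), h5, mul_one]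
    _ ≤ (2 * polarLength s p) * (ε / r) ^ q := by gcongr
    _ = _ := by ring

end NeckCurvature

/-! ### Curvature bounds on the neck of the hypersurface -/

namespace IsSmallGluingProfile

variable {n k : ℕ} {a ε r : ℝ} {φ : ℝ → ℝ} {x : SplitSpace n k}

theorem finrank_splitSpace {n k : ℕ} (hk : k + 2 ≤ n) :
    Module.finrank ℝ (SplitSpace n k) = n + 1 := by
  rw [LinearEquiv.finrank_eq (WithLp.linearEquiv 2 ℝ _)]
  simp
  lia

/-- The catenoid equation is odd in the slope, so the inner sheet satisfies it too. -/
theorem deriv_deriv_of_eq_or_eq_neg (h : IsSmallGluingProfile n k a ε φ) {ψ : ℝ → ℝ}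
    (hψ : ψ = φ ∨ ψ = -φ) (hr : r ∈ Ioo ε (a + ε)) :
    deriv (deriv ψ) r = -((n - k - 1 : ℕ) / r) * deriv ψ r * (1 + deriv ψ r ^ 2) := by
  have h1 := h.deriv_deriv_eq hr
  rcases hψ with rfl | rfl
  · exact h1
  · have e : deriv (-φ) = -deriv φ := by ext t; exact deriv.neg
    have e2 : deriv (-deriv φ) r = -deriv (deriv φ) r := deriv.neg
    rw [e, e2, h1, Pi.neg_apply]
    ring

theorem deriv_sq_of_eq_or_eq_neg (h : IsSmallGluingProfile n k a ε φ) {ψ : ℝ → ℝ}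
    (hψ : ψ = φ ∨ ψ = -φ) (hr : r ∈ Ioo ε (a + ε)) :
    deriv ψ r ^ 2 = neckSlope (n - k - 1) ε r ^ 2 := by
  rw [← h.deriv_eq_neckSlope hr]
  rcases hψ with rfl | rfl
  · rfl
  · rw [show deriv (-φ) r = -deriv φ r from deriv.neg, neg_sq]

theorem abs_of_eq_or_eq_neg {ψ φ : ℝ → ℝ} (hψ : ψ = φ ∨ ψ = -φ) (r : ℝ) : |ψ r| = |φ r| := by
  rcases hψ with rfl | rfl <;> simp

theorem abs_neck_le (h : IsSmallGluingProfile n k a ε φ) (hr : r ∈ Ioc ε (a + ε)) : |φ r| ≤ r := by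
  rw [abs_of_pos (h.neck_pos hr)]
  exact h.neck_le_self ⟨hr.1.le, hr.2⟩

/-- The mean curvature is bounded on the neck. -/
theorem abs_meanCurvature_neck_le (h : IsSmallGluingProfile n k a ε φ)
    (hx : x ∈ gluedHypersurface n k ε φ) (hr : polarAngle x ≤ a) :
    |meanCurvature (gluedHypersurface n k ε φ) x| ≤ 9 * (n - k - 1 : ℕ) + 4 + k * 4 := by
  have hk := h.codim
  have hpi := Real.pi_pos
  have main : ∀ y ∈ gluedHypersurface n k ε φ, polarAngle y ∈ Ioc ε a →
      |meanCurvature (gluedHypersurface n k ε φ) y| ≤ 9 * (n - k - 1 : ℕ) + 4 + k * 4 := by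
    intro y hy hry
    have hε := h.eps_pos
    have ha := h.a_lt
    have hry' : polarAngle y ∈ Ioo ε (a + ε) := ⟨hry.1, by linarith [hry.2]⟩
    obtain ⟨U, ψ, hyU, hψ, hG⟩ := h.exists_isPolarGraph hy ⟨hry.1, by linarith [hry.2]⟩
    rw [hG.meanCurvature_eq ⟨hy, hyU⟩ (finrank_splitSpace hk), h.deriv_deriv_of_eq_or_eq_neg hψ hry']
    have hE : ((Module.finrank ℝ (EuclideanSpace ℝ (Fin (n - k))) : ℕ) : ℝ) - 1 = (n - k - 1 : ℕ) := by
      rw [finrank_euclideanSpace_fin]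
      rw [show n - k = (n - k - 1) + 1 by lia]
      simp
    have hF : ((Module.finrank ℝ (EuclideanSpace ℝ (Fin (k + 1))) : ℕ) : ℝ) - 1 = k := by
      rw [finrank_euclideanSpace_fin]
      simp
    rw [hE, hF]
    have hs : |ψ (polarAngle y)| < 1 / 2 := by
      rw [abs_of_eq_or_eq_neg hψ]
      exact h.abs_lt_half _ ⟨hry.1.le, by linarith [hry.2]⟩
    have hsr : |ψ (polarAngle y)| ≤ polarAngle y := by
      rw [abs_of_eq_or_eq_neg hψ]
      exact h.abs_neck_le ⟨hry.1, by linarith [hry.2]⟩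
    have hr0 : 0 < polarAngle y := hε.trans hry.1
    have hr1 : polarAngle y < π / 10 := by linarith [hry.2]
    have e1 := abs_neck_trace_le (p := deriv ψ (polarAngle y)) (q := (n - k - 1 : ℕ))
      (Nat.cast_nonneg _) hr0 hr1 hs hsr
    have e2 := abs_polarCurvSnd_le (p := deriv ψ (polarAngle y)) hr0 hr1 hs
    have hn : (1 : ℝ) ≤ n := by exact_mod_cast (by lia : 1 ≤ n)
    rw [abs_div, Nat.abs_cast]
    refine (div_le_self (abs_nonneg _) hn).trans ?_
    rw [add_right_comm]
    refine (abs_add_le _ _).trans (add_le_add e1 ?_)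
    rw [abs_mul, abs_of_nonneg (Nat.cast_nonneg k)]
    gcongr
  have h2 := (h.mem_glued_iff.1 hx).2.1
  rcases h2.1.eq_or_lt with h3 | h3
  · refine h.isSmoothHypersurface.abs_meanCurvature_le_of_frequently hx (finrank_splitSpace hk) ?_
    exact h.frequently_of_polarAngle_eq hx h3.symm fun y hy hry ↦ main y hy ⟨hry.1, hry.2.le⟩
  · exact main x hx ⟨h3, hr⟩

/-- The second fundamental form of the neck is bounded by that of the catenoid. -/
theorem abs_secondFundamentalForm_neck_le (h : IsSmallGluingProfile n k a ε φ)
    (hx : x ∈ gluedHypersurface n k ε φ) (hr : polarAngle x ≤ a) :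
    ∀ u ∈ tangentSpaceAt (gluedHypersurface n k ε φ) x,
      ∀ v ∈ tangentSpaceAt (gluedHypersurface n k ε φ) x,
      |secondFundamentalForm (outerNormal (gluedHypersurface n k ε φ) x) x u v| ≤
        (40 + (16 + 48 * (n - k - 1 : ℕ)) * |(ε / polarAngle x) ^ (n - k - 1) / polarAngle x|) *
          (‖u‖ * ‖v‖) := by
  have hk := h.codim
  have hε := h.eps_pos
  have hpi := Real.pi_pos
  have main : ∀ y ∈ gluedHypersurface n k ε φ, polarAngle y ∈ Ioc ε a →
      ∀ u ∈ tangentSpaceAt (gluedHypersurface n k ε φ) y,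
      ∀ v ∈ tangentSpaceAt (gluedHypersurface n k ε φ) y,
      |secondFundamentalForm (outerNormal (gluedHypersurface n k ε φ) y) y u v| ≤
        (40 + (16 + 48 * (n - k - 1 : ℕ)) * |(ε / polarAngle y) ^ (n - k - 1) / polarAngle y|) *
          (‖u‖ * ‖v‖) := by
    intro y hy hry u hu v _
    have ha := h.a_lt
    have hry' : polarAngle y ∈ Ioo ε (a + ε) := ⟨hry.1, by linarith [hry.2]⟩
    obtain ⟨U, ψ, hyU, hψ, hG⟩ := h.exists_isPolarGraph hy ⟨hry.1, by linarith [hry.2]⟩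
    refine (hG.abs_secondFundamentalForm_le ⟨hy, hyU⟩ hu).trans ?_
    rw [h.deriv_deriv_of_eq_or_eq_neg hψ hry']
    have hs : |ψ (polarAngle y)| < 1 / 2 := by
      rw [abs_of_eq_or_eq_neg hψ]
      exact h.abs_lt_half _ ⟨hry.1.le, by linarith [hry.2]⟩
    have hr0 : 0 < polarAngle y := hε.trans hry.1
    have hr1 : polarAngle y < π / 10 := by linarith [hry.2]
    have e1 := abs_polarCurvFst_le (p := deriv ψ (polarAngle y)) hr0 hr1 hs
    have e2 := abs_polarCurvSnd_le (p := deriv ψ (polarAngle y)) hr0 hr1 hs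
    have e3 := abs_polarCurvProfile_le (p := deriv ψ (polarAngle y)) (q := (n - k - 1 : ℕ))
      (Nat.cast_nonneg _) hr0 hs
    have e4 := abs_neckSlope_div_polarLength_le h.one_le hε hry.1 hs
      (h.deriv_sq_of_eq_or_eq_neg hψ hry')
    have e5 : |deriv ψ (polarAngle y)| / polarLength (ψ (polarAngle y)) (deriv ψ (polarAngle y)) /
        polarAngle y ≤ 2 * ((ε / polarAngle y) ^ (n - k - 1) / polarAngle y) := by
      rw [← mul_div_assoc]
      gcongr
    rw [abs_of_nonneg (show 0 ≤ (ε / polarAngle y) ^ (n - k - 1) / polarAngle y by positivity)]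
    refine mul_le_mul_of_nonneg_right ?_ (by positivity)
    set Y := |deriv ψ (polarAngle y)| / polarLength (ψ (polarAngle y)) (deriv ψ (polarAngle y)) /
        polarAngle y
    have e6 : (6 * ((n - k - 1 : ℕ) : ℝ)) * Y ≤ (6 * ((n - k - 1 : ℕ) : ℝ)) *
      (2 * ((ε / polarAngle y) ^ (n - k - 1) / polarAngle y)) := by gcongr
    -- With `Y` at most twice the catenoid term, `4((2 + 2Y) + 4 + (4 + 6qY))` gives the constants
    -- `40` and `16 + 48q`.
    linarith
  have h2 := (h.mem_glued_iff.1 hx).2.1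
  rcases h2.1.eq_or_lt with h3 | h3
  · have hx0 := (h.mem_glued_iff.1 hx).1
    have hr0 : polarAngle x ≠ 0 := by rw [← h3]; exact hε.ne'
    have hc := continuousAt_polarAngle hx0
    refine h.isSmoothHypersurface.abs_secondFundamentalForm_le_of_frequently hx
      -- The absolute value makes the bound nonnegative at every point of the space, as the limit
      -- argument requires.
      (c := fun x ↦ 40 + (16 + 48 * (n - k - 1 : ℕ)) *
        |(ε / polarAngle x) ^ (n - k - 1) / polarAngle x|) ?_ (fun y ↦ by positivity) ?_
    · exact continuousAt_const.add (continuousAt_const.mul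
        ((((continuousAt_const.div hc hr0).pow _).div hc hr0).abs))
    · exact h.frequently_of_polarAngle_eq hx h3.symm fun y hy hry ↦ main y hy ⟨hry.1, hry.2.le⟩
  · exact main x hx ⟨h3, hr⟩

end IsSmallGluingProfile

/-- The principal curvatures of a polar graph which is `C²`-close to the unit sphere are close
to `1`. -/
theorem exists_abs_polarCurv_sub_one_lt {η : ℝ} (hη : 0 < η) :
    ∃ τ > 0, ∀ r s p p₂ : ℝ, |s| < τ → |p| < τ → |p₂| < τ → |p * (cos r / sin r)| < τ →
      |p * (sin r / cos r)| < τ → |polarCurvFst r s p - 1| < η ∧ |polarCurvSnd r s p - 1| < η ∧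
        |polarCurvProfile s p p₂ - 1| < η := by
  -- The product `p cot r` is treated as an independent variable, so continuity at the origin gives
  -- a threshold uniform in `r`.
  have hc1 : ContinuousAt (fun x : ℝ × ℝ × ℝ ↦
      (1 - x.2.2 / (1 + x.1)) / √((1 + x.1) ^ 2 + x.2.1 ^ 2)) (0, 0, 0) := by
    refine ContinuousAt.div (ContinuousAt.sub continuousAt_const
      (ContinuousAt.div (by fun_prop) (by fun_prop) (by simp))) (by fun_prop) (by simp)
  have hc2 : ContinuousAt (fun x : ℝ × ℝ × ℝ ↦
      ((1 + x.1) ^ 2 + 2 * x.2.1 ^ 2 - (1 + x.1) * x.2.2) / √((1 + x.1) ^ 2 + x.2.1 ^ 2) ^ 3)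
      (0, 0, 0) := by
    refine ContinuousAt.div (by fun_prop) (by fun_prop) (by simp)
  obtain ⟨τ₁, hτ₁, h1⟩ := Metric.continuousAt_iff.1 hc1 η hη
  obtain ⟨τ₂, hτ₂, h2⟩ := Metric.continuousAt_iff.1 hc2 η hη
  refine ⟨min τ₁ τ₂, lt_min hτ₁ hτ₂, fun r s p p₂ hs hp hp₂ hA hB ↦ ⟨?_, ?_, ?_⟩⟩
  · have := @h1 (s, p, p * (cos r / sin r)) (by
      simp only [Prod.dist_eq, Real.dist_eq, sub_zero, max_lt_iff]
      exact ⟨hs.trans_le (min_le_left _ _), hp.trans_le (min_le_left _ _),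
        hA.trans_le (min_le_left _ _)⟩)
    simpa [Real.dist_eq, polarCurvFst, polarLength] using this
  -- The second curvature is the first with `p cot r` replaced by `-p tan r`.
  · have := @h1 (s, p, -(p * (sin r / cos r))) (by
      simp only [Prod.dist_eq, Real.dist_eq, sub_zero, max_lt_iff, abs_neg]
      exact ⟨hs.trans_le (min_le_left _ _), hp.trans_le (min_le_left _ _),
        hB.trans_le (min_le_left _ _)⟩)
    simpa [Real.dist_eq, polarCurvSnd, polarLength, neg_div] using this
  · have := @h2 (s, p, p₂) (by
      simp only [Prod.dist_eq, Real.dist_eq, sub_zero, max_lt_iff]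
      exact ⟨hs.trans_le (min_le_right _ _), hp.trans_le (min_le_right _ _),
        hp₂.trans_le (min_le_right _ _)⟩)
    simpa [Real.dist_eq, polarCurvProfile, polarLength] using this

/-! ### Curvature away from the neck -/

namespace IsSmallGluingProfile

variable {n k : ℕ} {a ε r δ : ℝ} {φ : ℝ → ℝ} {x : SplitSpace n k}

/-- The cotangent is bounded for `r ≥ δ`. The tangent is at most `2` below `2a + ε < π/3`, and
beyond this point the slope vanishes, so its pole at the equator plays no role. -/
theorem abs_deriv_mul_le (h : IsSmallGluingProfile n k a ε φ) {ψ : ℝ → ℝ}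
    (hψ : ψ = φ ∨ ψ = -φ) (hδ : 0 < δ) (hr : r ∈ Ico δ (π / 2)) :
    |deriv ψ r * (cos r / sin r)| ≤ |deriv φ r| * (2 / sin δ) ∧
      |deriv ψ r * (sin r / cos r)| ≤ |deriv φ r| * (2 / sin δ) := by
  have hpi := Real.pi_pos
  have e0 : |deriv ψ r| = |deriv φ r| := by
    rcases hψ with rfl | rfl
    · rfl
    · rw [show deriv (-φ) r = -deriv φ r from deriv.neg, abs_neg]
  have hsδ : 0 < sin δ := Real.sin_pos_of_pos_of_lt_pi hδ (by linarith [hr.1, hr.2])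
  have hs : sin δ ≤ sin r := Real.sin_le_sin_of_le_of_le_pi_div_two (by linarith) hr.2.le hr.1
  have hc : 0 < cos r := Real.cos_pos_of_mem_Ioo ⟨by linarith [hr.1], hr.2⟩
  rw [abs_mul, abs_mul, e0]
  constructor
  · gcongr
    rw [abs_of_nonneg (div_nonneg hc.le (hsδ.le.trans hs))]
    exact div_le_div₀ (by norm_num) ((Real.cos_le_one r).trans (by norm_num)) hsδ hs
  · rcases lt_or_ge r (2 * a + ε) with h1 | h1
    · gcongr
      have h2 := h.lt_pi
      have h3 : 1 / 2 ≤ cos r := by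
        rw [← Real.cos_pi_div_three]
        exact Real.cos_le_cos_of_nonneg_of_le_pi (by linarith [hr.1]) (by linarith) (by linarith)
      rw [abs_of_nonneg (div_nonneg (hsδ.le.trans hs) hc.le)]
      calc sin r / cos r ≤ 1 / (1 / 2) :=
            div_le_div₀ (by norm_num) (Real.sin_le_one r) (by norm_num) h3
        _ ≤ 2 / sin δ := by
            rw [one_div_one_div, le_div_iff₀ hsδ]
            linarith [Real.sin_le_one δ]
    · rw [h.deriv_eq_zero ⟨h1, hr.2⟩]
      simp

theorem abs_deriv_deriv_of_eq_or_eq_neg {ψ : ℝ → ℝ} (hψ : ψ = φ ∨ ψ = -φ) :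
    |deriv ψ r| = |deriv φ r| ∧ |deriv (deriv ψ) r| = |deriv (deriv φ) r| := by
  rcases hψ with rfl | rfl
  · exact ⟨rfl, rfl⟩
  · have e : deriv (-φ) = -deriv φ := by ext t; exact deriv.neg
    have e2 : deriv (-deriv φ) r = -deriv (deriv φ) r := deriv.neg
    rw [e, e2, Pi.neg_apply, abs_neg, abs_neg]
    exact ⟨rfl, rfl⟩

/-- Quantitative closeness of the curvature to that of the unit sphere. -/
theorem curvature_far (h : IsSmallGluingProfile n k a ε φ) {η τ : ℝ} (hη : η ≤ 1)
    (hτ : ∀ r s p p₂ : ℝ, |s| < τ → |p| < τ → |p₂| < τ → |p * (cos r / sin r)| < τ →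
      |p * (sin r / cos r)| < τ → |polarCurvFst r s p - 1| < η ∧ |polarCurvSnd r s p - 1| < η ∧
        |polarCurvProfile s p p₂ - 1| < η)
    (hτη : τ ≤ η / 2) (hδ : 0 < δ) (hεδ : ε < δ)
    (h0 : ∀ r ∈ Icc ε (π / 2), |φ r| < τ)
    (h1 : ∀ r ∈ Ico δ (π / 2), |deriv φ r| < τ * (sin δ / 2) ∧ |deriv (deriv φ) r| < τ)
    (hx : x ∈ gluedHypersurface n k ε φ) (hr : δ ≤ polarAngle x) :
    |meanCurvature (gluedHypersurface n k ε φ) x - 1| ≤ η ∧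
    ∀ u ∈ tangentSpaceAt (gluedHypersurface n k ε φ) x,
      ∀ v ∈ tangentSpaceAt (gluedHypersurface n k ε φ) x,
      |secondFundamentalForm (outerNormal (gluedHypersurface n k ε φ) x) x u v| ≤
        24 * (‖u‖ * ‖v‖) := by
  have hk := h.codim
  have hpi := Real.pi_pos
  have hn : (0 : ℝ) < n := by exact_mod_cast (by lia : 0 < n)
  obtain ⟨hx0, hxr, hxn⟩ := h.mem_glued_iff.1 hx
  rcases hxr.2.eq_or_lt with h2 | h2
  -- On the equator the hypersurface is a sphere of radius `‖x‖ ≥ 1/2`; the bound `‖x‖⁻¹ ≤ 2` is the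
  -- reason for requiring `τ ≤ η/2`.
  · obtain ⟨U, hxU, hU, hU0, hM⟩ := h.exists_sphere hx (by rw [h2]; exact h.lt_pi_div_two)
    have hb := h0 _ hxr
    have hb2 := h.abs_lt_half _ hxr
    have e1 : |‖x‖ - 1| < τ := by
      rcases hxn with h3 | h3 <;> rw [h3]
      · simpa using hb
      · simpa using hb
    have e2 : 1 / 2 ≤ ‖x‖ := by
      rcases hxn with h3 | h3 <;> rw [h3] <;> linarith [(abs_lt.1 hb2).1, (abs_lt.1 hb2).2]
    have e3 : ‖x‖⁻¹ ≤ 2 := by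
      rw [inv_le_comm₀ (by linarith) (by norm_num)]; linarith
    constructor
    · rw [meanCurvature_sphere hU hU0 hM ⟨hx, hxU⟩ (by lia) (finrank_splitSpace hk)]
      have : ‖x‖⁻¹ - 1 = -((‖x‖ - 1) * ‖x‖⁻¹) := by
        have : ‖x‖ ≠ 0 := norm_ne_zero_iff.2 hx0
        field_simp
        ring
      rw [this, abs_neg, abs_mul, abs_of_pos (show 0 < ‖x‖⁻¹ by positivity)]
      calc |‖x‖ - 1| * ‖x‖⁻¹ ≤ (η / 2) * 2 := by gcongr; linarith [abs_nonneg (‖x‖ - 1)]; linarith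
        _ = η := by ring
    · intro u hu v _
      refine (abs_secondFundamentalForm_sphere_le hU hU0 hM ⟨hx, hxU⟩ hu).trans ?_
      gcongr
      linarith
  · obtain ⟨U, ψ, hxU, hψ, hG⟩ := h.exists_isPolarGraph hx ⟨hεδ.trans_le hr, h2⟩
    have hsδ : 0 < sin δ := Real.sin_pos_of_pos_of_lt_pi hδ (by linarith)
    obtain ⟨d1, d2⟩ := h1 _ ⟨hr, h2⟩
    obtain ⟨e1, e2⟩ := abs_deriv_deriv_of_eq_or_eq_neg (r := polarAngle x) hψ
    obtain ⟨m1, m2⟩ := h.abs_deriv_mul_le hψ hδ ⟨hr, h2⟩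
    have hτ0 : 0 < τ := (abs_nonneg _).trans_lt d2
    have d3 : |deriv φ (polarAngle x)| * (2 / sin δ) < τ := by
      calc |deriv φ (polarAngle x)| * (2 / sin δ) < τ * (sin δ / 2) * (2 / sin δ) := by gcongr
        _ = τ := by field_simp
    have d4 : |deriv ψ (polarAngle x)| < τ := by
      rw [e1]
      refine d1.trans_le (mul_le_of_le_one_right hτ0.le ?_)
      linarith [Real.sin_le_one δ]
    obtain ⟨c1, c2, c3⟩ := hτ (polarAngle x) (ψ (polarAngle x)) (deriv ψ (polarAngle x))
      (deriv (deriv ψ) (polarAngle x)) (by rw [abs_of_eq_or_eq_neg hψ]; exact h0 _ hxr) d4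
      (by rw [e2]; exact d2) (m1.trans_lt d3) (m2.trans_lt d3)
    constructor
    · rw [hG.meanCurvature_eq ⟨hx, hxU⟩ (finrank_splitSpace hk), finrank_euclideanSpace_fin,
        finrank_euclideanSpace_fin]
      set A := polarCurvFst (polarAngle x) (ψ (polarAngle x)) (deriv ψ (polarAngle x))
      set B := polarCurvSnd (polarAngle x) (ψ (polarAngle x)) (deriv ψ (polarAngle x))
      set D := polarCurvProfile (ψ (polarAngle x)) (deriv ψ (polarAngle x))
        (deriv (deriv ψ) (polarAngle x))
      have hnk : ((n - k : ℕ) : ℝ) = n - k := Nat.cast_sub (by lia)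
      have hnk2 : (0 : ℝ) ≤ n - k - 1 := by
        have : ((k + 2 : ℕ) : ℝ) ≤ n := by exact_mod_cast hk
        push_cast at this
        linarith
      rw [hnk, div_sub_one hn.ne', abs_div, abs_of_pos hn, div_le_iff₀ hn]
      push_cast
      -- The multiplicities `n - k - 1`, `k` and `1` add up to `n`.
      have key : (n - k - 1 : ℝ) * A + (k + 1 - 1) * B + D - n =
          (n - k - 1) * (A - 1) + k * (B - 1) + (D - 1) := by ring
      rw [key]
      refine (abs_add_three _ _ _).trans ?_
      rw [abs_mul, abs_mul, abs_of_nonneg hnk2, Nat.abs_cast]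
      have f1 := mul_le_mul_of_nonneg_left c1.le hnk2
      have f2 := mul_le_mul_of_nonneg_left c2.le (Nat.cast_nonneg (α := ℝ) k)
      linarith
    · intro u hu v _
      refine (hG.abs_secondFundamentalForm_le ⟨hx, hxU⟩ hu).trans ?_
      have f : ∀ c : ℝ, |c - 1| < η → |c| ≤ 2 := fun c hc ↦ by
        have := abs_lt.1 hc
        rw [abs_le]; constructor <;> linarith
      have := f _ c1
      have := f _ c2
      have := f _ c3
      refine mul_le_mul_of_nonneg_right ?_ (by positivity)
      linarith

end IsSmallGluingProfile

namespace IsGluingFamily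

variable {n k : ℕ} {a δ : ℝ} {φ : ℝ → ℝ → ℝ}

theorem eventually_isSmallGluingProfile (h : IsGluingFamily n k a φ) (hk : k + 2 ≤ n) (ha : 0 < a)
    (ha' : a < π / 10) : ∀ᶠ ε in 𝓝[>] 0, IsSmallGluingProfile n k a ε (φ ε) := by
  filter_upwards [h.profile, h.tendsto_zero (1 / 2) (by norm_num), eventually_Ioo_nhdsGT ha]
    with ε h1 h2 h3
  exact ⟨h1, hk, ha, ha', h3.1, h3.2, h2⟩

/-- The end `π/2` is left out because two-sided derivatives there depend on values outside the
domain of the profile. -/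
theorem eventually_abs_deriv_lt (h : IsGluingFamily n k a φ) (hδ : 0 < δ) {τ : ℝ} (hτ : 0 < τ) :
    ∀ᶠ ε in 𝓝[>] 0, ∀ r ∈ Ico δ (π / 2),
      |deriv (φ ε) r| < τ ∧ |deriv (deriv (φ ε)) r| < τ := by
  have hK : Icc δ (π / 2) ⊆ Ioc 0 (π / 2) := fun r hr ↦ ⟨hδ.trans_le hr.1, hr.2⟩
  filter_upwards [eventually_Ioo_nhdsGT hδ,
    Metric.tendstoUniformlyOn_iff.1 (h.deriv_tendsto_zero _ hK isCompact_Icc) τ hτ,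
    Metric.tendstoUniformlyOn_iff.1 (h.deriv2_tendsto_zero _ hK isCompact_Icc) τ hτ]
    with ε h1 h2 h3 r hr
  have key : ∀ t ∈ Ioo ε (π / 2), derivWithin (φ ε) (Ioc ε (π / 2)) t = deriv (φ ε) t :=
    fun t ht ↦ derivWithin_of_mem_nhds (Ioc_mem_nhds ht.1 ht.2)
  have hr' : r ∈ Ioo ε (π / 2) := ⟨h1.2.trans_le hr.1, hr.2⟩
  have e1 := h2 r ⟨hr.1, hr.2.le⟩
  have e2 := h3 r ⟨hr.1, hr.2.le⟩
  rw [key r hr'] at e1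
  have e3 : iteratedDerivWithin 2 (φ ε) (Ioc ε (π / 2)) r = deriv (deriv (φ ε)) r := by
    rw [iteratedDerivWithin_succ, derivWithin_of_mem_nhds (Ioc_mem_nhds hr'.1 hr'.2)]
    refine Filter.EventuallyEq.deriv_eq ?_
    filter_upwards [Ioo_mem_nhds hr'.1 hr'.2] with t ht
    rw [iteratedDerivWithin_one, key t ht]
  rw [e3] at e2
  simpa [Real.dist_eq] using And.intro e1 e2

/-- Away from the neck the curvature converges uniformly to that of the unit sphere. -/
theorem eventually_curvature_far (h : IsGluingFamily n k a φ) (hk : k + 2 ≤ n) (ha : 0 < a)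
    (ha' : a < π / 10) (hδ : 0 < δ) (hδ' : δ < π / 2) {η : ℝ} (hη : 0 < η) (hη' : η ≤ 1) :
    ∀ᶠ ε in 𝓝[>] 0, ∀ x ∈ gluedHypersurface n k ε (φ ε), δ ≤ polarAngle x →
      |meanCurvature (gluedHypersurface n k ε (φ ε)) x - 1| ≤ η ∧
      ∀ u ∈ tangentSpaceAt (gluedHypersurface n k ε (φ ε)) x,
        ∀ v ∈ tangentSpaceAt (gluedHypersurface n k ε (φ ε)) x,
        |secondFundamentalForm (outerNormal (gluedHypersurface n k ε (φ ε)) x) x u v| ≤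
          24 * (‖u‖ * ‖v‖) := by
  obtain ⟨τ, hτ, H⟩ := exists_abs_polarCurv_sub_one_lt hη
  have hsδ : 0 < sin δ := Real.sin_pos_of_pos_of_lt_pi hδ (by linarith [Real.pi_pos])
  set τ' := min τ (η / 2)
  have hτ' : 0 < τ' := lt_min hτ (by linarith)
  filter_upwards [h.eventually_isSmallGluingProfile hk ha ha', eventually_Ioo_nhdsGT hδ,
    h.tendsto_zero τ' hτ', h.eventually_abs_deriv_lt hδ (τ := τ' * (sin δ / 2)) (by positivity)]
    with ε h1 h2 h3 h4 x hx hr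
  have hle : τ' ≤ τ := min_le_left _ _
  refine h1.curvature_far hη' (fun r s p p₂ e1 e2 e3 e4 e5 ↦ H r s p p₂ (e1.trans_le hle)
    (e2.trans_le hle) (e3.trans_le hle) (e4.trans_le hle) (e5.trans_le hle)) (min_le_right _ _)
    hδ h2.2 h3 (fun r hr ↦ ⟨(h4 r hr).1, (h4 r hr).2.trans_le ?_⟩) hx hr
  refine mul_le_of_le_one_right hτ'.le ?_
  linarith [Real.sin_le_one δ]

end IsGluingFamily

/-! ### Lipschitz charts of spheres by faces of cubes -/

section SphereCharts

theorem norm_normalize_sub_normalize_le {V : Type*} [NormedAddCommGroup V] [NormedSpace ℝ V]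
    {y z : V} (hy : 1 ≤ ‖y‖) (hz : 1 ≤ ‖z‖) : ‖‖y‖⁻¹ • y - ‖z‖⁻¹ • z‖ ≤ 2 * ‖y - z‖ := by
  have hy0 : 0 < ‖y‖ := by linarith
  have hz0 : 0 < ‖z‖ := by linarith
  have e : ‖y‖⁻¹ • y - ‖z‖⁻¹ • z = ‖y‖⁻¹ • ((y - z) + ((‖z‖ - ‖y‖) * ‖z‖⁻¹) • z) := by
    rw [smul_add, smul_smul, smul_sub]
    have : ‖y‖⁻¹ * ((‖z‖ - ‖y‖) * ‖z‖⁻¹) = ‖y‖⁻¹ - ‖z‖⁻¹ := by field_simp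
    rw [this, sub_smul]
    abel
  rw [e, norm_smul, norm_inv, norm_norm]
  have h1 : ‖((‖z‖ - ‖y‖) * ‖z‖⁻¹) • z‖ ≤ ‖y - z‖ := by
    rw [norm_smul, norm_mul, norm_inv, norm_norm, mul_assoc, inv_mul_cancel₀ hz0.ne', mul_one,
      Real.norm_eq_abs, abs_sub_comm]
    exact abs_norm_sub_norm_le y z
  have h2 := norm_add_le (y - z) (((‖z‖ - ‖y‖) * ‖z‖⁻¹) • z)
  calc _ ≤ 1 * (‖y - z‖ + ‖y - z‖) := by
        gcongr
        · exact inv_le_one_of_one_le₀ hy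
        · linarith
    _ = _ := by ring

/-- The parametrization of a part of the sphere by a face of the cube. -/
def cubeChart {d : ℕ} (i : Fin (d + 1)) (σ : ℝ) (w : Fin d → ℝ) : EuclideanSpace ℝ (Fin (d + 1)) :=
  ‖(WithLp.toLp 2 (i.insertNth σ w) : EuclideanSpace ℝ (Fin (d + 1)))‖⁻¹ •
    WithLp.toLp 2 (i.insertNth σ w)

theorem one_le_norm_insertNth {d : ℕ} (i : Fin (d + 1)) {σ : ℝ} (hσ : |σ| = 1) (w : Fin d → ℝ) :
    1 ≤ ‖(WithLp.toLp 2 (i.insertNth σ w) : EuclideanSpace ℝ (Fin (d + 1)))‖ := by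
  have := PiLp.norm_apply_le (WithLp.toLp 2 (i.insertNth σ w) : EuclideanSpace ℝ (Fin (d + 1))) i
  simpa [hσ] using this

theorem norm_cubeChart {d : ℕ} (i : Fin (d + 1)) {σ : ℝ} (hσ : |σ| = 1) (w : Fin d → ℝ) :
    ‖cubeChart i σ w‖ = 1 := by
  have := one_le_norm_insertNth i hσ w
  rw [cubeChart, norm_smul, norm_inv, norm_norm, inv_mul_cancel₀ (by linarith)]

/-- Normalization is `2`-Lipschitz outside the unit ball, and `√(d + 1)` compares the Euclidean norm
with the sup norm. -/
theorem norm_cubeChart_sub_le {d : ℕ} (i : Fin (d + 1)) {σ : ℝ} (hσ : |σ| = 1) (w w' : Fin d → ℝ) :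
    ‖cubeChart i σ w - cubeChart i σ w'‖ ≤ 2 * √(d + 1) * ‖w - w'‖ := by
  refine (norm_normalize_sub_normalize_le (one_le_norm_insertNth i hσ w)
    (one_le_norm_insertNth i hσ w')).trans ?_
  rw [mul_assoc]
  gcongr
  rw [EuclideanSpace.norm_eq]
  refine Real.sqrt_le_iff.2 ⟨by positivity, ?_⟩
  rw [mul_pow, Real.sq_sqrt (by positivity)]
  have : ∀ j, ‖(WithLp.toLp 2 (i.insertNth σ w) - WithLp.toLp 2 (i.insertNth σ w') :
      EuclideanSpace ℝ (Fin (d + 1))) j‖ ^ 2 ≤ ‖w - w'‖ ^ 2 := by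
    intro j
    gcongr
    rcases i.eq_self_or_eq_succAbove j with rfl | ⟨l, rfl⟩
    · simp
    · simpa using norm_le_pi_norm (w - w') l
  refine (Finset.sum_le_sum fun j _ ↦ this j).trans ?_
  simp

/-- Division by the coordinate of largest absolute value moves the point onto a face of the cube. -/
theorem exists_cubeChart_eq {d : ℕ} (x : EuclideanSpace ℝ (Fin (d + 1))) (hx : ‖x‖ = 1) :
    ∃ (i : Fin (d + 1)) (b : Bool) (w : Fin d → ℝ), w ∈ Icc (-1) 1 ∧
      cubeChart i (if b then 1 else -1) w = x := by
  obtain ⟨i, hi⟩ := Finite.exists_max fun i ↦ |x i|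
  have hpos : 0 < |x i| := by
    by_contra h0
    have : x = 0 := by
      ext j
      have := hi j
      have := abs_nonneg (x j)
      have : |x j| = 0 := by linarith
      simpa using this
    simp [this] at hx
  have hne : x i ≠ 0 := abs_pos.1 hpos
  refine ⟨i, decide (0 < x i), fun l ↦ x (i.succAbove l) / |x i|, ?_, ?_⟩
  · rw [mem_Icc, Pi.le_def, Pi.le_def]
    rw [← forall_and]
    intro l
    rw [Pi.neg_apply, Pi.one_apply, ← abs_le, abs_div, abs_abs, div_le_one hpos]
    exact hi _
  · have e : (WithLp.toLp 2 (i.insertNth (if decide (0 < x i) then (1 : ℝ) else -1)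
        fun l ↦ x (i.succAbove l) / |x i|) : EuclideanSpace ℝ (Fin (d + 1))) = |x i|⁻¹ • x := by
      ext j
      rcases i.eq_self_or_eq_succAbove j with rfl | ⟨l, rfl⟩
      · rcases hne.lt_or_gt with h | h
        · simp [h.not_gt, abs_of_neg h, hne, inv_neg]
        · simp [h, abs_of_pos h, hne]
      · simp [div_eq_inv_mul]
    rw [cubeChart, e, norm_smul, norm_inv, Real.norm_eq_abs, abs_abs, hx, mul_one, inv_inv, smul_smul,
      mul_inv_cancel₀ hpos.ne', one_smul]

end SphereCharts

/-! ### Volume of tubes around a profile curve -/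

section TubeVolume

theorem volume_box_le {q k : ℕ} {R : ℝ} (hR : 0 ≤ R) :
    volume (Icc (Sum.elim (fun _ ↦ -R) (Sum.elim (fun _ ↦ -1) fun _ ↦ 0))
      (Sum.elim (fun _ ↦ R) (Sum.elim (fun _ ↦ 1) fun _ ↦ 2 * R)) :
        Set (Fin q ⊕ Fin k ⊕ Unit → ℝ)) ≤
      ENNReal.ofReal (2 ^ (q + k + 1) * R ^ (q + 1)) := by
  rw [Real.volume_Icc_pi, Fintype.prod_sum_type, Fintype.prod_sum_type]
  simp only [Sum.elim_inl, Sum.elim_inr, Finset.prod_const, Finset.card_univ, Fintype.card_fin,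
    Fintype.card_unit, sub_zero, pow_one]
  rw [← ENNReal.ofReal_pow (by linarith), ← ENNReal.ofReal_pow (by norm_num),
    ← ENNReal.ofReal_mul (by positivity), ← ENNReal.ofReal_mul (pow_nonneg (by linarith) _)]
  refine ENNReal.ofReal_le_ofReal (le_of_eq ?_)
  ring

/-- The volume of a tube swept by products of spheres is controlled by the radius of the first
spheres and the length of the profile curve. -/
theorem exists_measure_tube_le (q k : ℕ) : ∃ C : ℝ, 0 < C ∧
    ∀ (N : ℕ), N = q + 1 → ∀ (n : ℕ), n = q + k + 1 →
    ∀ (R : ℝ), 0 < R → ∀ (T : Set ℝ), T ⊆ Icc 0 (2 * R) → ∀ (A B : ℝ → ℝ),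
      (∀ t ∈ T, |A t| ≤ 2 * R) → (∀ t ∈ T, |B t| ≤ 2) →
      (∀ t ∈ T, ∀ t' ∈ T, |A t - A t'| ≤ 3 * |t - t'|) →
      (∀ t ∈ T, ∀ t' ∈ T, |B t - B t'| ≤ 3 * |t - t'|) →
      μHE[n] {x : WithLp 2 (EuclideanSpace ℝ (Fin N) × EuclideanSpace ℝ (Fin (k + 1))) |
        ∃ t ∈ T, ∃ (y : EuclideanSpace ℝ (Fin N)) (z : EuclideanSpace ℝ (Fin (k + 1))),
          ‖y‖ = 1 ∧ ‖z‖ = 1 ∧ x = WithLp.toLp 2 (A t • y, B t • z)} ≤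
        ENNReal.ofReal (C * R ^ (q + 1)) := by
  -- The `6` comes from the constants `3` of `A` and `B`; the roots come from the charts, weighted
  -- by `|A| ≤ 2R` with coordinates scaled by `1/R`, and by `|B| ≤ 2`.
  set L : ℝ := 6 + 4 * √(q + 1) + 4 * √(k + 1) with hL
  have hL0 : 0 < L := by positivity
  set c := Measure.addHaarScalarFactor (volume : Measure (EuclideanSpace ℝ (Fin (q + k + 1))))
    μH[(q + k + 1 : ℕ)] with hc
  -- Number of pairs of cube faces, times the Lipschitz constant to the power `n`, times the volume
  -- of the box up to `R^(q+1)`; the added `1` ensures positivity.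
  refine ⟨c * (((q + 1) * 2 * ((k + 1) * 2)) * (L ^ (q + k + 1) * 2 ^ (q + k + 1))) + 1,
    by positivity, ?_⟩
  rintro N rfl n rfl R hR T hT A B hA hB hA' hB'
  set S := {x : WithLp 2 (EuclideanSpace ℝ (Fin (q + 1)) × EuclideanSpace ℝ (Fin (k + 1))) |
        ∃ t ∈ T, ∃ (y : EuclideanSpace ℝ (Fin (q + 1))) (z : EuclideanSpace ℝ (Fin (k + 1))),
          ‖y‖ = 1 ∧ ‖z‖ = 1 ∧ x = WithLp.toLp 2 (A t • y, B t • z)} with hS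
  -- The coordinates of the first sphere range over `[-R, R]`. The box then has volume of order
  -- `R^(q+1)`, while the Lipschitz constant stays independent of `R`.
  let G : ((Fin (q + 1) × Bool) × (Fin (k + 1) × Bool)) → (Fin q ⊕ Fin k ⊕ Unit → ℝ) →
      WithLp 2 (EuclideanSpace ℝ (Fin (q + 1)) × EuclideanSpace ℝ (Fin (k + 1))) := fun i w ↦
    WithLp.toLp 2 (A (w (Sum.inr (Sum.inr ()))) • cubeChart i.1.1 (if i.1.2 then 1 else -1)
        (R⁻¹ • fun l ↦ w (Sum.inl l)),
      B (w (Sum.inr (Sum.inr ()))) • cubeChart i.2.1 (if i.2.2 then 1 else -1)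
        (fun l ↦ w (Sum.inr (Sum.inl l))))
  let D : Set (Fin q ⊕ Fin k ⊕ Unit → ℝ) :=
    Icc (Sum.elim (fun _ ↦ -R) (Sum.elim (fun _ ↦ -1) fun _ ↦ 0))
      (Sum.elim (fun _ ↦ R) (Sum.elim (fun _ ↦ 1) fun _ ↦ 2 * R)) ∩
      {w | w (Sum.inr (Sum.inr ())) ∈ T}
  have hσ : ∀ b : Bool, |(if b then (1 : ℝ) else -1)| = 1 := by intro b; cases b <;> simp
  have hcover : S ⊆ ⋃ i, G i '' D := by
    rintro x ⟨t, ht, y, z, hy, hz, rfl⟩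
    obtain ⟨i, b, w, hw, rfl⟩ := exists_cubeChart_eq y hy
    obtain ⟨j, b', w', hw', rfl⟩ := exists_cubeChart_eq z hz
    refine mem_iUnion.2 ⟨((i, b), (j, b')),
      Sum.elim (R • w) (Sum.elim w' fun _ ↦ t), ⟨⟨?_, ?_⟩, ht⟩, ?_⟩
    · rintro (l | l | l)
      · have := hw.1 l
        simp only [Pi.neg_apply, Pi.one_apply] at this
        simp only [Sum.elim_inl, Pi.smul_apply, smul_eq_mul]
        nlinarith
      · exact hw'.1 l
      · exact (hT ht).1
    · rintro (l | l | l)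
      · have := hw.2 l
        simp only [Pi.one_apply] at this
        simp only [Sum.elim_inl, Pi.smul_apply, smul_eq_mul]
        nlinarith
      · exact hw'.2 l
      · exact (hT ht).2
    · have : (R⁻¹ • fun l ↦ (R • w) l) = w := by
        ext l; simp [hR.ne']
      simp only [G, Sum.elim_inl, Sum.elim_inr, this]
  have hlip : ∀ i, LipschitzOnWith (Real.toNNReal L) (G i) D := by
    intro i
    refine LipschitzOnWith.of_dist_le_mul fun w hw w' hw' ↦ ?_
    rw [Real.coe_toNNReal _ hL0.le, dist_eq_norm, dist_eq_norm]
    have ht := hw.2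
    have ht' := hw'.2
    set t := w (Sum.inr (Sum.inr ()))
    set t' := w' (Sum.inr (Sum.inr ()))
    have hd : ∀ j, |w j - w' j| ≤ ‖w - w'‖ := fun j ↦ norm_le_pi_norm (w - w') j
    have htt : |t - t'| ≤ ‖w - w'‖ := hd _
    have e1 : ‖(R⁻¹ • fun l ↦ w (Sum.inl l)) - (R⁻¹ • fun l ↦ w' (Sum.inl l))‖ ≤
        R⁻¹ * ‖w - w'‖ := by
      rw [← smul_sub, norm_smul, norm_inv, Real.norm_of_nonneg hR.le]
      gcongr
      exact (pi_norm_le_iff_of_nonneg (norm_nonneg _)).2 fun l ↦ hd _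
    have e2 : ‖(fun l ↦ w (Sum.inr (Sum.inl l))) - (fun l ↦ w' (Sum.inr (Sum.inl l)))‖ ≤
        ‖w - w'‖ := (pi_norm_le_iff_of_nonneg (norm_nonneg _)).2 fun l ↦ hd _
    have f1 := norm_cubeChart_sub_le i.1.1 (hσ i.1.2) (R⁻¹ • fun l ↦ w (Sum.inl l))
      (R⁻¹ • fun l ↦ w' (Sum.inl l))
    have f2 := norm_cubeChart_sub_le i.2.1 (hσ i.2.2) (fun l ↦ w (Sum.inr (Sum.inl l)))
      (fun l ↦ w' (Sum.inr (Sum.inl l)))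
    have n1 := norm_cubeChart i.1.1 (hσ i.1.2) (R⁻¹ • fun l ↦ w (Sum.inl l))
    have n2 := norm_cubeChart i.2.1 (hσ i.2.2) (fun l ↦ w (Sum.inr (Sum.inl l)))
    have key : ∀ {V : Type} [NormedAddCommGroup V] [NormedSpace ℝ V] (α α' : ℝ) (u u' : V),
        ‖u‖ = 1 → ‖α • u - α' • u'‖ ≤ |α - α'| + |α'| * ‖u - u'‖ := by
      intro V _ _ α α' u u' hu
      have : α • u - α' • u' = (α - α') • u + α' • (u - u') := by
        rw [sub_smul, smul_sub]; abel
      rw [this]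
      refine (norm_add_le _ _).trans ?_
      rw [norm_smul, norm_smul, hu, mul_one, Real.norm_eq_abs, Real.norm_eq_abs]
    have hbound : ∀ (p : EuclideanSpace ℝ (Fin (q + 1))) (p' : EuclideanSpace ℝ (Fin (k + 1))),
        ‖(WithLp.toLp 2 (p, p') :
          WithLp 2 (EuclideanSpace ℝ (Fin (q + 1)) × EuclideanSpace ℝ (Fin (k + 1))))‖ ≤
          ‖p‖ + ‖p'‖ := by
      intro p p'
      rw [WithLp.prod_norm_eq_of_L2]
      refine Real.sqrt_le_iff.2 ⟨by positivity, ?_⟩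
      change ‖p‖ ^ 2 + ‖p'‖ ^ 2 ≤ _
      nlinarith [norm_nonneg p, norm_nonneg p']
    have g0 : G i w - G i w' = WithLp.toLp 2
        (A t • cubeChart i.1.1 (if i.1.2 then 1 else -1) (R⁻¹ • fun l ↦ w (Sum.inl l)) -
          A t' • cubeChart i.1.1 (if i.1.2 then 1 else -1) (R⁻¹ • fun l ↦ w' (Sum.inl l)),
        B t • cubeChart i.2.1 (if i.2.2 then 1 else -1) (fun l ↦ w (Sum.inr (Sum.inl l))) -
          B t' • cubeChart i.2.1 (if i.2.2 then 1 else -1)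
            (fun l ↦ w' (Sum.inr (Sum.inl l)))) := rfl
    rw [g0]
    refine (hbound _ _).trans ((add_le_add (key _ _ _ _ n1) (key _ _ _ _ n2)).trans ?_)
    have g1 := (hA' t ht t' ht').trans (mul_le_mul_of_nonneg_left htt (by norm_num))
    have g2 := (hB' t ht t' ht').trans (mul_le_mul_of_nonneg_left htt (by norm_num))
    have g3 := mul_le_mul (hA t' ht') (f1.trans (mul_le_mul_of_nonneg_left e1 (by positivity)))
      (norm_nonneg _) (by positivity)
    have g4 := mul_le_mul (hB t' ht') (f2.trans (mul_le_mul_of_nonneg_left e2 (by positivity)))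
      (norm_nonneg _) (by norm_num)
    have g5 : 2 * R * (2 * √(q + 1) * (R⁻¹ * ‖w - w'‖)) = 4 * √(q + 1) * ‖w - w'‖ := by
      field_simp
      ring
    rw [g5] at g3
    refine (add_le_add (add_le_add g1 g3) (add_le_add g2 g4)).trans (le_of_eq ?_)
    rw [hL]
    ring
  have hcard : ((Fintype.card (Fin q ⊕ Fin k ⊕ Unit) : ℕ) : ℝ) = (q + k + 1 : ℕ) := by
    simp
    ring
  have hD : μH[((q + k + 1 : ℕ) : ℝ)] D ≤ ENNReal.ofReal (2 ^ (q + k + 1) * R ^ (q + 1)) := by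
    -- With the sup norm on the parameter space, Hausdorff measure is exactly Lebesgue measure.
    rw [← hcard, hausdorffMeasure_pi_real]
    exact (measure_mono inter_subset_left).trans (volume_box_le hR.le)
  have hG : ∀ i, μH[((q + k + 1 : ℕ) : ℝ)] (G i '' D) ≤
      ENNReal.ofReal (L ^ (q + k + 1) * 2 ^ (q + k + 1) * R ^ (q + 1)) := by
    intro i
    refine ((hlip i).hausdorffMeasure_image_le (Nat.cast_nonneg _)).trans ?_
    rw [ENNReal.rpow_natCast, mul_assoc, ENNReal.ofReal_mul (by positivity),
      ENNReal.ofReal_pow hL0.le]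
    exact mul_le_mul_right hD _
  rw [Measure.euclideanHausdorffMeasure_def, Measure.smul_apply, ← hc, ENNReal.smul_def, smul_eq_mul]
  have hS' : μH[((q + k + 1 : ℕ) : ℝ)] S ≤ ENNReal.ofReal (((q + 1) * 2 * ((k + 1) * 2)) *
      (L ^ (q + k + 1) * 2 ^ (q + k + 1) * R ^ (q + 1))) := by
    refine (measure_mono hcover).trans ((measure_iUnion_fintype_le _ _).trans ?_)
    refine (Finset.sum_le_sum fun i _ ↦ hG i).trans (le_of_eq ?_)
    rw [Finset.sum_const, nsmul_eq_mul,
      ENNReal.ofReal_mul (p := ((q : ℝ) + 1) * 2 * ((k + 1) * 2)) (by positivity)]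
    congr 1
    rw [← ENNReal.ofReal_natCast]
    congr 1
    simp
  calc (c : ℝ≥0∞) * μH[((q + k + 1 : ℕ) : ℝ)] S ≤ ENNReal.ofReal c *
      ENNReal.ofReal (((q + 1) * 2 * ((k + 1) * 2)) *
      (L ^ (q + k + 1) * 2 ^ (q + k + 1) * R ^ (q + 1))) := by
        rw [ENNReal.ofReal_coe_nnreal]
        exact mul_le_mul_right hS' _
    _ ≤ _ := by
        rw [← ENNReal.ofReal_mul (by positivity)]
        refine ENNReal.ofReal_le_ofReal ?_
        have := pow_pos hR (q + 1)
        nlinarith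

end TubeVolume

/-- When two quantities vary in the same direction, each is a `1`-Lipschitz function of their sum.
-/
theorem abs_sub_le_abs_sub_of_monotone {α β x y : ℝ} (h : (α ≤ β ∧ x ≤ y) ∨ (β ≤ α ∧ y ≤ x)) :
    |α - β| ≤ |(α + x) - (β + y)| ∧ |x - y| ≤ |(α + x) - (β + y)| := by
  rcases h with h | h
  · rw [abs_of_nonpos (by linarith [h.1]), abs_of_nonpos (by linarith [h.2]),
      abs_of_nonpos (by linarith [h.1, h.2])]
    constructor <;> linarith [h.1, h.2]
  · rw [abs_of_nonneg (by linarith [h.1]), abs_of_nonneg (by linarith [h.2]),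
      abs_of_nonneg (by linarith [h.1, h.2])]
    constructor <;> linarith [h.1, h.2]

theorem abs_mul_sub_mul_le {ρ ρ' c c' d : ℝ} (hρ : |ρ - ρ'| ≤ d) (hρ' : |ρ'| ≤ 2) (hc : |c - c'| ≤ d)
    (hc' : |c| ≤ 1) : |ρ * c - ρ' * c'| ≤ 3 * d := by
  have e : ρ * c - ρ' * c' = (ρ - ρ') * c + ρ' * (c - c') := by ring
  have hd := (abs_nonneg _).trans hρ
  rw [e]
  refine (abs_add_le _ _).trans ?_
  rw [abs_mul, abs_mul]
  have h1 := mul_le_mul hρ hc' (abs_nonneg _) hd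
  have h2 := mul_le_mul hρ' hc (abs_nonneg _) (by norm_num)
  linarith

/-! ### Upper and lower volume bounds for the hypersurface -/

namespace IsSmallGluingProfile

variable {n k : ℕ} {a ε r : ℝ} {φ : ℝ → ℝ} {x : SplitSpace n k}

theorem monotoneOn_neck (h : IsSmallGluingProfile n k a ε φ) : MonotoneOn φ (Icc ε (a + ε)) := by
  intro r hr s hs hrs
  have hε := h.eps_pos
  rw [h.eq_neck r hr, h.eq_neck s hs, neckProfile_eq, neckProfile_eq]
  refine mul_le_mul_of_nonneg_left ((catenoidProfile_strictMonoOn h.one_le).monotoneOn ?_ ?_ ?_) hε.le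
  · exact (one_le_div hε).2 hr.1
  · exact (one_le_div hε).2 hs.1
  · gcongr

/-- The volume of the neck is that of a tube of radius `R` in codimension `n - k`. -/
theorem exists_measure_neck_le {n k : ℕ} (hk : k + 2 ≤ n) : ∃ C : ℝ, 0 < C ∧
    ∀ (a ε : ℝ) (φ : ℝ → ℝ), IsSmallGluingProfile n k a ε φ → ∀ R ∈ Icc ε a,
      μHE[n] (gluedHypersurface n k ε φ ∩ {x | polarAngle x ≤ R}) ≤
        ENNReal.ofReal (C * R ^ (n - k)) := by
  obtain ⟨C, hC, H⟩ := exists_measure_tube_le (n - k - 1) k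
  refine ⟨C + C, by positivity, fun a ε φ h R hR ↦ ?_⟩
  have hε := h.eps_pos
  have hpi := Real.pi_pos
  have ha := h.a_lt
  have hR0 : 0 < R := hε.trans_le hR.1
  have hmono : MonotoneOn φ (Icc ε R) :=
    h.monotoneOn_neck.mono (Icc_subset_Icc_right (by linarith [hR.2]))
  -- The profile is not Lipschitz in `r` at the neck circle. In the parameter `r + φ(r)` both `r`
  -- and `φ(r)` are `1`-Lipschitz, by monotonicity, and the bound `φ(r) ≤ r` keeps it in `[0, 2R]`.
  set f : ℝ → ℝ := fun r ↦ r + φ r with hf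
  have hsub : ∀ r ∈ Icc ε R, r ∈ Icc ε (π / 2) := fun r hr ↦ ⟨hr.1, by linarith [hr.2, hR.2]⟩
  have hφ0 : ∀ r ∈ Icc ε R, 0 ≤ φ r := fun r hr ↦ by
    rw [← h.apply_eps]
    exact hmono ⟨le_rfl, hR.1⟩ hr hr.1
  have hinj : InjOn f (Icc ε R) := by
    refine StrictMonoOn.injOn fun r hr s hs hrs ↦ ?_
    exact add_lt_add_of_lt_of_le hrs (hmono hr hs hrs.le)
  set g := Function.invFunOn f (Icc ε R) with hg
  have hgf : ∀ r ∈ Icc ε R, g (f r) = r := hinj.leftInvOn_invFunOn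
  have hdiff : ∀ r ∈ Icc ε R, ∀ s ∈ Icc ε R, |r - s| ≤ |f r - f s| ∧ |φ r - φ s| ≤ |f r - f s| := by
    intro r hr s hs
    refine abs_sub_le_abs_sub_of_monotone ?_
    rcases le_total r s with hrs | hrs
    · exact Or.inl ⟨hrs, hmono hr hs hrs⟩
    · exact Or.inr ⟨hrs, hmono hs hr hrs⟩
  have piece : ∀ σ : ℝ, |σ| = 1 →
      μHE[n] (gluingPiece n k ε (fun r ↦ σ * φ r) ∩ {x | polarAngle x ≤ R}) ≤
        ENNReal.ofReal (C * R ^ (n - k)) := by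
    intro σ hσ
    have hσφ : ∀ r ∈ Icc ε R, |σ * φ r| < 1 / 2 := fun r hr ↦ by
      rw [abs_mul, hσ, one_mul]; exact h.abs_lt_half r (hsub r hr)
    have hρ : ∀ r ∈ Icc ε R, |1 + σ * φ r| ≤ 2 := fun r hr ↦ by
      have := abs_lt.1 (hσφ r hr)
      rw [abs_le]; constructor <;> linarith
    have hρd : ∀ r ∈ Icc ε R, ∀ s ∈ Icc ε R,
        |(1 + σ * φ r) - (1 + σ * φ s)| ≤ |f r - f s| := fun r hr s hs ↦ by
      rw [show (1 + σ * φ r) - (1 + σ * φ s) = σ * (φ r - φ s) by ring, abs_mul, hσ, one_mul]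
      exact (hdiff r hr s hs).2
    have := H (n - k) (by lia) n (by lia) R hR0 (f '' Icc ε R) ?_
      (fun t ↦ (1 + σ * φ (g t)) * sin (g t)) (fun t ↦ (1 + σ * φ (g t)) * cos (g t)) ?_ ?_ ?_ ?_
    · rw [show n - k - 1 + 1 = n - k by lia] at this
      refine (measure_mono ?_).trans this
      rintro x ⟨⟨⟨y, z, r⟩, ⟨hy, hz, hr⟩, rfl⟩, hx⟩
      rw [mem_sphere_zero_iff_norm] at hy hz
      have hpos : 0 < 1 + σ * φ r := by
        have := h.abs_lt_half r hr
        have h2 : |σ * φ r| < 1 / 2 := by rw [abs_mul, hσ, one_mul]; exact this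
        linarith [(abs_lt.1 h2).1]
      obtain ⟨h1, -⟩ := polarAngle_toLp hy hz hpos (hε.le.trans hr.1) hr.2
      have hrR : r ≤ R := h1.ge.trans hx
      have hr' : r ∈ Icc ε R := ⟨hr.1, hrR⟩
      refine ⟨f r, mem_image_of_mem f hr', y, z, hy, hz, ?_⟩
      rw [hgf r hr', mul_smul, mul_smul]
      rfl
    · rintro _ ⟨r, hr, rfl⟩
      have h1 := hφ0 r hr
      have h2 := h.neck_le_self (r := r) ⟨hr.1, by linarith [hr.2, hR.2]⟩
      constructor
      · change 0 ≤ r + φ r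
        linarith [hr.1]
      · change r + φ r ≤ 2 * R
        linarith [hr.2]
    · rintro _ ⟨r, hr, rfl⟩
      simp only [hgf r hr]
      rw [abs_mul]
      have h0 : 0 ≤ r := hε.le.trans hr.1
      have h1 : |sin r| ≤ R := by
        rw [abs_of_nonneg (Real.sin_nonneg_of_nonneg_of_le_pi h0 (by linarith [(hsub r hr).2]))]
        exact (Real.sin_le h0).trans hr.2
      exact mul_le_mul (hρ r hr) h1 (abs_nonneg _) (by norm_num)
    · rintro _ ⟨r, hr, rfl⟩
      simp only [hgf r hr]
      rw [abs_mul]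
      calc _ ≤ 2 * 1 := mul_le_mul (hρ r hr) (Real.abs_cos_le_one r) (abs_nonneg _) (by norm_num)
        _ = 2 := by norm_num
    · rintro _ ⟨r, hr, rfl⟩ _ ⟨s, hs, rfl⟩
      simp only [hgf r hr, hgf s hs]
      refine abs_mul_sub_mul_le (hρd r hr s hs) (hρ s hs) ?_ (Real.abs_sin_le_one r)
      exact (abs_sin_sub_sin_le r s).trans (hdiff r hr s hs).1
    · rintro _ ⟨r, hr, rfl⟩ _ ⟨s, hs, rfl⟩
      simp only [hgf r hr, hgf s hs]
      refine abs_mul_sub_mul_le (hρd r hr s hs) (hρ s hs) ?_ (Real.abs_cos_le_one r)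
      exact (abs_cos_sub_cos_le r s).trans (hdiff r hr s hs).1
  have e1 := piece 1 (by simp)
  have e2 := piece (-1) (by simp)
  simp only [one_mul] at e1
  simp only [neg_one_mul] at e2
  unfold gluedHypersurface
  rw [union_inter_distrib_right, add_mul, ENNReal.ofReal_add (by positivity) (by positivity)]
  exact (measure_union_le _ _).trans (add_le_add e1 e2)

/-- The hypersurface contains a fixed part of a sphere of radius at least `1`. -/
theorem exists_le_measure_glued {n k : ℕ} (hk : k + 2 ≤ n) : ∃ c : ℝ≥0∞, 0 < c ∧
    ∀ (a ε : ℝ) (φ : ℝ → ℝ), IsSmallGluingProfile n k a ε φ →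
      c ≤ μHE[n] (gluedHypersurface n k ε φ) := by
  have hnk : 0 < n - k := by lia
  -- A unit vector on the equator. Projection along `e` does not increase Hausdorff measure, and the
  -- cap of the outer sphere around `e` covers a fixed ball.
  set e : SplitSpace n k := WithLp.toLp 2 (EuclideanSpace.single ⟨0, hnk⟩ 1, 0) with he
  have he1 : ‖e‖ = 1 := by
    rw [he, WithLp.prod_norm_eq_of_L2]
    simp
  have he0 : e ≠ 0 := norm_ne_zero_iff.1 (by rw [he1]; norm_num)
  have hes : e.snd = 0 := rfl
  let K : Submodule ℝ (SplitSpace n k) := (ℝ ∙ e)ᗮ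
  have hK : Module.finrank ℝ K = n := by
    have : Fact (Module.finrank ℝ (SplitSpace n k) = n + 1) := ⟨finrank_splitSpace hk⟩
    exact Submodule.finrank_orthogonal_span_singleton he0
  refine ⟨μHE[n] (Metric.ball (0 : K) (1 / 4)), ?_, fun a ε φ h ↦ ?_⟩
  -- The dimension is generalized so that it can be identified with that of the subspace, where the
  -- measure is positive on open sets.
  · have hpos : ∀ d, Module.finrank ℝ K = d →
        0 < (μHE[d] : Measure K) (Metric.ball (0 : K) (1 / 4)) := by
      rintro d rfl
      exact Metric.isOpen_ball.measure_pos _ ⟨0, by simp⟩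
    exact hpos n hK
  · have hproj : μHE[n] (K.orthogonalProjectionOnto '' gluedHypersurface n k ε φ) ≤
        μHE[n] (gluedHypersurface n k ε φ) := by
      rw [Measure.euclideanHausdorffMeasure_def, Measure.euclideanHausdorffMeasure_def,
        Measure.smul_apply, Measure.smul_apply]
      gcongr
      exact hausdorffMeasure_orthogonalProjectionOnto_le K _ _ (Nat.cast_nonneg n)
    refine (measure_mono fun v hv ↦ ?_).trans hproj
    rw [mem_ball_zero_iff] at hv
    obtain ⟨b, -, hb⟩ := h.eq_const
    have hpi := Real.pi_pos
    have hlt := h.lt_pi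
    have hbpos : 0 < b := by
      rw [← hb (π / 2) ⟨h.lt_pi_div_two.le, le_rfl⟩]
      exact h.pos ⟨by linarith [h.lt_pi_div_two, h.a_pos], le_rfl⟩
    set τ := √((1 + b) ^ 2 - ‖v‖ ^ 2) with hτ
    have hτ2 : τ ^ 2 = (1 + b) ^ 2 - ‖v‖ ^ 2 := Real.sq_sqrt (by nlinarith [norm_nonneg v])
    have hve : ⟪e, (v : SplitSpace n k)⟫ = 0 := Submodule.mem_orthogonal_singleton_iff_inner_right.1 v.2
    set x : SplitSpace n k := v + τ • e with hx
    have hxn : ‖x‖ = 1 + b := by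
      rw [← sq_eq_sq₀ (norm_nonneg _) (by linarith), hx, norm_add_sq_real, real_inner_smul_right,
        real_inner_comm, hve, norm_smul, he1, Real.norm_eq_abs, mul_one, sq_abs, hτ2]
      simp
    have hx0 : x ≠ 0 := norm_ne_zero_iff.1 (by rw [hxn]; positivity)
    -- The second component of `x` is that of `v`, of norm below `1/4`, so the cosine of the angle
    -- is below `1/2` and the point lies in the constant part of the profile.
    have hang : π / 3 ≤ polarAngle x := by
      by_contra hcon
      push Not at hcon
      have h1 : cos (π / 3) < cos (polarAngle x) :=
        Real.cos_lt_cos_of_nonneg_of_le_pi (polarAngle_nonneg x) (by linarith) hcon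
      rw [Real.cos_pi_div_three, cos_polarAngle hx0, hxn, lt_div_iff₀ (by positivity)] at h1
      have h2 : x.snd = (v : SplitSpace n k).snd := by
        rw [hx]
        change (v : SplitSpace n k).snd + τ • e.snd = _
        rw [hes, smul_zero, add_zero]
      have h3 : ‖(v : SplitSpace n k).snd‖ ≤ ‖v‖ := WithLp.norm_snd_le _ _
      rw [h2] at h1
      linarith
    refine ⟨x, h.mem_glued_iff.2 ⟨hx0, ⟨?_, polarAngle_le x⟩, Or.inl ?_⟩, ?_⟩
    · linarith [h.a_pos]
    · rw [hxn, hb _ ⟨by linarith, polarAngle_le x⟩]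
    · rw [hx, map_add, map_smul]
      have h1 : K.orthogonalProjectionOnto e = 0 := by
        refine Submodule.orthogonalProjectionOnto_eq_zero_iff.2 ?_
        rw [Submodule.orthogonal_orthogonal]
        exact Submodule.mem_span_singleton_self e
      rw [h1, smul_zero, add_zero, Submodule.orthogonalProjectionOnto_mem_subspace_eq_self]

end IsSmallGluingProfile

/-! ### Renormalized integrals and the dyadic sum over the neck -/

section Renormalized

/-- Contributions proportional to the volume survive normalization, and fixed ones are absorbed by
the lower volume bound. Finiteness of the volume is not needed, since `m⁻¹ * m ≤ 1` for every
extended `m`. -/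
theorem lintegral_inv_smul_restrict_le {X : Type*} [MeasurableSpace X] {μ : Measure X} {M : Set X}
    {f : X → ℝ≥0∞} {c D K : ℝ≥0∞} (h : ∫⁻ x in M, f x ∂μ ≤ D * μ M + K) (hc : c ≤ μ M) :
    ∫⁻ x, f x ∂((μ M)⁻¹ • μ.restrict M) ≤ D + c⁻¹ * K := by
  rw [lintegral_smul_measure, smul_eq_mul]
  calc (μ M)⁻¹ * ∫⁻ x in M, f x ∂μ ≤ (μ M)⁻¹ * (D * μ M + K) := by gcongr
    _ = D * ((μ M)⁻¹ * μ M) + (μ M)⁻¹ * K := by ring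
    _ ≤ D * 1 + c⁻¹ * K := by
        gcongr
        exact ENNReal.inv_mul_le_one _
    _ = D + c⁻¹ * K := by rw [mul_one]

theorem setLIntegral_le_const_mul {X : Type*} [MeasurableSpace X] {μ : Measure X} {S : Set X}
    (hS : MeasurableSet S) {f : X → ℝ≥0∞} {c : ℝ≥0∞} (h : ∀ x ∈ S, f x ≤ c) :
    ∫⁻ x in S, f x ∂μ ≤ c * μ S :=
  (setLIntegral_mono' hS h).trans (setLIntegral_const S c).le

theorem measurable_polarAngle {n k : ℕ} :
    Measurable (polarAngle : SplitSpace n k → ℝ) := by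
  unfold polarAngle
  have h1 : Continuous fun x : SplitSpace n k ↦ ‖x.fst‖ :=
    continuous_norm.comp (WithLp.continuous_fst 2 _ _)
  exact Real.measurable_arcsin.comp (h1.measurable.div continuous_norm.measurable)

end Renormalized

namespace IsSmallGluingProfile

variable {n k : ℕ} {a ε r : ℝ} {φ : ℝ → ℝ} {x : SplitSpace n k}

theorem measurableSet_glued (h : IsSmallGluingProfile n k a ε φ) :
    MeasurableSet (gluedHypersurface n k ε φ) := h.isCompact_glued.isClosed.measurableSet

theorem glued_subset_union : gluedHypersurface n k ε φ ⊆
    (gluedHypersurface n k ε φ ∩ {x | polarAngle x ≤ r}) ∪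
      (gluedHypersurface n k ε φ ∩ {x | r ≤ polarAngle x}) := fun x hx ↦
  (le_total (polarAngle x) r).imp (fun h ↦ ⟨hx, h⟩) fun h ↦ ⟨hx, h⟩

theorem setLIntegral_glued_le (f : SplitSpace n k → ℝ≥0∞) (r : ℝ) :
    ∫⁻ x in gluedHypersurface n k ε φ, f x ∂μHE[n] ≤
      ∫⁻ x in gluedHypersurface n k ε φ ∩ {x | polarAngle x ≤ r}, f x ∂μHE[n] +
        ∫⁻ x in gluedHypersurface n k ε φ ∩ {x | r ≤ polarAngle x}, f x ∂μHE[n] :=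
  (lintegral_mono_set glued_subset_union).trans (lintegral_union_le _ _ _)

/-- The curvature of the catenoidal neck is bounded in `L^{n-k}`: the dyadic shells of the neck
contribute a geometric series. -/
theorem setLIntegral_neck_le (h : IsSmallGluingProfile n k a ε φ) {C c : ℝ} (hC : 0 ≤ C)
    (hc : 0 ≤ c) (hvol : ∀ R ∈ Icc ε a,
      μHE[n] (gluedHypersurface n k ε φ ∩ {x | polarAngle x ≤ R}) ≤
        ENNReal.ofReal (C * R ^ (n - k))) :
    ∫⁻ x in gluedHypersurface n k ε φ ∩ {x | polarAngle x ≤ a},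
      ENNReal.ofReal ((c * |(ε / polarAngle x) ^ (n - k - 1) / polarAngle x|) ^ (n - k)) ∂μHE[n] ≤
      ENNReal.ofReal (C * (2 * c) ^ (n - k) * 2) := by
  have hε := h.eps_pos
  have hk := h.codim
  set M := gluedHypersurface n k ε φ
  -- Shells on which the angle lies between `2^j ε` and `2^(j+1) ε`; the minimum with `a` keeps the
  -- outer radius in the range of the volume bound.
  set S : ℕ → Set (SplitSpace n k) := fun j ↦
    (M ∩ {x | polarAngle x ≤ min (2 ^ (j + 1) * ε) a}) ∩ {x | 2 ^ j * ε ≤ polarAngle x} with hS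
  have hcover : M ∩ {x | polarAngle x ≤ a} ⊆ ⋃ j, S j := by
    rintro x ⟨hx, hxa⟩
    have hxε := (h.mem_glued_iff.1 hx).2.1.1
    obtain ⟨j, h1, h2⟩ := exists_nat_pow_near ((one_le_div hε).2 hxε) one_lt_two
    rw [le_div_iff₀ hε] at h1
    rw [div_lt_iff₀ hε] at h2
    exact mem_iUnion.2 ⟨j, ⟨hx, le_min h2.le hxa⟩, h1⟩
  have hmeas : ∀ j, MeasurableSet (S j) := fun j ↦
    (h.measurableSet_glued.inter (measurableSet_le measurable_polarAngle measurable_const)).inter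
      (measurableSet_le measurable_const measurable_polarAngle)
  have hshell : ∀ j, ∫⁻ x in S j,
      ENNReal.ofReal ((c * |(ε / polarAngle x) ^ (n - k - 1) / polarAngle x|) ^ (n - k)) ∂μHE[n] ≤
      ENNReal.ofReal (C * (2 * c) ^ (n - k) * (1 / 2) ^ j) := by
    intro j
    set u : ℝ := (1 / 2) ^ j with hu
    have hu0 : 0 < u := by positivity
    have hu1 : u ≤ 1 := pow_le_one₀ (by norm_num) (by norm_num)
    have hu2 : (2 : ℝ) ^ j = u⁻¹ := by rw [hu, one_div, inv_pow, inv_inv]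
    have h2j : ε ≤ 2 ^ (j + 1) * ε :=
      le_mul_of_one_le_left hε.le (one_le_pow₀ (by norm_num))
    have hpt : ∀ x ∈ S j,
        ENNReal.ofReal ((c * |(ε / polarAngle x) ^ (n - k - 1) / polarAngle x|) ^ (n - k)) ≤
        ENNReal.ofReal ((c * (u ^ (n - k) / ε)) ^ (n - k)) := by
      intro x hx
      have hr : u⁻¹ * ε ≤ polarAngle x := by rw [← hu2]; exact hx.2
      have hr0 : 0 < polarAngle x := lt_of_lt_of_le (by positivity) hr
      refine ENNReal.ofReal_le_ofReal (pow_le_pow_left₀ (by positivity) ?_ _)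
      gcongr
      rw [abs_of_nonneg (by positivity)]
      have e1 : ε / polarAngle x ≤ u := by
        rw [div_le_iff₀ hr0]
        calc ε = u * (u⁻¹ * ε) := by field_simp
          _ ≤ u * polarAngle x := by gcongr
      calc (ε / polarAngle x) ^ (n - k - 1) / polarAngle x =
            (ε / polarAngle x) ^ (n - k - 1) * (ε / polarAngle x) / ε := by field_simp
        _ = (ε / polarAngle x) ^ (n - k) / ε := by rw [← pow_succ, show n - k - 1 + 1 = n - k by lia]
        _ ≤ u ^ (n - k) / ε := by gcongr
    refine (setLIntegral_le_const_mul (hmeas j) hpt).trans ?_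
    have hv : μHE[n] (S j) ≤ ENNReal.ofReal (C * (2 * u⁻¹ * ε) ^ (n - k)) := by
      refine (measure_mono inter_subset_left).trans ((hvol _ ⟨le_min h2j h.eps_lt.le,
        min_le_right _ _⟩).trans (ENNReal.ofReal_le_ofReal ?_))
      gcongr
      · exact le_min (hε.le.trans h2j) h.a_pos.le
      · refine (min_le_left _ _).trans (le_of_eq ?_)
        rw [pow_succ, hu2]
        ring
    refine (mul_le_mul_right hv _).trans ?_
    rw [← ENNReal.ofReal_mul (by positivity)]
    refine ENNReal.ofReal_le_ofReal ?_
    -- The exponent `n - k` is scale invariant: `ε` disappears, leaving `u^((n-k-1)(n-k)) ≤ u =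
    -- 2^(-j)`.
    have e2 : (c * (u ^ (n - k) / ε)) ^ (n - k) * (C * (2 * u⁻¹ * ε) ^ (n - k)) =
        C * (2 * c) ^ (n - k) * (u ^ (n - k - 1)) ^ (n - k) := by
      have e3 : c * (u ^ (n - k) / ε) * (2 * u⁻¹ * ε) = 2 * c * u ^ (n - k - 1) := by
        rw [show n - k = n - k - 1 + 1 by lia, pow_succ]
        simp only [add_tsub_cancel_right]
        field_simp
      rw [mul_left_comm, ← mul_pow, e3, mul_pow, mul_assoc]
    rw [e2]
    gcongr
    rw [← pow_mul]
    exact pow_le_of_le_one hu0.le hu1 (Nat.mul_ne_zero (by lia) (by lia))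
  refine (lintegral_mono_set hcover).trans ((lintegral_iUnion_le S _).trans
    ((ENNReal.tsum_le_tsum hshell).trans (le_of_eq ?_)))
  rw [← ENNReal.ofReal_tsum_of_nonneg (fun j ↦ by positivity)
    (summable_geometric_two.mul_left _), tsum_mul_left, tsum_geometric_two]

end IsSmallGluingProfile

/-! ### Asymptotics of admissible families -/

namespace IsGluingFamily

variable {n k : ℕ} {a : ℝ} {φ : ℝ → ℝ → ℝ}

theorem exists_supNorm_meanCurvature_le (h : IsGluingFamily n k a φ) (hk : k + 2 ≤ n) (ha : 0 < a)
    (ha' : a < π / 10) : ∃ C : ℝ, 1 ≤ C ∧ ∀ᶠ ε in 𝓝[>] 0, ∀ x ∈ gluedHypersurface n k ε (φ ε),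
      |meanCurvature (gluedHypersurface n k ε (φ ε)) x| ≤ C := by
  have hpi := Real.pi_pos
  refine ⟨9 * (n - k - 1 : ℕ) + 4 + k * 4, ?_, ?_⟩
  · have h1 : (0 : ℝ) ≤ (n - k - 1 : ℕ) := Nat.cast_nonneg _
    have h2 : (0 : ℝ) ≤ k := Nat.cast_nonneg _
    linarith
  filter_upwards [h.eventually_isSmallGluingProfile hk ha ha',
    h.eventually_curvature_far hk ha ha' ha (by linarith) one_pos le_rfl] with ε h1 h2 x hx
  rcases le_total (polarAngle x) a with h3 | h3
  · exact h1.abs_meanCurvature_neck_le hx h3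
  · have h4 := abs_le.1 (h2 x hx h3).1
    have h5 : (0 : ℝ) ≤ (n - k - 1 : ℕ) := Nat.cast_nonneg _
    have h6 : (0 : ℝ) ≤ k := Nat.cast_nonneg _
    rw [abs_le]
    constructor <;> linarith

theorem exists_renormLpNorm_le (h : IsGluingFamily n k a φ) (hk : k + 2 ≤ n) (ha : 0 < a)
    (ha' : a < π / 10) : ∃ C : ℝ, ∀ᶠ ε in 𝓝[>] 0,
        renormLpNorm n (gluedHypersurface n k ε (φ ε)) ((n - k : ℕ) : ℝ≥0∞)
          (normSecondFundamentalForm (gluedHypersurface n k ε (φ ε))) ≤ ENNReal.ofReal C := by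
  have hpi := Real.pi_pos
  obtain ⟨C, hC, hvol⟩ := IsSmallGluingProfile.exists_measure_neck_le hk
  obtain ⟨v, hv, hlow⟩ := IsSmallGluingProfile.exists_le_measure_glued hk
  set m := n - k with hm
  have hm0 : m ≠ 0 := by lia
  -- The factor `2`, like `80 = 2 · 40`, comes from `(x + y)^m ≤ (2x)^m + (2y)^m` for nonnegative
  -- `x`, `y`.
  set c : ℝ := 2 * (16 + 48 * (n - k - 1 : ℕ)) with hc
  have hc0 : 0 ≤ c := by positivity
  set D : ℝ≥0∞ := ENNReal.ofReal (80 ^ m) + ENNReal.ofReal (24 ^ m)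
  set K : ℝ≥0∞ := ENNReal.ofReal (C * (2 * c) ^ m * 2)
  have hfin : D + v⁻¹ * K ≠ ⊤ := by
    refine ENNReal.add_ne_top.2 ⟨ENNReal.add_ne_top.2 ⟨ENNReal.ofReal_ne_top, ENNReal.ofReal_ne_top⟩,
      ENNReal.mul_ne_top (ENNReal.inv_ne_top.2 hv.ne') ENNReal.ofReal_ne_top⟩
  refine ⟨((D + v⁻¹ * K) ^ (1 / (m : ℝ))).toReal, ?_⟩
  filter_upwards [h.eventually_isSmallGluingProfile hk ha ha',
    h.eventually_curvature_far hk ha ha' ha (by linarith) one_pos le_rfl] with ε h1 h2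
  set M := gluedHypersurface n k ε (φ ε)
  rw [ENNReal.ofReal_toReal (ENNReal.rpow_ne_top_of_nonneg (by positivity) hfin), renormLpNorm,
    eLpNorm_eq_lintegral_rpow_enorm_toReal (by exact_mod_cast hm0) (ENNReal.natCast_ne_top m),
    ENNReal.toReal_natCast]
  refine ENNReal.rpow_le_rpow (lintegral_inv_smul_restrict_le ?_ (hlow a ε (φ ε) h1)) (by positivity)
  have hpow : ∀ x, ‖normSecondFundamentalForm M x‖ₑ ^ (m : ℝ) =
      ENNReal.ofReal (normSecondFundamentalForm M x ^ m) := fun x ↦ by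
    rw [ENNReal.rpow_natCast, Real.enorm_of_nonneg (normSecondFundamentalForm_nonneg M x),
      ENNReal.ofReal_pow (normSecondFundamentalForm_nonneg M x)]
  simp only [hpow]
  refine (IsSmallGluingProfile.setLIntegral_glued_le _ a).trans ?_
  have hnear : ∀ x ∈ M ∩ {x | polarAngle x ≤ a},
      ENNReal.ofReal (normSecondFundamentalForm M x ^ m) ≤ ENNReal.ofReal (80 ^ m) +
        ENNReal.ofReal ((c * |(ε / polarAngle x) ^ (n - k - 1) / polarAngle x|) ^ m) := by
    rintro x ⟨hx, hxa⟩
    set g := |(ε / polarAngle x) ^ (n - k - 1) / polarAngle x| with hg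
    have hg0 : 0 ≤ g := abs_nonneg _
    have e1 : normSecondFundamentalForm M x ≤ 40 + (16 + 48 * (n - k - 1 : ℕ)) * g :=
      normSecondFundamentalForm_le (by positivity) (h1.abs_secondFundamentalForm_neck_le hx hxa)
    rw [← ENNReal.ofReal_add (by positivity) (by positivity)]
    refine ENNReal.ofReal_le_ofReal
      ((pow_le_pow_left₀ (normSecondFundamentalForm_nonneg M x) e1 m).trans ?_)
    rcases le_total 40 ((16 + 48 * (n - k - 1 : ℕ)) * g) with e2 | e2
    · have e3 : (40 + (16 + 48 * (n - k - 1 : ℕ)) * g) ^ m ≤ (c * g) ^ m :=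
        pow_le_pow_left₀ (by positivity) (by rw [hc]; linarith) m
      have : (0 : ℝ) ≤ 80 ^ m := by positivity
      linarith
    · have e3 : (40 + (16 + 48 * (n - k - 1 : ℕ)) * g) ^ m ≤ 80 ^ m :=
        pow_le_pow_left₀ (by positivity) (by linarith) m
      have : 0 ≤ (c * g) ^ m := by positivity
      linarith
  have hfar : ∀ x ∈ M ∩ {x | a ≤ polarAngle x},
      ENNReal.ofReal (normSecondFundamentalForm M x ^ m) ≤ ENNReal.ofReal (24 ^ m) := by
    rintro x ⟨hx, hxa⟩
    refine ENNReal.ofReal_le_ofReal (pow_le_pow_left₀ (normSecondFundamentalForm_nonneg M x) ?_ m)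
    exact normSecondFundamentalForm_le (by norm_num) (h2 x hx hxa).2
  have i1 := setLIntegral_mono' (μ := μHE[n]) (h1.measurableSet_glued.inter
    (measurableSet_le measurable_polarAngle measurable_const)) hnear
  rw [lintegral_add_left measurable_const, setLIntegral_const] at i1
  have i2 := setLIntegral_le_const_mul (μ := μHE[n]) (h1.measurableSet_glued.inter
    (measurableSet_le measurable_const measurable_polarAngle)) hfar
  have i3 := h1.setLIntegral_neck_le hC.le hc0 (hvol a ε (φ ε) h1)
  refine (add_le_add i1 i2).trans ?_
  calc ENNReal.ofReal (80 ^ m) * μHE[n] (M ∩ {x | polarAngle x ≤ a}) +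
        ∫⁻ x in M ∩ {x | polarAngle x ≤ a}, ENNReal.ofReal
          ((c * |(ε / polarAngle x) ^ (n - k - 1) / polarAngle x|) ^ m) ∂μHE[n] +
        ENNReal.ofReal (24 ^ m) * μHE[n] (M ∩ {x | a ≤ polarAngle x})
      ≤ ENNReal.ofReal (80 ^ m) * μHE[n] M + K + ENNReal.ofReal (24 ^ m) * μHE[n] M := by
        gcongr
        · exact inter_subset_left
        · exact inter_subset_left
    _ = D * μHE[n] M + K := by ring

/-- Split at a fixed angle `δ`. Beyond it `|H - 1| ≤ δ` once `ε` is small; below it `|H - 1|` is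
bounded on a set of volume `O(δ^(n-k))`. -/
theorem tendsto_renormLpNorm_meanCurvature_sub_one (h : IsGluingFamily n k a φ) (hk : k + 2 ≤ n)
    (ha : 0 < a) (ha' : a < π / 10) :
    Tendsto (fun ε ↦ renormLpNorm n (gluedHypersurface n k ε (φ ε)) 1
      (fun p ↦ meanCurvature (gluedHypersurface n k ε (φ ε)) p - 1)) (𝓝[>] 0) (𝓝 0) := by
  have hpi := Real.pi_pos
  obtain ⟨C, hC, hvol⟩ := IsSmallGluingProfile.exists_measure_neck_le hk
  obtain ⟨v, hv, hlow⟩ := IsSmallGluingProfile.exists_le_measure_glued hk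
  obtain ⟨B, hB, hH⟩ := h.exists_supNorm_meanCurvature_le hk ha ha'
  rw [ENNReal.tendsto_nhds_zero]
  intro ζ hζ
  have hlim : Tendsto (fun δ : ℝ ↦ ENNReal.ofReal δ + v⁻¹ *
      ENNReal.ofReal ((B + 1) * (C * δ ^ (n - k)))) (𝓝[>] 0) (𝓝 0) := by
    have h1 : Tendsto (fun δ : ℝ ↦ ENNReal.ofReal δ) (𝓝 0) (𝓝 0) := by
      simpa using (ENNReal.continuous_ofReal.tendsto (0 : ℝ))
    have h2 : Tendsto (fun δ : ℝ ↦ ENNReal.ofReal ((B + 1) * (C * δ ^ (n - k)))) (𝓝 0) (𝓝 0) := by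
      have : Continuous fun δ : ℝ ↦ ENNReal.ofReal ((B + 1) * (C * δ ^ (n - k))) :=
        ENNReal.continuous_ofReal.comp (by fun_prop)
      simpa [zero_pow (show n - k ≠ 0 by lia)] using this.tendsto 0
    have h3 := ENNReal.Tendsto.const_mul h2 (Or.inr (ENNReal.inv_ne_top.2 hv.ne'))
    have h4 := h1.add h3
    rw [mul_zero, add_zero] at h4
    exact h4.mono_left nhdsWithin_le_nhds
  -- `δ` is fixed before `ε` tends to `0` and serves both as cutting angle and as tolerance for the
  -- curvature.
  obtain ⟨δ, hδζ, hδ⟩ := ((ENNReal.tendsto_nhds_zero.1 hlim ζ hζ).and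
    (eventually_Ioo_nhdsGT (lt_min ha one_pos))).exists
  have hδa : δ < a := hδ.2.trans_le (min_le_left _ _)
  have hδ1 : δ < 1 := hδ.2.trans_le (min_le_right _ _)
  filter_upwards [h.eventually_isSmallGluingProfile hk ha ha', hH, eventually_Ioo_nhdsGT hδ.1,
    h.eventually_curvature_far hk ha ha' hδ.1 (by linarith) hδ.1 hδ1.le] with ε h1 h2 h3 h4
  set M := gluedHypersurface n k ε (φ ε)
  refine le_trans ?_ hδζ
  rw [renormLpNorm, eLpNorm_one_eq_lintegral_enorm]
  refine lintegral_inv_smul_restrict_le ?_ (hlow a ε (φ ε) h1)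
  refine (IsSmallGluingProfile.setLIntegral_glued_le _ δ).trans ?_
  have i1 := setLIntegral_le_const_mul (μ := μHE[n]) (c := ENNReal.ofReal (B + 1))
    (f := fun x ↦ ‖meanCurvature M x - 1‖ₑ) (h1.measurableSet_glued.inter
    (measurableSet_le measurable_polarAngle (measurable_const (a := δ)))) (by
      rintro x ⟨hx, -⟩
      rw [Real.enorm_eq_ofReal_abs]
      refine ENNReal.ofReal_le_ofReal ((abs_sub _ _).trans ?_)
      rw [abs_one]
      exact add_le_add_left (h2 x hx) 1)
  have i2 := setLIntegral_le_const_mul (μ := μHE[n]) (c := ENNReal.ofReal δ)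
    (f := fun x ↦ ‖meanCurvature M x - 1‖ₑ) (h1.measurableSet_glued.inter
    (measurableSet_le (measurable_const (a := δ)) measurable_polarAngle)) (by
      rintro x ⟨hx, hxδ⟩
      rw [Real.enorm_eq_ofReal_abs]
      exact ENNReal.ofReal_le_ofReal (h4 x hx hxδ).1)
  refine (add_le_add i1 i2).trans ?_
  rw [add_comm]
  refine add_le_add ?_ ?_
  · gcongr
    exact inter_subset_left
  · rw [ENNReal.ofReal_mul (by linarith)]
    gcongr
    exact hvol a ε (φ ε) h1 δ ⟨h3.2.le, hδa.le⟩

theorem tendsto_supNorm_norm_sub_one (h : IsGluingFamily n k a φ) (hk : k + 2 ≤ n)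
    (ha : 0 < a) (ha' : a < π / 10) :
    Tendsto (fun ε ↦ supNorm (gluedHypersurface n k ε (φ ε)) (fun p ↦ ‖p‖ - 1))
      (𝓝[>] 0) (𝓝 0) := by
  rw [ENNReal.tendsto_nhds_zero]
  intro ζ hζ
  obtain ⟨η, hη, hηζ⟩ : ∃ η : ℝ, 0 < η ∧ ENNReal.ofReal η ≤ ζ := by
    obtain ⟨η, h1, h2⟩ := ENNReal.lt_iff_exists_nnreal_btwn.1 hζ
    exact ⟨η, by exact_mod_cast h1, by rw [ENNReal.ofReal_coe_nnreal]; exact h2.le⟩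
  filter_upwards [h.eventually_isSmallGluingProfile hk ha ha', h.tendsto_zero η hη] with ε h1 h2
  refine iSup₂_le fun x hx ↦ le_trans ?_ hηζ
  obtain ⟨-, hr, hn⟩ := h1.mem_glued_iff.1 hx
  rw [Real.enorm_eq_ofReal_abs]
  refine ENNReal.ofReal_le_ofReal ?_
  change |‖x‖ - 1| ≤ η
  have h3 := (h2 _ hr).le
  rcases hn with hn | hn <;> rw [hn]
  · simpa using h3
  · simpa using h3

end IsGluingFamily

end

theorem mainTheorem7 (n k : ℕ) (hk : k + 2 ≤ n) (a : ℝ) (ha : 0 < a) (ha' : a < π / 10) :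
    (∃ φ : ℝ → ℝ → ℝ, IsGluingFamily n k a φ) ∧
    ∀ φ : ℝ → ℝ → ℝ, IsGluingFamily n k a φ →
      (∀ᶠ ε in 𝓝[>] 0, IsCompact (gluedHypersurface n k ε (φ ε)) ∧
        IsSmoothHypersurface (gluedHypersurface n k ε (φ ε))) ∧
      (∃ C : ℝ, ∀ᶠ ε in 𝓝[>] 0,
        supNorm (gluedHypersurface n k ε (φ ε))
          (meanCurvature (gluedHypersurface n k ε (φ ε))) ≤ ENNReal.ofReal C) ∧
      (∃ C : ℝ, ∀ᶠ ε in 𝓝[>] 0,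
        renormLpNorm n (gluedHypersurface n k ε (φ ε)) ((n - k : ℕ) : ℝ≥0∞)
          (normSecondFundamentalForm (gluedHypersurface n k ε (φ ε))) ≤ ENNReal.ofReal C) ∧
      Tendsto (fun ε ↦ renormLpNorm n (gluedHypersurface n k ε (φ ε)) 1
          (fun p ↦ meanCurvature (gluedHypersurface n k ε (φ ε)) p - 1)) (𝓝[>] 0) (𝓝 0) ∧
      Tendsto (fun ε ↦ supNorm (gluedHypersurface n k ε (φ ε)) (fun p ↦ ‖p‖ - 1))
        (𝓝[>] 0) (𝓝 0) := by
  refine ⟨⟨_, isGluingFamily_cutoffProfile hk ha ha'⟩, fun φ hφ ↦ ⟨?_, ?_,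
    hφ.exists_renormLpNorm_le hk ha ha', hφ.tendsto_renormLpNorm_meanCurvature_sub_one hk ha ha',
    hφ.tendsto_supNorm_norm_sub_one hk ha ha'⟩⟩
  · filter_upwards [hφ.eventually_isSmallGluingProfile hk ha ha'] with ε h
    exact ⟨h.isCompact_glued, h.isSmoothHypersurface⟩
  · obtain ⟨C, -, hC⟩ := hφ.exists_supNorm_meanCurvature_le hk ha ha'
    refine ⟨C, hC.mono fun ε h ↦ iSup₂_le fun x hx ↦ ?_⟩
    rw [Real.enorm_eq_ofReal_abs]
    exact ENNReal.ofReal_le_ofReal (h x hx)
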